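/- For $r\in(0,\tfrac12)$ let $Z_r=\{x\in\mathbf R^2 : \mathrm{dist}(x,\mathbf Z^2)>r/2\}$, and for $\epsilon\in(0,\tfrac14)$ let $\Omega_\epsilon=\{\epsilon z : z\in Z_\epsilon\}$, with $n_x$ the unit normal at $x\in\partial\Omega_\epsilon$ pointing into $\Omega_\epsilon$. Let $0\le f^{in}\in C_c(\mathbf R^2\times\mathbf S^1)$ and consider the problem $$ \begin{aligned} \partial_t f_\epsilon+v\cdot\nabla_x f_\epsilon&=0, && t>0,\ x\in\Omega_\epsilon,\ |v|=1,\\ f_\epsilon(t,x,v)&=0, && t>0,\ x\in\partial\Omega_\epsilon,\ v\cdot n_x>0,\\ f_\epsilon(0,x,v)&=f^{in}(x,v), && x\in\Omega_\epsilon,\ |v|=1, \end{aligned} $$ where $\partial_t+v\cdot\nabla_x$ is the derivative along characteristics, the initial and boundary values are attained along characteristics, and $f_\epsilon$ is extended by $0$ to the holes. This problem has a solution for each $\epsilon\in(0,\tfrac14)$. Let $f_\epsilon$ denote, for each $\epsilon\in(0,\tfrac14)$, a solution, and put $$f(t,x,v)=\frac{2f^{in}(x-tv,v)}{\pi^2t},\qquad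 A_\epsilon(t)=\iint\left(\frac1{|\ln\epsilon|}\int_\epsilon^{1/4}f_r(t,x,v)\frac{dr}r\right)\chi(x,v)\,dx\,dv ,$$ with $\chi\in C^1_c(\mathbf R^2\times\mathbf S^1)$, $\chi\ge0$. For each $t>0$ these integrals converge absolutely and $A_\epsilon(t)$ is bounded as $\epsilon\to0^+$. Moreover, for all such $f^{in}$, $\chi$ and $(f_\epsilon)$, $$ \limsup_{\epsilon\to0^+}A_\epsilon(t)=\iint f(t,x,v)\chi(x,v)\,dx\,dv+O\left(\frac1{t^2}\right),\qquad \liminf_{\epsilon\to0^+}A_\epsilon(t)=\iint f(t,x,v)\chi(x,v)\,dx\,dv+O\left(\frac1{t^2}\right) $$ as $t\to+\infty$. These estimates hold uniformly in the data in the following sense: there are absolute constants $C,T>0$ such that, for all $f^{in}$, $\chi$ and $(f_\epsilon)$ as above and all $t\ge T$, both $\left|\limsup_{\epsilon\to0^+}A_\epsilon(t)-\iint f\chi\,dx\,dv\right|$ and $\left|\liminf_{\epsilon\to0^+}A_\epsilon(t)-\iint f\chi\,dx\,dv\right|$ are at most $$\frac{C}{t^2}\,\sup_{v\in\mathbf S^1}\int_{\mathbf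 R^2}f^{in}(x-tv,v)\chi(x,v)\,dx .$$ Finally, $f$ is locally integrable on $(0,+\infty)\times\mathbf R^2\times\mathbf S^1$ and satisfies there $$\partial_tf+v\cdot\nabla_xf+\frac1tf=0$$ in the sense of distributions. -/

import Mathlib

open Set Filter Topology MeasureTheory
open scoped Manifold ContDiff Pointwise

noncomputable section

namespace PerforatedTransport

/-- The Euclidean plane `ℝ²`. -/
abbrev Plane : Type := EuclideanSpace ℝ (Fin 2)

/-- The unit circle `S¹` of velocities. -/
abbrev Circ : Type := Metric.sphere (0 : Plane) 1

/-- The phase space `ℝ² × S¹`. -/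
abbrev Phase : Type := Plane × Circ

/-- The measure `dv`: arc length on `S¹` (total mass `2π`). -/
def dv : Measure Circ := (volume : Measure Plane).toSphere

instance : IsFiniteMeasure dv := by
  unfold dv
  infer_instance

/-- The measure `dx dv` on `ℝ² × S¹`. -/
def dxdv : Measure Phase := (volume : Measure Plane).prod dv

/-- The lattice `ℤ²`. -/
def lattice : Set Plane := {x | ∀ i, ∃ n : ℤ, x i = n}

/-- `Z_r = {x ∈ ℝ² | dist (x, ℤ²) > r / 2}`. -/
def Z (r : ℝ) : Set Plane := {x | r / 2 < Metric.infDist x lattice}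

/-- The scaled perforated domain `Ω_ε = {ε z | z ∈ Z_ε}`. -/
def Omega (ε : ℝ) : Set Plane := ε • Z ε

/-- `n` is the unit normal to `∂Ω_ε` at `x` that points into `Ω_ε`, that is, away from the hole:
the holes are the closed disks of radius `ε² / 2` centred at the points of `ε ℤ²`. -/
def IsInwardNormal (ε : ℝ) (x n : Plane) : Prop :=
  ‖n‖ = 1 ∧ ∃ k ∈ lattice, x = ε • k + (ε ^ 2 / 2) • n

/-- `f` solves the free transport equation in `Ω_ε` with absorption at the holes and initial
data `fin`. As `fin` is only continuous, `∂_t f + v · ∇_x f` is the derivative of `f` along the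
field `(1, v, 0)`, and the initial and boundary values are attained along characteristics.
`f` is extended by `0` inside the holes. -/
structure IsSolution (ε : ℝ) (fin : Phase → ℝ) (f : ℝ → Phase → ℝ) : Prop where
  transport : ∀ t > 0, ∀ x ∈ Omega ε, ∀ v : Circ,
    HasDerivAt (fun s : ℝ => f (t + s) (x + s • (v : Plane), v)) 0 0
  initial : ∀ x ∈ Omega ε, ∀ v : Circ, f 0 (x, v) = fin (x, v)
  initial_trace : ∀ x ∈ Omega ε, ∀ v : Circ,
    ContinuousWithinAt (fun s : ℝ => f s (x + s • (v : Plane), v)) (Ici 0) 0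
  boundary : ∀ t > 0, ∀ x ∈ frontier (Omega ε), ∀ (v : Circ) (n : Plane),
    IsInwardNormal ε x n → 0 < inner ℝ (v : Plane) n → f t (x, v) = 0
  boundary_trace : ∀ t > 0, ∀ x ∈ frontier (Omega ε), ∀ (v : Circ) (n : Plane),
    IsInwardNormal ε x n → 0 < inner ℝ (v : Plane) n →
      ContinuousWithinAt (fun s : ℝ => f (t + s) (x + s • (v : Plane), v)) (Ici 0) 0
  zero_in_holes : ∀ t ≥ 0, ∀ x ∉ closure (Omega ε), ∀ v : Circ, f t (x, v) = 0

/-- `(1 / |ln ε|) ∫_ε^{1/4} f_r(t, x, v) dr / r`, at the point `p = (x, v)`. -/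
def cesaro (f : ℝ → ℝ → Phase → ℝ) (t ε : ℝ) (p : Phase) : ℝ :=
  1 / |Real.log ε| * ∫ r in ε..(1 / 4), f r t p / r

/-- The Cesàro average tested against `χ`. -/
def testedCesaro (f : ℝ → ℝ → Phase → ℝ) (χ : Phase → ℝ) (t ε : ℝ) : ℝ :=
  ∫ p, cesaro f t ε p * χ p ∂dxdv

/-- `f(t, x, v) = 2 f^in(x - t v, v) / (π² t)`. -/
def limitDensity (fin : Phase → ℝ) (t : ℝ) (p : Phase) : ℝ :=
  2 * fin (p.1 - t • (p.2 : Plane), p.2) / (Real.pi ^ 2 * t)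

/-- `χ ∈ C^1_c(ℝ² × S¹)`. -/
def IsC1c (χ : Phase → ℝ) : Prop :=
  ContMDiff (𝓘(ℝ, Plane).prod (𝓡 1)) 𝓘(ℝ, ℝ) 1 χ ∧ HasCompactSupport χ

/-- `φ ∈ C^∞_c((0, ∞) × ℝ² × S¹)`. -/
def IsTestFunction (φ : ℝ × Phase → ℝ) : Prop :=
  ContMDiff (𝓘(ℝ, ℝ).prod (𝓘(ℝ, Plane).prod (𝓡 1))) 𝓘(ℝ, ℝ) ∞ φ ∧
    HasCompactSupport φ ∧ tsupport φ ⊆ {q | 0 < q.1}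

/-- `∂_t φ + v · ∇_x φ` at the point `q = (t, x, v)`. -/
def transportDeriv (φ : ℝ × Phase → ℝ) (q : ℝ × Phase) : ℝ :=
  deriv (fun s : ℝ => φ (s, q.2)) q.1 +
    fderiv ℝ (fun y : Plane => φ (q.1, y, q.2.2)) q.2.1 (q.2.2 : Plane)

/-- `∂_t f + v · ∇_x f + f / t = 0` on `(0, ∞) × ℝ² × S¹` in the sense of distributions. -/
def SolvesDampedTransport (f : ℝ → Phase → ℝ) : Prop :=
  LocallyIntegrableOn (fun q : ℝ × Phase => f q.1 q.2) {q | 0 < q.1}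
      ((volume : Measure ℝ).prod dxdv) ∧
    ∀ φ : ℝ × Phase → ℝ, IsTestFunction φ →
      ∫ q in {q : ℝ × Phase | 0 < q.1}, (f q.1 q.2 * -transportDeriv φ q + f q.1 q.2 / q.1 * φ q)
        ∂((volume : Measure ℝ).prod dxdv) = 0

end PerforatedTransport

end

open PerforatedTransport

/-!
# The logarithmic average of free transport in a perforated plane

The holes of `Ω_r` are disks of radius `r² / 2` around the points of `r ℤ²`, and a particle is
absorbed by the first hole that it meets. Along characteristics a solution at time `t` is
therefore `f^in(x - t v, v)` if the backward trajectory of duration `t` from `(x, v)` meets no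
hole (`IsFree`), and `0` otherwise. The formulation leaves the values of a solution undetermined
only on trajectories that touch a hole tangentially or have an end on a boundary
(`IsTransversal`), and for each `(x, v)` these exceptional trajectories occur for countably many
`r` only. Hence the tested average of any solution is the logarithmic average `logAverage` over
`r` of the integral `freeInt` of `h(x, v) = f^in(x - t v, v) χ(x, v)` over the free trajectories
(`testedCesaro_eq`).

*Channels.* The lattice points lie on equidistant rows in the direction of any primitive
`a ∈ ℤ²`. The gaps between these rows, reduced by the holes, are channels. A trajectory inside a
channel is free (`isFree_of_fract_mem`). Conversely, Dirichlet's approximation theorem provides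
for every `v` a primitive `a` of length `O(1 / r)` that is almost parallel to `v`
(`exists_primitive_near`), and every free trajectory, shortened by the time `2` at either end, lies
in a channel of this direction (`IsFree.fract_mem`): otherwise it would pass between two
consecutive points of a row and one of them would be too close. Different channel directions do
not compete for the same velocity (`eq_of_primitive_near`). As the channels have period at most `r`,
they are equidistributed with respect to a fixed continuous function (`abs_integral_strip_sub_le`),
and the proportion of starting points in the channels of direction `a` is
`max 0 (1 - r |a| - (t / r) |v ∧ a|)` (`chanWeight`).

*Integration over `v` and `r`.* This weight is concentrated near `v = a / |a|`, and its integral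
over `v` is `r max 0 (1 - r |a|)² / (t |a|)`, up to replacing `t` by `t - 1` where the sine of an
angle is compared with the angle. Since `∫ max 0 (1 - r |a|)² dr = 1 / (3 |a|)`, the logarithmic average
becomes `1 / (3 t |ln ε|)` times the sum of `G(a / |a|) / |a|²` over the primitive `a` of length at
most `1 / ε`, where `G(v) = ∫ h(x, v) dx` (`velMass`). The logarithmic equidistribution of primitive
vectors (`tendsto_primSum_div_log`), which follows from Riemann sums over dyadic annuli and from
`ζ(2) = π² / 6`, shows that these sums are asymptotic to `(6 / π²) |ln ε| ∫ G dv`. This is the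
origin of the factor `2 / (π² t)`.

*The error.* The lower bound holds with `t` itself (`le_liminf_logAverage`) and the upper bound with
`t - 5` in place of `t` (`limsup_logAverage_le`), because of the time `4` lost at the ends of the
trajectories and the time `1` lost to the sine. As `1 / (t - 5) - 1 / t = O(1 / t²)`, both limits
satisfy the estimate, with constants that do not depend on the data.

*The limiting equation.* Along a characteristic the limit density is a multiple of `1 / t`, so that
the integrand of the weak formulation is the derivative of a multiple of `φ / t`
(`integral_characteristic`). The free transport preserves the measure
(`measurePreserving_transport`), and Fubini's theorem gives the claim.
-/
open PerforatedTransport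

/-! ### Polar coordinates and the arc length on the circle -/

/-- The unit vector `(cos θ, sin θ)`. -/
noncomputable def ang (θ : ℝ) : Circ := ⟨!₂[Real.cos θ, Real.sin θ], by
  simp [EuclideanSpace.norm_eq]⟩

@[simp] lemma ang_zero_coord (θ : ℝ) : (ang θ : Plane) 0 = Real.cos θ := rfl

@[simp] lemma ang_one_coord (θ : ℝ) : (ang θ : Plane) 1 = Real.sin θ := rfl

lemma continuous_ang : Continuous ang := by
  unfold ang
  fun_prop

/-- The identification of `ℝ × ℝ` with the plane. -/
def pair (z : ℝ × ℝ) : Plane := !₂[z.1, z.2]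

lemma measurePreserving_pair : MeasurePreserving pair := by
  have := (PiLp.volume_preserving_toLp (Fin 2)).comp (volume_preserving_finTwoArrow ℝ).symm
  convert! this using 1

lemma measurableEmbedding_pair : MeasurableEmbedding pair := by
  have := (MeasurableEquiv.toLp 2 (Fin 2 → ℝ)).measurableEmbedding.comp
     (MeasurableEquiv.finTwoArrow (α := ℝ)).symm.measurableEmbedding
  convert! this using 1

lemma pair_polar (ρ θ : ℝ) : pair (polarCoord.symm (ρ, θ)) = ρ • (ang θ : Plane) := by
  ext i; fin_cases i <;> simp [pair, ang]

lemma norm_sq_plane (y : Plane) : ‖y‖ ^ 2 = y 0 ^ 2 + y 1 ^ 2 := by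
  rw [EuclideanSpace.norm_sq_eq]
  simp

@[simp] lemma norm_circ (v : Circ) : ‖(v : Plane)‖ = 1 := by
  simp

lemma circ_sq (v : Circ) : (v : Plane) 0 ^ 2 + (v : Plane) 1 ^ 2 = 1 := by
  rw [← norm_sq_plane, norm_circ, one_pow]

/-- The direction `y / |y|` of a vector, with the value `(1, 0)` at the origin. -/
noncomputable def dir (y : Plane) : Circ := ⟨if y = 0 then (ang 0 : Plane) else ‖y‖⁻¹ • y, by
  split_ifs with h
  · exact (ang 0).2
  · simp [norm_smul, inv_mul_cancel₀ (norm_ne_zero_iff.2 h)]⟩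

lemma dir_coe {y : Plane} (h : y ≠ 0) : (dir y : Plane) = ‖y‖⁻¹ • y := by
  simp [dir, h]

lemma norm_smul_dir (y : Plane) : ‖y‖ • (dir y : Plane) = y := by
  by_cases h : y = 0
  · simp [h]
  · rw [dir_coe h, smul_inv_smul₀ (norm_ne_zero_iff.2 h)]

lemma dir_smul_circ {ρ : ℝ} (hρ : 0 < ρ) (v : Circ) : dir (ρ • (v : Plane)) = v := by
  have hv : (v : Plane) ≠ 0 := by
    intro h
    have := norm_circ v
    simp [h] at this
  ext1
  rw [dir_coe (smul_ne_zero hρ.ne' hv), norm_smul, norm_circ, Real.norm_of_nonneg hρ.le, mul_one,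
    inv_smul_smul₀ hρ.ne']

lemma dir_smul {ρ : ℝ} (hρ : 0 < ρ) (y : Plane) : dir (ρ • y) = dir y := by
  by_cases h : y = 0
  · simp [h]
  · have hy := norm_pos_iff.2 h
    conv_lhs => rw [← norm_smul_dir y, smul_smul]
    exact dir_smul_circ (mul_pos hρ hy) _

lemma measurable_dir : Measurable dir := by
  unfold dir
  refine Measurable.subtype_mk ?_
  exact Measurable.ite (measurableSet_eq) measurable_const (by fun_prop)

lemma continuousAt_dir {y : Plane} (h : y ≠ 0) : ContinuousAt dir y := by
  rw [Topology.IsInducing.subtypeVal.continuousAt_iff]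
  have h1 : ContinuousAt (fun y : Plane => ‖y‖⁻¹ • y) y := by
    have h2 : ContinuousAt (fun y : Plane => ‖y‖⁻¹) y :=
      continuous_norm.continuousAt.inv₀ (norm_ne_zero_iff.2 h)
    exact h2.smul continuousAt_id
  refine h1.congr ?_
  filter_upwards [isOpen_ne.mem_nhds h] with z hz
  simp [dir_coe hz]

lemma exists_ang_eq (v : Circ) : ∃ θ ∈ Icc (-Real.pi) Real.pi, ang θ = v := by
  have h := circ_sq v
  refine ⟨Complex.arg ⟨(v : Plane) 0, (v : Plane) 1⟩,
    Ioc_subset_Icc_self (Complex.arg_mem_Ioc _), ?_⟩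
  have hn : ‖(⟨(v : Plane) 0, (v : Plane) 1⟩ : ℂ)‖ = 1 := by
    rw [Complex.norm_eq_sqrt_sq_add_sq]
    simp [h]
  have h0 : (⟨(v : Plane) 0, (v : Plane) 1⟩ : ℂ) ≠ 0 := by
    intro h0
    rw [h0] at hn
    simp at hn
  ext i
  fin_cases i
  · simp [Complex.cos_arg h0, hn]
  · simp [Complex.sin_arg, hn]

/-- Arc length, defined as the spherical part of Lebesgue measure, is the image of Lebesgue measure
under the angle. Both describe the volume of the cones over subsets of the circle. -/
lemma measurePreserving_ang :
    MeasurePreserving ang (volume.restrict (Ioo (-Real.pi) Real.pi)) dv := by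
  refine ⟨continuous_ang.measurable, ?_⟩
  ext s hs
  have hs' : MeasurableSet (ang ⁻¹' s) := continuous_ang.measurable hs
  rw [Measure.map_apply continuous_ang.measurable hs, dv, Measure.toSphere_apply' _ hs]
  have hcone : (Ioo (0 : ℝ) 1 • (Subtype.val '' s) : Set Plane) =
      {y | ‖y‖ ∈ Ioo (0 : ℝ) 1 ∧ dir y ∈ s} := by
    ext y
    simp only [Set.mem_smul, mem_image, mem_ofPred_eq]
    constructor
    · rintro ⟨ρ, hρ, _, ⟨v, hv, rfl⟩, rfl⟩
      rw [dir_smul_circ hρ.1, norm_smul, norm_circ, mul_one, Real.norm_of_nonneg hρ.1.le]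
      exact ⟨hρ, hv⟩
    · rintro ⟨h1, h2⟩
      exact ⟨‖y‖, h1, _, ⟨_, h2, rfl⟩, norm_smul_dir y⟩
  have hm : MeasurableSet {y : Plane | ‖y‖ ∈ Ioo (0 : ℝ) 1 ∧ dir y ∈ s} :=
    (measurable_norm measurableSet_Ioo).inter (measurable_dir hs)
  have h1 : ∫⁻ ρ in Ioi (0 : ℝ), ENNReal.ofReal ρ * (Ioo (0 : ℝ) 1).indicator 1 ρ = 2⁻¹ := by
    have : ∀ ρ : ℝ, ENNReal.ofReal ρ * (Ioo (0 : ℝ) 1).indicator 1 ρ =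
        (Ioo (0 : ℝ) 1).indicator (fun ρ => ENNReal.ofReal ρ) ρ := by
      intro ρ
      by_cases h : ρ ∈ Ioo (0 : ℝ) 1 <;> simp [h]
    simp_rw [this]
    rw [lintegral_indicator measurableSet_Ioo, Measure.restrict_restrict measurableSet_Ioo,
      inter_eq_left.2 Ioo_subset_Ioi_self, ← ofReal_integral_eq_lintegral_ofReal]
    · rw [← integral_Ioc_eq_integral_Ioo, ← intervalIntegral.integral_of_le zero_le_one,
        integral_id, ← ENNReal.ofReal_ofNat 2, ← ENNReal.ofReal_inv_of_pos two_pos]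
      norm_num
    · exact (continuous_id.intervalIntegrable (μ := volume) 0 1).1.mono_set Ioo_subset_Ioc_self
    · exact (ae_restrict_iff' measurableSet_Ioo).2 (ae_of_all _ fun x hx => hx.1.le)
  have key : volume {y : Plane | ‖y‖ ∈ Ioo (0 : ℝ) 1 ∧ dir y ∈ s} =
      2⁻¹ * volume.restrict (Ioo (-Real.pi) Real.pi) (ang ⁻¹' s) := by
    rw [← measurePreserving_pair.measure_preimage_emb measurableEmbedding_pair,
      ← lintegral_indicator_one (measurePreserving_pair.measurable hm),
      ← lintegral_comp_polarCoord_symm, ← h1, ← lintegral_indicator_one hs',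
      ← lintegral_prod_mul, Measure.prod_restrict]
    · refine setLIntegral_congr_fun (measurableSet_Ioi.prod measurableSet_Ioo) ?_
      rintro ⟨ρ, θ⟩ ⟨h1, h2⟩
      have hρ : 0 < ρ := h1
      have h5 : polarCoord.symm (ρ, θ) ∈ pair ⁻¹' {y : Plane | ‖y‖ ∈ Ioo (0 : ℝ) 1 ∧ dir y ∈ s} ↔
          ρ ∈ Ioo (0 : ℝ) 1 ∧ ang θ ∈ s := by
        rw [mem_preimage, pair_polar, mem_ofPred_eq, dir_smul_circ hρ, norm_smul, norm_circ,
          mul_one, Real.norm_of_nonneg hρ.le]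
      by_cases h3 : ρ ∈ Ioo (0 : ℝ) 1 <;> by_cases h4 : ang θ ∈ s <;>
        simp only [indicator, h5, mem_preimage, h3, h4] <;> simp
    · exact (measurable_id.ennreal_ofReal.mul
        (measurable_one.indicator measurableSet_Ioo)).aemeasurable
    · exact (measurable_one.indicator hs').aemeasurable
  rw [hcone, key, ← mul_assoc]
  simp [ENNReal.mul_inv_cancel]

lemma continuous_integrable_dv {g : Circ → ℝ} (hg : Continuous g) : Integrable g dv :=
  hg.integrable_of_hasCompactSupport (HasCompactSupport.of_compactSpace g)

/-- The arc length integral may be computed over any period of the angle. -/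
lemma integral_dv_eq {g : Circ → ℝ} (hg : AEStronglyMeasurable g dv) (a : ℝ) :
    ∫ v, g v ∂dv = ∫ θ in (a - Real.pi)..(a + Real.pi), g (ang θ) := by
  have hp : Function.Periodic (fun θ => g (ang θ)) (2 * Real.pi) := by
    intro θ
    have : ang (θ + 2 * Real.pi) = ang θ := by
      ext i; fin_cases i <;> simp [ang]
    simp [this]
  have h := hp.intervalIntegral_add_eq (a - Real.pi) (-Real.pi)
  rw [show a - Real.pi + 2 * Real.pi = a + Real.pi by ring,
    show -Real.pi + 2 * Real.pi = Real.pi by ring] at h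
  rw [h, ← measurePreserving_ang.map_eq, integral_map continuous_ang.aemeasurable,
    intervalIntegral.integral_of_le (by linarith [Real.pi_pos]), integral_Ioc_eq_integral_Ioo]
  rwa [measurePreserving_ang.map_eq]

lemma dv_univ : dv.real univ = 2 * Real.pi := by
  have := integral_dv_eq (g := fun _ => (1 : ℝ)) aestronglyMeasurable_const 0
  simp only [integral_const, smul_eq_mul, mul_one, intervalIntegral.integral_const] at this
  rw [this]; ring

/-- Integration in polar coordinates of a product of a radial and an angular function. -/
lemma integral_radial_mul_angular (w : ℝ → ℝ) {g : Circ → ℝ} (hg : AEStronglyMeasurable g dv) :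
    ∫ y : Plane, w ‖y‖ * g (dir y) = (∫ ρ in Ioi (0 : ℝ), ρ * w ρ) * ∫ v, g v ∂dv := by
  rw [← measurePreserving_pair.integral_comp measurableEmbedding_pair,
    ← integral_comp_polarCoord_symm, integral_dv_eq hg 0, zero_sub, zero_add,
    intervalIntegral.integral_of_le (by linarith [Real.pi_pos]), integral_Ioc_eq_integral_Ioo,
    ← setIntegral_prod_mul]
  refine setIntegral_congr_fun (measurableSet_Ioi.prod measurableSet_Ioo) ?_
  rintro ⟨ρ, θ⟩ ⟨h1, h2⟩
  have hρ : 0 < ρ := h1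
  simp only [pair_polar, dir_smul_circ hρ, norm_smul, norm_circ, mul_one,
    Real.norm_of_nonneg hρ.le, smul_eq_mul, mul_assoc]

/-! ### Logarithmic averages over lattice vectors -/

/-- The point of `ℤ²` with the given integer coordinates. -/
def latVec (a : ℤ × ℤ) : Plane := pair (a.1, a.2)

@[simp] lemma latVec_zero_coord (a : ℤ × ℤ) : latVec a 0 = a.1 := rfl

@[simp] lemma latVec_one_coord (a : ℤ × ℤ) : latVec a 1 = a.2 := rfl

lemma norm_sq_latVec (a : ℤ × ℤ) : ‖latVec a‖ ^ 2 = (a.1 : ℝ) ^ 2 + (a.2 : ℝ) ^ 2 := by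
  rw [norm_sq_plane]; simp

lemma latVec_eq_zero {a : ℤ × ℤ} : latVec a = 0 ↔ a = 0 := by
  constructor
  · intro h
    have h0 := congrArg (fun y : Plane => y 0) h
    have h1 := congrArg (fun y : Plane => y 1) h
    simp at h0 h1
    exact Prod.ext h0 h1
  · rintro rfl
    ext i; fin_cases i <;> simp [latVec, pair]

lemma one_le_norm_latVec {a : ℤ × ℤ} (h : a ≠ 0) : 1 ≤ ‖latVec a‖ := by
  have h1 : 0 < ‖latVec a‖ ^ 2 := by
    have := norm_pos_iff.2 (fun h' => h (latVec_eq_zero.1 h'))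
    positivity
  have h2 : (1 : ℝ) ≤ ‖latVec a‖ ^ 2 := by
    rw [norm_sq_latVec] at h1 ⊢
    exact_mod_cast h1
  nlinarith [norm_nonneg (latVec a)]

lemma latVec_smul (k : ℤ) (a : ℤ × ℤ) : latVec (k • a) = (k : ℝ) • latVec a := by
  ext i; fin_cases i <;> simp [latVec, pair]

/-- The nonzero vectors of `ℤ²` of length at most `X`. -/
noncomputable def latDisc (X : ℝ) : Finset (ℤ × ℤ) :=
  (Finset.Icc (-⌈X⌉) ⌈X⌉ ×ˢ Finset.Icc (-⌈X⌉) ⌈X⌉).filter fun a => a ≠ 0 ∧ ‖latVec a‖ ≤ X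

lemma mem_latDisc {X : ℝ} {a : ℤ × ℤ} : a ∈ latDisc X ↔ a ≠ 0 ∧ ‖latVec a‖ ≤ X := by
  rw [latDisc, Finset.mem_filter, and_iff_right_iff_imp]
  rintro ⟨-, h⟩
  have key : ∀ i, |latVec a i| ≤ X := fun i => by
    have := PiLp.norm_apply_le (latVec a) i
    rw [Real.norm_eq_abs] at this
    exact this.trans h
  have h0 : |(a.1 : ℝ)| ≤ ⌈X⌉ := (key 0).trans (Int.le_ceil X)
  have h1 : |(a.2 : ℝ)| ≤ ⌈X⌉ := (key 1).trans (Int.le_ceil X)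
  rw [Finset.mem_product, Finset.mem_Icc, Finset.mem_Icc, ← abs_le, ← abs_le]
  exact ⟨by exact_mod_cast h0, by exact_mod_cast h1⟩

/-- The primitive vectors of `ℤ²` of length at most `X`. -/
noncomputable def primDisc (X : ℝ) : Finset (ℤ × ℤ) :=
  (latDisc X).filter fun a => Int.gcd a.1 a.2 = 1

lemma mem_primDisc {X : ℝ} {a : ℤ × ℤ} :
    a ∈ primDisc X ↔ Int.gcd a.1 a.2 = 1 ∧ ‖latVec a‖ ≤ X := by
  rw [primDisc, Finset.mem_filter, mem_latDisc]
  constructor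
  · tauto
  · rintro ⟨h1, h2⟩
    refine ⟨⟨?_, h2⟩, h1⟩
    rintro rfl
    simp at h1

/-- The summand `G(a / |a|) / |a|²`. -/
noncomputable def latTerm (G : Circ → ℝ) (a : ℤ × ℤ) : ℝ := G (dir (latVec a)) / ‖latVec a‖ ^ 2

lemma latTerm_nonneg {G : Circ → ℝ} (hG : ∀ v, 0 ≤ G v) (a : ℤ × ℤ) : 0 ≤ latTerm G a :=
  div_nonneg (hG _) (by positivity)

lemma latTerm_smul (G : Circ → ℝ) {k : ℤ} (hk : 0 < k) (a : ℤ × ℤ) :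
    latTerm G (k • a) = 1 / (k : ℝ) ^ 2 * latTerm G a := by
  have hk' : (0 : ℝ) < k := by exact_mod_cast hk
  rw [latTerm, latTerm, latVec_smul, dir_smul hk', norm_smul, Real.norm_of_nonneg hk'.le, mul_pow]
  field_simp

/-- A continuous function on the plane that equals `G(y / |y|) / |y|²` outside the unit disk. -/
noncomputable def homExt (G : Circ → ℝ) (y : Plane) : ℝ :=
  min 1 ‖y‖ / max 1 ‖y‖ ^ 2 * G (dir y)

lemma continuous_homExt {G : Circ → ℝ} (hG : Continuous G) : Continuous (homExt G) := by
  have hw : Continuous fun y : Plane => min 1 ‖y‖ / max 1 ‖y‖ ^ 2 := by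
    refine Continuous.div (by fun_prop) (by fun_prop) fun y => ?_
    have : 0 < max 1 ‖y‖ := lt_max_of_lt_left one_pos
    positivity
  rw [continuous_iff_continuousAt]
  intro y
  by_cases hy : y = 0
  · subst hy
    obtain ⟨M, hM⟩ := isCompact_univ.exists_bound_of_continuousOn hG.continuousOn
    have h0 : homExt G 0 = 0 := by simp [homExt]
    rw [ContinuousAt, h0]
    have h1 : Tendsto (fun y : Plane => min 1 ‖y‖ / max 1 ‖y‖ ^ 2) (𝓝 0) (𝓝 0) := by
      have := hw.tendsto 0
      simpa using this
    refine h1.zero_mul_isBoundedUnder_le ?_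
    exact isBoundedUnder_of ⟨M, fun y => hM _ (mem_univ _)⟩
  · exact hw.continuousAt.mul (hG.continuousAt.comp (continuousAt_dir hy))

/-- The sum over a dyadic annulus is a Riemann sum of `G(y / |y|) / |y|²` over `1 < |y| ≤ 2`, by
homogeneity. -/
lemma tendsto_annulus_sum {G : Circ → ℝ} (hG : Continuous G) :
    Tendsto (fun n : ℕ => ∑ a ∈ (latDisc (2 * n)) \ (latDisc n), latTerm G a) atTop
      (𝓝 (Real.log 2 * ∫ v, G v ∂dv)) := by
  set e : (Fin 2 → ℝ) ≃ₜ Plane := (PiLp.homeomorph 2 fun _ : Fin 2 => ℝ).symm with he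
  have hev : MeasurePreserving e := PiLp.volume_preserving_toLp (Fin 2)
  have hee : MeasurableEmbedding e := e.measurableEmbedding
  set S : Set Plane := Metric.closedBall 0 2 ∩ (Metric.closedBall 0 1)ᶜ with hS
  have hSm : MeasurableSet S := Metric.isClosed_closedBall.measurableSet.inter
    Metric.isClosed_closedBall.measurableSet.compl
  have hfS : volume (frontier S) = 0 := by
    refine measure_mono_null (frontier_inter_subset _ _) ?_
    rw [frontier_compl, frontier_closedBall _ two_ne_zero, frontier_closedBall _ one_ne_zero]
    refine measure_union_null (measure_mono_null inter_subset_left ?_)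
      (measure_mono_null inter_subset_right ?_)
    · exact Measure.addHaar_sphere _ _ _
    · exact Measure.addHaar_sphere _ _ _
  have hbd : Bornology.IsBounded (e ⁻¹' S) := by
    have : IsCompact (e ⁻¹' Metric.closedBall 0 2) :=
      e.isCompact_preimage.2 (isCompact_closedBall _ _)
    exact this.isBounded.subset (preimage_mono inter_subset_left)
  have hfr : volume (frontier (e ⁻¹' S)) = 0 := by
    rw [← e.preimage_frontier, hev.measure_preimage_emb hee, hfS]
  have main := tendsto_tsum_div_pow_atTop_integral (e ⁻¹' S) (homExt G ∘ e)
    ((continuous_homExt hG).comp e.continuous) hbd (hev.measurable hSm) hfr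
  have hint : ∫ x in e ⁻¹' S, (homExt G ∘ e) x = Real.log 2 * ∫ v, G v ∂dv := by
    have h1 := hev.setIntegral_preimage_emb hee (homExt G) S
    simp only [Function.comp_def]
    rw [h1, ← integral_indicator hSm]
    have h2 : S.indicator (homExt G) =
        fun y => (Ioc (1 : ℝ) 2).indicator (fun ρ => 1 / ρ ^ 2) ‖y‖ * G (dir y) := by
      ext y
      have hy : y ∈ S ↔ ‖y‖ ∈ Ioc (1 : ℝ) 2 := by
        simp [hS, and_comm]
      by_cases h : ‖y‖ ∈ Ioc (1 : ℝ) 2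
      · rw [indicator_of_mem (hy.2 h), indicator_of_mem h, homExt, min_eq_left h.1.le,
          max_eq_right h.1.le]
      · rw [indicator_of_notMem (fun h' => h (hy.1 h')), indicator_of_notMem h, zero_mul]
    rw [h2, integral_radial_mul_angular _ hG.aestronglyMeasurable]
    congr 1
    have h3 : ∀ ρ : ℝ, ρ * (Ioc (1 : ℝ) 2).indicator (fun ρ => 1 / ρ ^ 2) ρ =
        (Ioc (1 : ℝ) 2).indicator (fun ρ => ρ⁻¹) ρ := by
      intro ρ
      by_cases h : ρ ∈ Ioc (1 : ℝ) 2
      · have : ρ ≠ 0 := (zero_lt_one.trans h.1).ne'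
        simp only [indicator_of_mem h]
        field_simp
      · simp [indicator_of_notMem h]
    simp_rw [h3]
    rw [integral_indicator measurableSet_Ioc, Measure.restrict_restrict measurableSet_Ioc,
      inter_eq_left.2 (Ioc_subset_Ioi_self.trans (Ioi_subset_Ioi zero_le_one)),
      ← intervalIntegral.integral_of_le one_le_two, integral_inv_of_pos one_pos two_pos, div_one]
  rw [hint] at main
  refine main.congr' ?_
  filter_upwards [eventually_gt_atTop 0] with n hn
  have hn' : (0 : ℝ) < n := by exact_mod_cast hn
  classical
  set emb : ℤ × ℤ → (Fin 2 → ℝ) := fun a => (n : ℝ)⁻¹ • ![(a.1 : ℝ), (a.2 : ℝ)] with hemb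
  have hlat : ∀ a, e (emb a) = (n : ℝ)⁻¹ • latVec a := by
    intro a
    ext i; fin_cases i <;> rfl
  have hinj : Function.Injective emb := by
    intro a b hab
    have h := congrArg e hab
    rw [hlat, hlat] at h
    have h := smul_right_injective Plane (inv_ne_zero hn'.ne') h
    have h0 := congrArg (fun y : Plane => y 0) h
    have h1 := congrArg (fun y : Plane => y 1) h
    simp at h0 h1
    exact Prod.ext h0 h1
  have hset : e ⁻¹' S ∩ (n : ℝ)⁻¹ •
      (Submodule.span ℤ (range (Pi.basisFun ℝ (Fin 2))) : Set (Fin 2 → ℝ)) =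
      ((latDisc (2 * n) \ latDisc n).image emb : Finset (Fin 2 → ℝ)) := by
    have hmem : ∀ a : ℤ × ℤ, emb a ∈ e ⁻¹' S ↔ a ∈ latDisc (2 * n) \ latDisc n := by
      intro a
      rw [mem_preimage, hlat, Finset.mem_sdiff, mem_latDisc, mem_latDisc, hS]
      simp only [mem_inter_iff, mem_closedBall_zero_iff, mem_compl_iff, norm_smul, norm_inv,
        RCLike.norm_natCast, not_le, inv_mul_le_iff₀ hn']
      rw [mul_one, mul_comm (n : ℝ) 2]
      constructor
      · rintro ⟨h1, h2⟩
        refine ⟨⟨?_, h1⟩, fun h => h2.not_ge h.2⟩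
        rintro rfl
        rw [latVec_eq_zero.2 rfl, norm_zero] at h2
        exact h2.not_ge hn'.le
      · rintro ⟨⟨h1, h2⟩, h3⟩
        exact ⟨h2, not_le.1 fun h => h3 ⟨h1, h⟩⟩
    ext x
    rw [Finset.coe_image, mem_inter_iff, mem_image]
    constructor
    · rintro ⟨h1, h2⟩
      obtain ⟨z, hz, rfl⟩ := Set.mem_smul_set.1 h2
      rw [SetLike.mem_coe, (Pi.basisFun ℝ (Fin 2)).mem_span_iff_repr_mem ℤ] at hz
      obtain ⟨p, hp⟩ := hz 0
      obtain ⟨q, hq⟩ := hz 1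
      have hx : emb (p, q) = (n : ℝ)⁻¹ • z := by
        rw [hemb]
        ext i
        fin_cases i
        · simpa using Or.inl hp
        · simpa using Or.inl hq
      refine ⟨(p, q), ?_, hx⟩
      rw [Finset.mem_coe, ← hmem, hx]
      exact h1
    · rintro ⟨a, ha, rfl⟩
      refine ⟨(hmem a).2 ha, Set.smul_mem_smul_set ?_⟩
      rw [SetLike.mem_coe, (Pi.basisFun ℝ (Fin 2)).mem_span_iff_repr_mem ℤ]
      intro i
      fin_cases i
      · exact ⟨a.1, by simp⟩
      · exact ⟨a.2, by simp⟩
  rw [hset, Finset.tsum_subtype', Finset.sum_image hinj.injOn, Finset.sum_div]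
  refine Finset.sum_congr rfl fun a ha => ?_
  rw [Finset.mem_sdiff, mem_latDisc, mem_latDisc] at ha
  have ha1 : (n : ℝ) < ‖latVec a‖ := by
    by_contra h
    exact ha.2 ⟨ha.1.1, not_lt.1 h⟩
  have h1 : 1 ≤ (n : ℝ)⁻¹ * ‖latVec a‖ := by
    rw [← div_eq_inv_mul, le_div_iff₀ hn', one_mul]
    exact ha1.le
  simp only [Function.comp_apply, hlat]
  rw [homExt, norm_smul, norm_inv, RCLike.norm_natCast, min_eq_left h1, max_eq_right h1,
    dir_smul (inv_pos.2 hn'), latTerm, Fintype.card_fin]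
  have := hn'.trans ha1
  field_simp

/-- The sum of `G(a / |a|) / |a|²` over the nonzero lattice vectors of length at most `X`. -/
noncomputable def latSum (G : Circ → ℝ) (X : ℝ) : ℝ := ∑ a ∈ latDisc X, latTerm G a

/-- The sum of `G(a / |a|) / |a|²` over the primitive vectors of length at most `X`. -/
noncomputable def primSum (G : Circ → ℝ) (X : ℝ) : ℝ := ∑ a ∈ primDisc X, latTerm G a

lemma latDisc_subset {X Y : ℝ} (h : X ≤ Y) : latDisc X ⊆ latDisc Y := fun a ha => by
  rw [mem_latDisc] at ha ⊢
  exact ⟨ha.1, ha.2.trans h⟩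

lemma primDisc_subset {X Y : ℝ} (h : X ≤ Y) : primDisc X ⊆ primDisc Y := fun a ha => by
  rw [mem_primDisc] at ha ⊢
  exact ⟨ha.1, ha.2.trans h⟩

lemma latSum_mono {G : Circ → ℝ} (hG : ∀ v, 0 ≤ G v) : Monotone (latSum G) := fun _ _ h =>
  Finset.sum_le_sum_of_subset_of_nonneg (latDisc_subset h) fun _ _ _ => latTerm_nonneg hG _

/-- The sums over the first `m` dyadic annuli, by Cesàro summation. -/
lemma tendsto_latSum_two_pow {G : Circ → ℝ} (hG : Continuous G) :
    Tendsto (fun m : ℕ => latSum G (2 ^ m) / m) atTop (𝓝 (Real.log 2 * ∫ v, G v ∂dv)) := by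
  have h1 : Tendsto (fun j : ℕ => latSum G (2 ^ (j + 1)) - latSum G (2 ^ j)) atTop
      (𝓝 (Real.log 2 * ∫ v, G v ∂dv)) := by
    refine ((tendsto_annulus_sum hG).comp (tendsto_pow_atTop_atTop_of_one_lt one_lt_two)).congr ?_
    intro j
    simp only [Function.comp_apply]
    have : latDisc ((2 ^ j : ℕ) : ℝ) ⊆ latDisc (2 * ((2 ^ j : ℕ) : ℝ)) :=
      latDisc_subset (by have : (0 : ℝ) ≤ ((2 ^ j : ℕ) : ℝ) := by positivity
                         linarith)
    rw [Finset.sum_sdiff_eq_sub this, latSum, latSum]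
    push_cast
    rw [pow_succ, mul_comm]
  have h2 := h1.cesaro
  simp_rw [Finset.sum_range_sub (fun j : ℕ => latSum G (2 ^ j))] at h2
  have h3 : Tendsto (fun m : ℕ => (m : ℝ)⁻¹ * latSum G (2 ^ 0)) atTop (𝓝 0) := by
    have := (tendsto_inv_atTop_nhds_zero_nat (𝕜 := ℝ)).mul_const (latSum G (2 ^ 0))
    rwa [zero_mul] at this
  have h4 := h2.add h3
  rw [add_zero] at h4
  refine h4.congr fun m => ?_
  rw [div_eq_inv_mul]
  ring

/-- Logarithmic equidistribution of the nonzero lattice vectors. -/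
lemma tendsto_latSum_div_log {G : Circ → ℝ} (hG : Continuous G) (h0 : ∀ v, 0 ≤ G v) :
    Tendsto (fun X : ℝ => latSum G X / Real.log X) atTop (𝓝 (∫ v, G v ∂dv)) := by
  -- the exponent `m` with `2 ^ m ≤ X < 2 ^ (m + 1)`
  set m : ℝ → ℕ := fun X => ⌊Real.log X / Real.log 2⌋₊ with hm
  have hl2 : 0 < Real.log 2 := Real.log_pos one_lt_two
  have hml : Tendsto (fun X : ℝ => Real.log X / Real.log 2) atTop atTop :=
    Real.tendsto_log_atTop.atTop_div_const hl2
  have hmt : Tendsto m atTop atTop := tendsto_nat_floor_atTop.comp hml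
  have hratio : Tendsto (fun X : ℝ => (m X : ℝ) / Real.log X) atTop (𝓝 (1 / Real.log 2)) := by
    have := ((tendsto_nat_floor_div_atTop (R := ℝ)).comp hml).mul_const (1 / Real.log 2)
    rw [one_mul] at this
    refine this.congr fun X => ?_
    simp only [Function.comp_apply, hm]
    by_cases h : Real.log X = 0
    · simp [h]
    · field_simp
  have hratio' : Tendsto (fun X : ℝ => ((m X + 1 : ℕ) : ℝ) / Real.log X) atTop
      (𝓝 (1 / Real.log 2)) := by
    have := hratio.add (Real.tendsto_log_atTop.inv_tendsto_atTop)
    rw [add_zero] at this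
    refine this.congr fun X => ?_
    push_cast
    rw [Pi.inv_apply, add_div, one_div]
  have hlim : Real.log 2 * (∫ v, G v ∂dv) * (1 / Real.log 2) = ∫ v, G v ∂dv := by
    field_simp
  have lo := ((tendsto_latSum_two_pow hG).comp hmt).mul hratio
  have hi := ((tendsto_latSum_two_pow hG).comp ((tendsto_add_atTop_nat 1).comp hmt)).mul hratio'
  rw [hlim] at lo hi
  refine tendsto_of_tendsto_of_tendsto_of_le_of_le' lo hi ?_ ?_
  · filter_upwards [eventually_gt_atTop 1, hmt.eventually_gt_atTop 0] with X hX hmX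
    have hlX : 0 < Real.log X := Real.log_pos hX
    have hmX' : (0 : ℝ) < m X := by exact_mod_cast hmX
    simp only [Function.comp_apply]
    rw [div_mul_div_cancel₀ hmX'.ne']
    gcongr
    apply latSum_mono h0
    rw [← Real.rpow_natCast, Real.rpow_def_of_pos two_pos,
      ← Real.le_log_iff_exp_le (zero_lt_one.trans hX), mul_comm, ← le_div_iff₀ hl2]
    exact Nat.floor_le (by positivity)
  · filter_upwards [eventually_gt_atTop 1] with X hX
    have hlX : 0 < Real.log X := Real.log_pos hX
    simp only [Function.comp_apply]
    have hmX' : (0 : ℝ) < ((m X + 1 : ℕ) : ℝ) := by positivity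
    rw [div_mul_div_cancel₀ hmX'.ne']
    gcongr
    apply latSum_mono h0
    rw [← Real.rpow_natCast, Real.rpow_def_of_pos two_pos,
      ← Real.log_le_iff_le_exp (zero_lt_one.trans hX), mul_comm, ← div_le_iff₀ hl2]
    push_cast
    exact (Nat.lt_floor_add_one _).le

/-- A lower bound for the sum over all lattice vectors: the products `k a` with `1 ≤ k ≤ K` and `a`
primitive are distinct, and the term of `k a` is `1 / k²` times that of `a`. -/
lemma sum_mul_primSum_le_latSum {G : Circ → ℝ} (h0 : ∀ v, 0 ≤ G v) (K : ℕ) (X : ℝ) :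
    (∑ k ∈ Finset.range K, 1 / ((k + 1 : ℕ) : ℝ) ^ 2) * primSum G (X / K) ≤ latSum G X := by
  classical
  have hinj : Set.InjOn (fun q : ℕ × (ℤ × ℤ) => ((q.1 + 1 : ℕ) : ℤ) • q.2)
      (Finset.range K ×ˢ primDisc (X / K) : Finset (ℕ × (ℤ × ℤ))) := by
    rintro ⟨k, a⟩ hk ⟨l, b⟩ hl h
    simp only [Finset.coe_product, mem_prod, Finset.mem_coe, mem_primDisc] at hk hl
    have h1 := congrArg Prod.fst h
    have h2 := congrArg Prod.snd h
    simp only [Prod.smul_fst, Prod.smul_snd, smul_eq_mul] at h1 h2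
    have hg : Int.gcd (((k + 1 : ℕ) : ℤ) * a.1) (((k + 1 : ℕ) : ℤ) * a.2) =
        Int.gcd (((l + 1 : ℕ) : ℤ) * b.1) (((l + 1 : ℕ) : ℤ) * b.2) := by rw [h1, h2]
    rw [Int.gcd_mul_left, Int.gcd_mul_left, hk.2.1, hl.2.1, Int.natAbs_natCast,
      Int.natAbs_natCast, mul_one, mul_one] at hg
    have hkl : k = l := by omega
    subst hkl
    have hk0 : ((k + 1 : ℕ) : ℤ) ≠ 0 := by positivity
    simp only [Prod.mk.injEq, true_and]
    exact Prod.ext (mul_left_cancel₀ hk0 h1) (mul_left_cancel₀ hk0 h2)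
  rw [primSum, Finset.sum_mul_sum, ← Finset.sum_product']
  calc _ = ∑ q ∈ Finset.range K ×ˢ primDisc (X / K),
        latTerm G (((q.1 + 1 : ℕ) : ℤ) • q.2) := by
        refine Finset.sum_congr rfl fun q _ => ?_
        rw [latTerm_smul G (by positivity)]
        push_cast
        rfl
    _ = ∑ b ∈ (Finset.range K ×ˢ primDisc (X / K)).image
          (fun q : ℕ × (ℤ × ℤ) => ((q.1 + 1 : ℕ) : ℤ) • q.2), latTerm G b :=
        (Finset.sum_image hinj).symm
    _ ≤ latSum G X := by
        refine Finset.sum_le_sum_of_subset_of_nonneg ?_ fun _ _ _ => latTerm_nonneg h0 _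
        intro b hb
        obtain ⟨⟨k, a⟩, hq, rfl⟩ := Finset.mem_image.1 hb
        rw [Finset.mem_product, Finset.mem_range, mem_primDisc] at hq
        obtain ⟨hk, ha, hX'⟩ := hq
        have hkK : ((k + 1 : ℕ) : ℝ) ≤ K := by exact_mod_cast hk
        rw [mem_latDisc]
        constructor
        · intro h
          have h1 := congrArg Prod.fst h
          have h2 := congrArg Prod.snd h
          have hk0 : ((k + 1 : ℕ) : ℤ) ≠ 0 := by positivity
          simp only [Prod.smul_fst, Prod.smul_snd, smul_eq_mul, Prod.fst_zero, Prod.snd_zero,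
            mul_eq_zero, hk0, false_or] at h1 h2
          simp only [h1, h2] at ha
          simp at ha
        · simp only
          rw [latVec_smul, norm_smul]
          have hK : (0 : ℝ) < K := lt_of_lt_of_le (by positivity) hkK
          simp only at hX'
          rw [le_div_iff₀ hK] at hX'
          rw [Int.cast_natCast, RCLike.norm_natCast]
          nlinarith [norm_nonneg (latVec a)]

/-- An upper bound for the sum over all lattice vectors: each of them is a multiple of a primitive
vector that is not longer. -/
lemma latSum_le_zeta_mul_primSum {G : Circ → ℝ} (h0 : ∀ v, 0 ≤ G v) (X : ℝ) :
    latSum G X ≤ Real.pi ^ 2 / 6 * primSum G X := by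
  classical
  set f : ℕ × (ℤ × ℤ) → ℤ × ℤ := fun q => ((q.1 + 1 : ℕ) : ℤ) • q.2
  set K : ℕ := ⌊X⌋₊
  have hsub : latDisc X ⊆ (Finset.range K ×ˢ primDisc X).image f := by
    intro a ha
    rw [mem_latDisc] at ha
    have hg : 0 < Int.gcd a.1 a.2 := by
      rw [Int.gcd_pos_iff]
      by_contra! h
      exact ha.1 (Prod.ext h.1 h.2)
    obtain ⟨b1, b2, hb, h1, h2⟩ := Int.exists_gcd_one hg
    have hab : a = ((Int.gcd a.1 a.2 : ℕ) : ℤ) • ((b1, b2) : ℤ × ℤ) := by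
      ext
      · simpa [mul_comm] using h1
      · simpa [mul_comm] using h2
    have hb0 : ((b1, b2) : ℤ × ℤ) ≠ 0 := by
      intro h
      rw [Prod.mk_eq_zero] at h
      simp [h.1, h.2] at hb
    have hn : ‖latVec a‖ = (Int.gcd a.1 a.2 : ℝ) * ‖latVec (b1, b2)‖ := by
      conv_lhs => rw [hab, latVec_smul, norm_smul]
      simp
    have hb1 := one_le_norm_latVec hb0
    have hg1 : (1 : ℝ) ≤ Int.gcd a.1 a.2 := by exact_mod_cast hg
    refine Finset.mem_image.2 ⟨(Int.gcd a.1 a.2 - 1, (b1, b2)), ?_, ?_⟩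
    · rw [Finset.mem_product, Finset.mem_range, mem_primDisc]
      refine ⟨?_, hb, ?_⟩
      · have : Int.gcd a.1 a.2 ≤ K := by
          apply Nat.le_floor
          nlinarith [ha.2]
        simp only
        omega
      · nlinarith [ha.2]
    · simp only [f]
      rw [Nat.sub_add_cancel hg]
      exact hab.symm
  calc latSum G X ≤ ∑ b ∈ (Finset.range K ×ˢ primDisc X).image f, latTerm G b :=
        Finset.sum_le_sum_of_subset_of_nonneg hsub fun _ _ _ => latTerm_nonneg h0 _
    _ ≤ ∑ q ∈ Finset.range K ×ˢ primDisc X, latTerm G (f q) :=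
        Finset.sum_image_le_of_nonneg fun _ _ => latTerm_nonneg h0 _
    _ = (∑ k ∈ Finset.range K, 1 / ((k + 1 : ℕ) : ℝ) ^ 2) * primSum G X := by
        rw [primSum, Finset.sum_mul_sum, ← Finset.sum_product']
        refine Finset.sum_congr rfl fun q _ => ?_
        simp only [f]
        rw [latTerm_smul G (by positivity)]
        push_cast
        rfl
    _ ≤ Real.pi ^ 2 / 6 * primSum G X := by
        have hp : 0 ≤ primSum G X := Finset.sum_nonneg fun _ _ => latTerm_nonneg h0 _
        refine mul_le_mul_of_nonneg_right ?_ hp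
        have h := (hasSum_nat_add_iff' 1).2 hasSum_zeta_two
        simp only [Finset.range_one, Finset.sum_singleton, Nat.cast_zero, ne_eq,
          OfNat.ofNat_ne_zero, not_false_eq_true, zero_pow, div_zero, sub_zero] at h
        exact sum_le_hasSum _ (fun i _ => by positivity) h

lemma tendsto_log_mul_div_log {c : ℝ} (hc : 0 < c) :
    Tendsto (fun X : ℝ => Real.log (c * X) / Real.log X) atTop (𝓝 1) := by
  have h := (Real.tendsto_log_atTop.inv_tendsto_atTop).const_mul (Real.log c)
  have h2 := h.add_const 1
  rw [mul_zero, zero_add] at h2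
  refine h2.congr' ?_
  filter_upwards [eventually_gt_atTop 1] with X hX
  have := Real.log_pos hX
  rw [Real.log_mul hc.ne' (by positivity), Pi.inv_apply]
  field_simp

/-- Logarithmic equidistribution of primitive vectors: their logarithmic density is `6 / π²`
times that of all lattice vectors. -/
lemma tendsto_primSum_div_log {G : Circ → ℝ} (hG : Continuous G) (h0 : ∀ v, 0 ≤ G v) :
    Tendsto (fun X : ℝ => primSum G X / Real.log X) atTop
      (𝓝 (6 / Real.pi ^ 2 * ∫ v, G v ∂dv)) := by
  set I := ∫ v, G v ∂dv with hI
  have hpi : 0 < Real.pi ^ 2 / 6 := by positivity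
  rw [tendsto_order]
  have hl := tendsto_latSum_div_log hG h0
  constructor
  · intro b hb
    have h1 : Real.pi ^ 2 / 6 * b < I := by
      rw [← lt_div_iff₀' hpi]
      convert hb using 1
      field_simp
    filter_upwards [hl.eventually_const_lt h1, eventually_gt_atTop 1] with X hX hX1
    have hlX : 0 < Real.log X := Real.log_pos hX1
    rw [lt_div_iff₀ hlX] at hX ⊢
    have h2 := latSum_le_zeta_mul_primSum h0 X
    have h3 := hX.trans_le h2
    rw [mul_assoc] at h3
    exact lt_of_mul_lt_mul_left h3 hpi.le
  · intro b hb
    have hz : Tendsto (fun K : ℕ => (∑ k ∈ Finset.range K, 1 / ((k + 1 : ℕ) : ℝ) ^ 2) * b) atTop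
        (𝓝 (Real.pi ^ 2 / 6 * b)) := by
      have h := (hasSum_nat_add_iff' 1).2 hasSum_zeta_two
      simp only [Finset.range_one, Finset.sum_singleton, Nat.cast_zero, ne_eq,
          OfNat.ofNat_ne_zero, not_false_eq_true, zero_pow, div_zero, sub_zero] at h
      exact h.tendsto_sum_nat.mul_const b
    have h1 : I < Real.pi ^ 2 / 6 * b := by
      rw [← div_lt_iff₀' hpi]
      convert hb using 1
      field_simp
    obtain ⟨K, hK, hK0⟩ := ((hz.eventually_const_lt h1).and (eventually_gt_atTop 0)).exists
    have hK' : (0 : ℝ) < K := by exact_mod_cast hK0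
    set σ := ∑ k ∈ Finset.range K, 1 / ((k + 1 : ℕ) : ℝ) ^ 2 with hσ
    have hσ0 : 0 < σ := Finset.sum_pos (fun k _ => by positivity) ⟨0, Finset.mem_range.2 hK0⟩
    have h2 : Tendsto (fun X : ℝ => latSum G (K * X) / Real.log X) atTop (𝓝 I) := by
      have h3 := (hl.comp (tendsto_id.const_mul_atTop hK')).mul (tendsto_log_mul_div_log hK')
      rw [mul_one] at h3
      refine h3.congr' ?_
      filter_upwards [eventually_gt_atTop 1] with X hX
      have hK1 : (1 : ℝ) ≤ K := by exact_mod_cast hK0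
      have hlog : 0 < Real.log (K * X) := Real.log_pos (by nlinarith)
      simp only [Function.comp_apply, id]
      rw [div_mul_div_cancel₀ hlog.ne']
    filter_upwards [h2.eventually_lt_const hK, eventually_gt_atTop 1] with X hX hX1
    have hlX : 0 < Real.log X := Real.log_pos hX1
    rw [div_lt_iff₀ hlX] at hX ⊢
    have h4 := sum_mul_primSum_le_latSum h0 K (K * X)
    rw [mul_div_cancel_left₀ _ hK'.ne'] at h4
    have h5 := h4.trans_lt hX
    rw [mul_assoc] at h5
    exact lt_of_mul_lt_mul_left h5 hσ0.le

/-! ### Free segments and channels -/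

/-- The determinant of two vectors of the plane. -/
def pdet (a b : Plane) : ℝ := a 0 * b 1 - a 1 * b 0

/-- The scalar product of two vectors of the plane, in coordinates. -/
def pdot (a b : Plane) : ℝ := a 0 * b 0 + a 1 * b 1

/-- The backward trajectory of duration `t` from `x` with velocity `v` stays in `Ω_r`. -/
def IsFree (r t : ℝ) (p : Phase) : Prop := ∀ s ∈ Icc 0 t, p.1 - s • (p.2 : Plane) ∈ Omega r

lemma pdet_sq_add_pdot_sq (a b : Plane) : pdet a b ^ 2 + pdot a b ^ 2 = ‖a‖ ^ 2 * ‖b‖ ^ 2 := by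
  rw [norm_sq_plane, norm_sq_plane, pdet, pdot]; ring

lemma abs_pdet_le (a b : Plane) : |pdet a b| ≤ ‖a‖ * ‖b‖ := by
  apply abs_le_of_sq_le_sq _ (by positivity)
  nlinarith [pdet_sq_add_pdot_sq a b, sq_nonneg (pdot a b)]

lemma pdot_le (a b : Plane) : pdot a b ≤ ‖a‖ * ‖b‖ := by
  apply le_of_abs_le
  apply abs_le_of_sq_le_sq _ (by positivity)
  nlinarith [pdet_sq_add_pdot_sq a b, sq_nonneg (pdet a b)]

lemma mem_lattice {x : Plane} : x ∈ lattice ↔ ∃ k, x = latVec k := by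
  constructor
  · intro h
    obtain ⟨p, hp⟩ := h 0
    obtain ⟨q, hq⟩ := h 1
    refine ⟨(p, q), ?_⟩
    ext i; fin_cases i
    · exact hp
    · exact hq
  · rintro ⟨k, rfl⟩ i
    fin_cases i
    · exact ⟨k.1, rfl⟩
    · exact ⟨k.2, rfl⟩

lemma isClosed_lattice : IsClosed lattice := by
  have : lattice = ⋂ i : Fin 2, (fun x : Plane => x i) ⁻¹' (range ((↑) : ℤ → ℝ)) := by
    ext x
    simp only [lattice, mem_iInter, mem_preimage, mem_range]
    exact forall_congr' fun i => exists_congr fun n => eq_comm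
  rw [this]
  refine isClosed_iInter fun i => IsClosed.preimage (by fun_prop) ?_
  exact Int.isClosedEmbedding_coe_real.isClosed_range

lemma mem_Z {r : ℝ} {z : Plane} : z ∈ Z r ↔ ∀ k, r / 2 < ‖z - latVec k‖ := by
  have hne : lattice.Nonempty := ⟨latVec 0, mem_lattice.2 ⟨0, rfl⟩⟩
  constructor
  · intro h k
    rw [← dist_eq_norm]
    exact lt_of_lt_of_le h (Metric.infDist_le_dist_of_mem (mem_lattice.2 ⟨k, rfl⟩))
  · intro h
    obtain ⟨y, hy, h'⟩ := isClosed_lattice.exists_infDist_eq_dist hne z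
    obtain ⟨k, rfl⟩ := mem_lattice.1 hy
    have := h k
    rwa [← dist_eq_norm, ← h'] at this

lemma mem_Omega {r : ℝ} (hr : 0 < r) {x : Plane} :
    x ∈ Omega r ↔ ∀ k, r ^ 2 / 2 < ‖x - r • latVec k‖ := by
  rw [Omega, mem_smul_set_iff_inv_smul_mem₀ hr.ne', mem_Z]
  refine forall_congr' fun k => ?_
  have : x - r • latVec k = r • (r⁻¹ • x - latVec k) := by
    rw [smul_sub, smul_inv_smul₀ hr.ne']
  rw [this, norm_smul, Real.norm_of_nonneg hr.le, ← div_lt_iff₀' hr]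
  congr! 1
  field_simp

/-- A lattice point whose projection on the segment is interior is far from the line. -/
lemma IsFree.abs_pdet_gt {r t : ℝ} (hr : 0 < r) {x : Plane} {v : Circ} (h : IsFree r t (x, v))
    (k : ℤ × ℤ) (hk : pdot v (x - r • latVec k) ∈ Icc 0 t) :
    r ^ 2 / 2 < |pdet v (x - r • latVec k)| := by
  have h1 := (mem_Omega hr).1 (h _ hk) k
  set w := x - r • latVec k with hw
  have h2 : ‖x - pdot v w • (v : Plane) - r • latVec k‖ = |pdet v w| := by
    rw [← abs_of_nonneg (norm_nonneg _), ← sq_eq_sq_iff_abs_eq_abs, norm_sq_plane]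
    have hv := circ_sq v
    have e0 : (x - pdot v w • (v : Plane) - r • latVec k) 0 = w 0 - pdot v w * (v : Plane) 0 := by
      simp [hw]; ring
    have e1 : (x - pdot v w • (v : Plane) - r • latVec k) 1 = w 1 - pdot v w * (v : Plane) 1 := by
      simp [hw]; ring
    rw [e0, e1, pdot, pdet]
    generalize (v : Plane) 0 = a at *
    generalize (v : Plane) 1 = b at *
    generalize w 0 = c
    generalize w 1 = d
    linear_combination (c ^ 2 * a ^ 2 + d ^ 2 * b ^ 2 + 2 * a * b * c * d - c ^ 2 - d ^ 2) * hv
  rw [← h2]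
  exact h1

/-- The rows of lattice points in a primitive direction are indexed by all integers. -/
lemma exists_pdet_eq {a : ℤ × ℤ} (ha : Int.gcd a.1 a.2 = 1) (m : ℤ) :
    ∃ k : ℤ × ℤ, pdet (latVec a) (latVec k) = m := by
  obtain ⟨p, q, h⟩ := Int.isCoprime_iff_gcd_eq_one.2 ha
  refine ⟨(-q * m, p * m), ?_⟩
  have h' : (p : ℝ) * a.1 + q * a.2 = 1 := by exact_mod_cast h
  simp only [pdet, latVec_zero_coord, latVec_one_coord]
  push_cast
  linear_combination (m : ℝ) * h'

lemma pdet_latVec_int (a k : ℤ × ℤ) : ∃ m : ℤ, pdet (latVec a) (latVec k) = m :=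
  ⟨a.1 * k.2 - a.2 * k.1, by simp [pdet]⟩

/-- The determinant in the orthonormal frame of `v` and its normal. -/
lemma pdet_decomp (v : Circ) (a w : Plane) :
    pdet a w = pdot v a * pdet v w - pdet v a * pdot v w := by
  have hv := circ_sq v
  simp only [pdet, pdot]
  linear_combination (-(a 0 * w 1) + a 1 * w 0) * hv

/-- Away from its ends a free segment keeps a distance from the rows of lattice points in the
direction `a`, when `a` is almost parallel to `v`: of two consecutive points of a row, on either
side of the crossing with the line, one would be within `r / 2` of it. -/
lemma IsFree.abs_row_gt {r t : ℝ} (hr : 0 < r) {x : Plane} {v : Circ} (h : IsFree r t (x, v))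
    {a : ℤ × ℤ} (ha : Int.gcd a.1 a.2 = 1) (hd : |pdet v (latVec a)| ≤ r)
    (hs0 : 0 < pdot v (latVec a)) (hs : pdot v (latVec a) ≤ 2 / r)
    {τ : ℝ} (hτ : τ ∈ Icc 2 (t - 2)) (m : ℤ) :
    r * pdot v (latVec a) / 2 <
      |pdet (latVec a) x / r + τ * pdet v (latVec a) / r - m| := by
  by_contra! hcon
  obtain ⟨k, hk⟩ := exists_pdet_eq ha m
  set s := pdot v (latVec a) with hs_def
  set d := pdet v (latVec a) with hd_def
  have hrs : 0 < r * s := mul_pos hr hs0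
  have hrs2 : r * s ≤ 2 := by rwa [le_div_iff₀' hr] at hs
  -- the points of the row on either side of the crossing have the indices `j` and `j + 1`
  set j : ℤ := ⌊(pdot v (x - r • latVec k) - τ) / (r * s)⌋ with hj
  have hj1 : (j : ℝ) * (r * s) ≤ pdot v (x - r • latVec k) - τ := by
    rw [← le_div_iff₀ hrs]; exact Int.floor_le _
  have hj2 : pdot v (x - r • latVec k) - τ < (j + 1) * (r * s) := by
    rw [← div_lt_iff₀ hrs]; exact Int.lt_floor_add_one _
  -- coordinates of the points of the row along and across the line
  have hS : ∀ i : ℤ, pdot v (x - r • latVec (k + i • a)) =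
      pdot v (x - r • latVec k) - i * (r * s) := by
    intro i
    simp only [hs_def, pdot, PiLp.sub_apply, PiLp.smul_apply, latVec_zero_coord, latVec_one_coord,
      smul_eq_mul, Prod.fst_add, Prod.snd_add, Prod.smul_fst, Prod.smul_snd]
    push_cast
    ring
  have hH : ∀ i : ℤ, pdet v (x - r • latVec (k + i • a)) =
      pdet v (x - r • latVec k) - i * (r * d) := by
    intro i
    simp only [hd_def, pdet, PiLp.sub_apply, PiLp.smul_apply, latVec_zero_coord, latVec_one_coord,
      smul_eq_mul, Prod.fst_add, Prod.snd_add, Prod.smul_fst, Prod.smul_snd]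
    push_cast
    ring
  have f0 := h.abs_pdet_gt hr (k + j • a) (by
    rw [hS]; constructor <;> nlinarith [hτ.1, hτ.2])
  have f1 := h.abs_pdet_gt hr (k + (j + 1) • a) (by
    rw [hS]; push_cast; constructor <;> nlinarith [hτ.1, hτ.2])
  rw [hH] at f0 f1
  push_cast at f1
  set S := pdot v (x - r • latVec k)
  set H := pdet v (x - r • latVec k)
  have hD : pdet (latVec a) x / r + τ * d / r - m = (s * H - d * (S - τ)) / r := by
    have h1 := pdet_decomp v (latVec a) (x - r • latVec k)
    have h2 : pdet (latVec a) (x - r • latVec k) = pdet (latVec a) x - r * m := by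
      rw [← hk]
      simp only [pdet, PiLp.sub_apply, PiLp.smul_apply, smul_eq_mul]; ring
    field_simp
    linear_combination h1 - h2
  rw [hD, abs_le, le_div_iff₀ hr, div_le_iff₀ hr] at hcon
  obtain ⟨c1, c2⟩ := hcon
  rw [abs_le] at hd
  rcases le_total 0 d with hd0 | hd0
  · have g0 : r ^ 2 / 2 < H - j * (r * d) := by
      rcases lt_abs.1 f0 with h | h
      · exact h
      · exfalso
        have : s * (H - j * (r * d)) ≥ s * (-(r ^ 2 / 2)) := by nlinarith
        have := le_of_mul_le_mul_left this hs0
        linarith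
    have g1 : H - (j + 1) * (r * d) < -(r ^ 2 / 2) := by
      rcases lt_abs.1 f1 with h | h
      · exfalso
        have : s * (H - (j + 1) * (r * d)) ≤ s * (r ^ 2 / 2) := by nlinarith
        have := le_of_mul_le_mul_left this hs0
        linarith
      · linarith
    nlinarith
  · have g0 : H - j * (r * d) < -(r ^ 2 / 2) := by
      rcases lt_abs.1 f0 with h | h
      · exfalso
        have : s * (H - j * (r * d)) ≤ s * (r ^ 2 / 2) := by nlinarith
        have := le_of_mul_le_mul_left this hs0
        linarith
      · linarith
    have g1 : r ^ 2 / 2 < H - (j + 1) * (r * d) := by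
      rcases lt_abs.1 f1 with h | h
      · exact h
      · exfalso
        have : s * (H - (j + 1) * (r * d)) ≥ s * (-(r ^ 2 / 2)) := by nlinarith
        have := le_of_mul_le_mul_left this hs0
        linarith
    nlinarith

/-- An interval that keeps a distance from the integers lies between two consecutive ones. -/
lemma fract_mem_Ioo_of_forall {u₀ u₁ ρ : ℝ} (h : u₀ ≤ u₁) (hρ : 0 ≤ ρ)
    (H : ∀ u ∈ Icc u₀ u₁, ∀ m : ℤ, ρ < |u - m|) :
    Int.fract u₀ ∈ Ioo ρ (1 - ρ - (u₁ - u₀)) := by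
  have h0 := H u₀ (left_mem_Icc.2 h) ⌊u₀⌋
  have h1 := H u₀ (left_mem_Icc.2 h) (⌊u₀⌋ + 1)
  have hf0 := Int.fract_nonneg u₀
  have hf1 := Int.fract_lt_one u₀
  have e : u₀ - ⌊u₀⌋ = Int.fract u₀ := rfl
  rw [e, abs_of_nonneg hf0] at h0
  push_cast at h1
  rw [show u₀ - ((⌊u₀⌋ : ℝ) + 1) = Int.fract u₀ - 1 by rw [← e]; ring,
    abs_of_nonpos (by linarith)] at h1
  refine ⟨h0, ?_⟩
  by_contra! hc
  have := H (⌊u₀⌋ + 1 - ρ) ⟨by linarith, by linarith⟩ (⌊u₀⌋ + 1)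
  push_cast at this
  rw [show (⌊u₀⌋ : ℝ) + 1 - ρ - (⌊u₀⌋ + 1) = -ρ by ring, abs_neg, abs_of_nonneg hρ] at this
  exact lt_irrefl _ this

/-- Free segments lie in channels: the position of `x` across the rows in the direction `a` is
confined to an interval, up to a translation that does not depend on `x`. -/
lemma IsFree.fract_mem {r t : ℝ} (hr : 0 < r) (ht : 4 ≤ t) {x : Plane} {v : Circ}
    (h : IsFree r t (x, v)) {a : ℤ × ℤ} (ha : Int.gcd a.1 a.2 = 1)
    (hd : |pdet v (latVec a)| ≤ r) (hs0 : 0 < pdot v (latVec a))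
    (hs : pdot v (latVec a) ≤ 2 / r) :
    Int.fract (pdet (latVec a) x / r +
        (if 0 ≤ pdet v (latVec a) then 2 else t - 2) * pdet v (latVec a) / r) ∈
      Ioo (r * pdot v (latVec a) / 2)
        (1 - r * pdot v (latVec a) / 2 - (t - 4) / r * |pdet v (latVec a)|) := by
  have hrow := fun τ hτ m => h.abs_row_gt hr ha hd hs0 hs (τ := τ) hτ m
  set s := pdot v (latVec a)
  set d := pdet v (latVec a)
  set c := pdet (latVec a) x / r
  have hρ : 0 ≤ r * s / 2 := by positivity
  have key : ∀ u : ℝ, (∃ τ ∈ Icc 2 (t - 2), u = c + τ * d / r) → ∀ m : ℤ,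
      r * s / 2 < |u - m| := by
    rintro u ⟨τ, hτ, rfl⟩ m
    exact hrow τ hτ m
  by_cases hd0 : 0 ≤ d
  · rw [if_pos hd0, abs_of_nonneg hd0]
    have := fract_mem_Ioo_of_forall (u₀ := c + 2 * d / r) (u₁ := c + (t - 2) * d / r) (by
      gcongr; linarith) hρ (fun u hu => key u (by
        rcases hd0.eq_or_lt with h0 | h0
        · refine ⟨2, ⟨le_rfl, by linarith⟩, ?_⟩
          have := hu.1.antisymm (hu.2.trans (by rw [← h0]; simp))
          exact this.symm
        · refine ⟨(u - c) * r / d, ⟨?_, ?_⟩, by field_simp; ring⟩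
          · rw [le_div_iff₀ h0, ← div_le_iff₀ hr]; linarith [hu.1]
          · rw [div_le_iff₀ h0, ← le_div_iff₀ hr]; linarith [hu.2]))
    convert this using 2
    ring
  · rw [if_neg hd0]
    rw [not_le] at hd0
    rw [abs_of_neg hd0]
    have := fract_mem_Ioo_of_forall (u₀ := c + (t - 2) * d / r) (u₁ := c + 2 * d / r) (by
      have : (t - 2) * d ≤ 2 * d := by nlinarith
      gcongr) hρ (fun u hu => key u (by
        refine ⟨(u - c) * r / d, ⟨?_, ?_⟩, by field_simp [hd0.ne]; ring⟩
        · rw [le_div_iff_of_neg hd0, ← le_div_iff₀ hr]; linarith [hu.2]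
        · rw [div_le_iff_of_neg hd0, ← div_le_iff₀ hr]; linarith [hu.1]))
    convert this using 2
    ring

/-- Segments inside a channel are free. -/
lemma isFree_of_fract_mem {r t : ℝ} (hr : 0 < r) {x : Plane} {v : Circ}
    {a : ℤ × ℤ} (ha : a ≠ 0)
    (h : Int.fract (pdet (latVec a) x / r +
        (if 0 ≤ pdet v (latVec a) then 0 else t) * pdet v (latVec a) / r) ∈
      Ioo (r * ‖latVec a‖ / 2) (1 - r * ‖latVec a‖ / 2 - t / r * |pdet v (latVec a)|)) :
    IsFree r t (x, v) := by
  intro τ hτ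
  rw [mem_Omega hr]
  intro k
  obtain ⟨n, hn⟩ := pdet_latVec_int a k
  have hL : 0 < ‖latVec a‖ := zero_lt_one.trans_le (one_le_norm_latVec ha)
  set d := pdet v (latVec a) with hd
  set c := pdet (latVec a) x / r with hc
  have e : pdet (latVec a) (x - τ • (v : Plane) - r • latVec k) = r * (c + τ * d / r - n) := by
    rw [← hn, hc, hd]
    field_simp
    simp only [pdet, PiLp.sub_apply, PiLp.smul_apply, smul_eq_mul]; ring
  suffices hgt : r * ‖latVec a‖ / 2 < |c + τ * d / r - n| by
    have h1 := abs_pdet_le (latVec a) (x - τ • (v : Plane) - r • latVec k)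
    rw [e, abs_mul, abs_of_pos hr] at h1
    have h2 : ‖latVec a‖ * (r ^ 2 / 2) < ‖latVec a‖ * ‖x - τ • (v : Plane) - r • latVec k‖ := by
      refine lt_of_lt_of_le ?_ h1
      have := mul_lt_mul_of_pos_left hgt hr
      linarith
    exact lt_of_mul_lt_mul_left h2 hL.le
  -- the position at time `τ` differs from the reference position by at most the width
  obtain ⟨m, w, hw0, hw1, hm⟩ : ∃ (m : ℤ) (w : ℝ), r * ‖latVec a‖ / 2 < w ∧
      w < 1 - r * ‖latVec a‖ / 2 ∧ c + τ * d / r = m + w := by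
    by_cases hd0 : 0 ≤ d
    · rw [if_pos hd0, abs_of_nonneg hd0, zero_mul, zero_div, add_zero] at h
      refine ⟨⌊c⌋, Int.fract c + τ * d / r, ?_, ?_, ?_⟩
      · have := h.1
        have : 0 ≤ τ * d / r := div_nonneg (mul_nonneg hτ.1 hd0) hr.le
        linarith
      · have h1 := h.2
        have : τ * d / r ≤ t / r * d := by
          rw [div_mul_eq_mul_div]; gcongr; exact hτ.2
        linarith
      · rw [← add_assoc, Int.floor_add_fract]
    · rw [if_neg hd0] at h
      rw [not_le] at hd0
      rw [abs_of_neg hd0] at h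
      refine ⟨⌊c + t * d / r⌋, Int.fract (c + t * d / r) + (t - τ) * (-d) / r, ?_, ?_, ?_⟩
      · have := h.1
        have : 0 ≤ (t - τ) * (-d) / r :=
          div_nonneg (mul_nonneg (by linarith [hτ.2]) (by linarith)) hr.le
        linarith
      · have h1 := h.2
        have : (t - τ) * (-d) / r ≤ t / r * (-d) := by
          rw [div_mul_eq_mul_div]; gcongr
          · linarith
          · linarith [hτ.1]
        linarith
      · rw [← add_assoc, Int.floor_add_fract]; ring
  rw [hm]
  have hp : 0 < r * ‖latVec a‖ / 2 := by positivity
  rcases le_or_gt n m with hnm | hnm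
  · have : (n : ℝ) ≤ m := by exact_mod_cast hnm
    rw [lt_abs]; left; linarith
  · have : (m : ℝ) + 1 ≤ n := by exact_mod_cast hnm
    rw [lt_abs]; right; linarith

/-- Dirichlet's theorem for a unit vector `(p, q)` of slope at most one: some lattice vector of
length `O(1 / r)` is within `r` of its line. -/
lemma exists_int_near_slope {r p q : ℝ} (hr : 0 < r) (hr4 : r ≤ 1 / 4) (hpq : p ^ 2 + q ^ 2 = 1)
    (h : |q| ≤ |p|) :
    ∃ k j : ℤ, (k, j) ≠ (0, 0) ∧ |p * j - q * k| ≤ r ∧ |p * k + q * j| ≤ 2 / r := by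
  have hp2 : 1 / 2 ≤ p ^ 2 := by
    have := sq_le_sq.2 h
    linarith
  have hp0 : p ≠ 0 := by rintro rfl; norm_num at hp2
  have hp1 : |p| ≤ 1 := by
    rw [← sq_le_one_iff_abs_le_one]; nlinarith [sq_nonneg q]
  have hq1 : |q| ≤ 1 := h.trans hp1
  have hn : 0 < ⌊1 / r⌋₊ := Nat.floor_pos.2 (by rw [le_div_iff₀ hr]; linarith)
  obtain ⟨j, k, hk0, hkn, hjk⟩ := Real.exists_int_int_abs_mul_sub_le (q / p) hn
  have hnr : 1 / ((⌊1 / r⌋₊ : ℝ) + 1) ≤ r := by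
    rw [div_le_iff₀ (by positivity), ← div_le_iff₀' hr]
    exact (Nat.lt_floor_add_one _).le
  have hjk' := hjk.trans hnr
  have hk1 : (k : ℝ) ≤ 1 / r := by
    have : ((⌊1 / r⌋₊ : ℕ) : ℝ) ≤ 1 / r := Nat.floor_le (by positivity)
    exact le_trans (by exact_mod_cast hkn) this
  have hk0' : (0 : ℝ) < k := by exact_mod_cast hk0
  refine ⟨k, j, by simp [hk0.ne'], ?_, ?_⟩
  · have e : p * j - q * k = -(p * (k * (q / p) - j)) := by field_simp; ring
    rw [e, abs_neg, abs_mul]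
    calc |p| * |k * (q / p) - j| ≤ 1 * r := by gcongr
      _ = r := one_mul r
  · have e : p * k + q * j = k / p - q * (k * (q / p) - j) := by
      field_simp; linear_combination (k : ℝ) * hpq
    have hinv : |(k : ℝ) / p| ≤ (3 / 2) * (1 / r) := by
      rw [abs_div, abs_of_pos hk0', div_le_iff₀ (abs_pos.2 hp0)]
      have : 1 ≤ 3 / 2 * |p| := by
        have := sq_abs p
        nlinarith [abs_nonneg p]
      have h1r : 0 < 1 / r := by positivity
      nlinarith
    rw [e]
    calc |(k : ℝ) / p - q * (k * (q / p) - j)| ≤ |(k : ℝ) / p| + |q * (k * (q / p) - j)| :=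
          abs_sub _ _
      _ ≤ (3 / 2) * (1 / r) + 1 * r := by
          rw [abs_mul]
          gcongr
      _ ≤ 2 / r := by
          rw [le_div_iff₀ hr]
          have : (3 / 2 * (1 / r) + 1 * r) * r = 3 / 2 + r ^ 2 := by field_simp
          rw [this]; nlinarith

/-- Every velocity is almost parallel to a short primitive vector, by Dirichlet's theorem. -/
lemma exists_primitive_near {r : ℝ} (hr : 0 < r) (hr4 : r ≤ 1 / 4) (v : Circ) :
    ∃ a : ℤ × ℤ, Int.gcd a.1 a.2 = 1 ∧ |pdet v (latVec a)| ≤ r ∧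
      0 < pdot v (latVec a) ∧ pdot v (latVec a) ≤ 2 / r := by
  have hv := circ_sq v
  obtain ⟨b, hb0, hb1, hb2⟩ : ∃ b : ℤ × ℤ, b ≠ 0 ∧ |pdet v (latVec b)| ≤ r ∧
      |pdot v (latVec b)| ≤ 2 / r := by
    rcases le_total |(v : Plane) 1| |(v : Plane) 0| with h | h
    · obtain ⟨k, j, h0, h1, h2⟩ := exists_int_near_slope hr hr4 hv h
      exact ⟨(k, j), h0, h1, h2⟩
    · obtain ⟨k, j, h0, h1, h2⟩ := exists_int_near_slope hr hr4 (add_comm _ _ |>.trans hv) h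
      refine ⟨(j, k), ?_, ?_, ?_⟩
      · rintro h
        rw [Prod.mk_eq_zero] at h
        exact h0 (by rw [h.1, h.2])
      · rw [pdet, abs_sub_comm]; exact h1
      · rw [pdot, add_comm]; exact h2
  have hg : 0 < Int.gcd b.1 b.2 := by
    rw [Int.gcd_pos_iff]
    by_contra! h
    exact hb0 (Prod.ext h.1 h.2)
  obtain ⟨c1, c2, hc, h1, h2⟩ := Int.exists_gcd_one hg
  set g : ℝ := ((Int.gcd b.1 b.2 : ℕ) : ℝ) with hgdef
  have hg1 : (1 : ℝ) ≤ g := by rw [hgdef]; exact_mod_cast hg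
  have h1' : (b.1 : ℝ) = c1 * g := by rw [hgdef]; exact_mod_cast h1
  have h2' : (b.2 : ℝ) = c2 * g := by rw [hgdef]; exact_mod_cast h2
  have hdet : pdet v (latVec b) = g * pdet v (latVec (c1, c2)) := by
    simp only [pdet, latVec_zero_coord, latVec_one_coord, h1', h2']; ring
  have hdot : pdot v (latVec b) = g * pdot v (latVec (c1, c2)) := by
    simp only [pdot, latVec_zero_coord, latVec_one_coord, h1', h2']; ring
  rw [hdet, abs_mul, abs_of_pos (by linarith)] at hb1
  rw [hdot, abs_mul, abs_of_pos (by linarith)] at hb2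
  have hd : |pdet v (latVec (c1, c2))| ≤ r := by nlinarith [abs_nonneg (pdet v (latVec (c1, c2)))]
  have hs : |pdot v (latVec (c1, c2))| ≤ 2 / r := by
    nlinarith [abs_nonneg (pdot v (latVec (c1, c2)))]
  have hne : pdot v (latVec (c1, c2)) ≠ 0 := by
    intro h0
    have h3 := pdet_sq_add_pdot_sq v (latVec (c1, c2))
    have h4 : 1 ≤ ‖latVec (c1, c2)‖ := one_le_norm_latVec (by
      intro h; rw [Prod.mk_eq_zero] at h; simp [h.1, h.2] at hc)
    rw [h0, norm_circ] at h3
    have h5 := sq_abs (pdet v (latVec (c1, c2)))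
    nlinarith [abs_nonneg (pdet v (latVec (c1, c2)))]
  rcases lt_or_gt_of_ne hne with h | h
  · have hneg : latVec (-c1, -c2) = -latVec (c1, c2) := by
      ext i; fin_cases i <;> simp [latVec, pair]
    have e1 : pdet v (latVec (-c1, -c2)) = -pdet v (latVec (c1, c2)) := by
      rw [hneg]; simp only [pdet, PiLp.neg_apply]; ring
    have e2 : pdot v (latVec (-c1, -c2)) = -pdot v (latVec (c1, c2)) := by
      rw [hneg]; simp only [pdot, PiLp.neg_apply]; ring
    refine ⟨(-c1, -c2), by simpa using hc, by rwa [e1, abs_neg], by rw [e2]; linarith, ?_⟩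
    rw [e2]; exact (neg_le_abs _).trans hs
  · exact ⟨(c1, c2), hc, hd, h, (le_abs_self _).trans hs⟩

/-- At most one channel direction is relevant for a given velocity: the determinant of two
candidates is an integer of absolute value less than one. -/
lemma eq_of_primitive_near {r : ℝ} (hr : 0 < r) {v : Circ} {a b : ℤ × ℤ}
    (ha : Int.gcd a.1 a.2 = 1) (hb : Int.gcd b.1 b.2 = 1)
    (ha0 : 0 < pdot v (latVec a)) (hb0 : 0 < pdot v (latVec b))
    (ha1 : r * ‖latVec a‖ < 1) (hb1 : r * ‖latVec b‖ < 1)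
    (ha2 : |pdet v (latVec a)| ≤ r / 2) (hb2 : |pdet v (latVec b)| ≤ r / 2) : a = b := by
  have hpa : r * pdot v (latVec a) < 1 := by
    have := pdot_le v (latVec a)
    rw [norm_circ, one_mul] at this
    nlinarith
  have hpb : r * pdot v (latVec b) < 1 := by
    have := pdot_le v (latVec b)
    rw [norm_circ, one_mul] at this
    nlinarith
  have hdec := pdet_decomp v (latVec a) (latVec b)
  have hlt : |pdet (latVec a) (latVec b)| < 1 := by
    rw [hdec]
    calc |pdot v (latVec a) * pdet v (latVec b) - pdet v (latVec a) * pdot v (latVec b)|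
        ≤ |pdot v (latVec a) * pdet v (latVec b)| + |pdet v (latVec a) * pdot v (latVec b)| :=
          abs_sub _ _
      _ ≤ pdot v (latVec a) * (r / 2) + r / 2 * pdot v (latVec b) := by
          rw [abs_mul, abs_mul, abs_of_pos ha0, abs_of_pos hb0]
          gcongr
      _ < 1 := by linarith
  obtain ⟨m, hm⟩ := pdet_latVec_int a b
  have hm0 : m = 0 := by
    rw [hm] at hlt
    have : |m| < 1 := by exact_mod_cast hlt
    exact Int.abs_lt_one_iff.1 this
  have hpar : a.1 * b.2 = a.2 * b.1 := by
    rw [hm0] at hm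
    simp only [pdet, latVec_zero_coord, latVec_one_coord, Int.cast_zero, sub_eq_zero] at hm
    exact_mod_cast hm
  rw [← Int.isCoprime_iff_gcd_eq_one] at ha hb
  obtain ⟨u, hu⟩ : ∃ u : ℤ, b = u • a := by
    obtain ⟨p, q, hpq⟩ := ha
    refine ⟨p * b.1 + q * b.2, ?_⟩
    ext
    · simp only [Prod.smul_fst, smul_eq_mul]; linear_combination -b.1 * hpq - q * hpar
    · simp only [Prod.smul_snd, smul_eq_mul]; linear_combination -b.2 * hpq + p * hpar
  have hu1 : IsUnit u := by
    apply hb.isUnit_of_dvd' <;> rw [hu]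
    · exact Dvd.intro _ rfl
    · exact Dvd.intro _ rfl
  rcases Int.isUnit_iff.1 hu1 with h | h
  · rw [hu, h, one_smul]
  · exfalso
    rw [hu, latVec_smul, h] at hb0
    simp only [pdot, PiLp.smul_apply, smul_eq_mul] at hb0 ha0
    push_cast at hb0
    linarith

/-! ### The angular weight of a channel -/

/-- The proportion of starting points `x` for which the backward trajectory of duration `t` with
velocity `v` stays in a channel of direction `a` between the disks of radius `r ^ 2 / 2`. -/
noncomputable def chanWeight (r t : ℝ) (a : ℤ × ℤ) (v : Circ) : ℝ :=
  if 0 < pdot v (latVec a) then max 0 (1 - r * ‖latVec a‖ - t / r * |pdet v (latVec a)|) else 0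

lemma chanWeight_nonneg (r t : ℝ) (a : ℤ × ℤ) (v : Circ) : 0 ≤ chanWeight r t a v := by
  unfold chanWeight
  split_ifs
  · exact le_max_left _ _
  · exact le_rfl

lemma chanWeight_le_one {r t : ℝ} (hr : 0 < r) (ht : 0 ≤ t) (a : ℤ × ℤ) (v : Circ) :
    chanWeight r t a v ≤ 1 := by
  unfold chanWeight
  split_ifs
  · apply max_le zero_le_one
    have : 0 ≤ r * ‖latVec a‖ := by positivity
    have : 0 ≤ t / r * |pdet v (latVec a)| := by positivity
    linarith
  · exact zero_le_one

lemma measurable_chanWeight (r t : ℝ) (a : ℤ × ℤ) : Measurable (chanWeight r t a) := by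
  have h1 : Continuous fun v : Circ => pdot v (latVec a) := by unfold pdot; fun_prop
  have h2 : Continuous fun v : Circ => pdet v (latVec a) := by unfold pdet; fun_prop
  exact Measurable.ite (measurableSet_lt measurable_const h1.measurable)
    (measurable_const.max (measurable_const.sub (h2.measurable.abs.const_mul _))) measurable_const

lemma integrable_chanWeight {r t : ℝ} (hr : 0 < r) (ht : 0 ≤ t) (a : ℤ × ℤ) :
    Integrable (chanWeight r t a) dv :=
  Integrable.of_bound (measurable_chanWeight r t a).aestronglyMeasurable 1
    (ae_of_all _ fun v => by
      rw [Real.norm_of_nonneg (chanWeight_nonneg _ _ _ _)]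
      exact chanWeight_le_one hr ht a v)

lemma integral_tent {β γ : ℝ} (hβ : 0 ≤ β) (hγ : 0 < γ) (h : β ≤ γ * Real.pi) :
    ∫ δ in (-Real.pi)..Real.pi, max 0 (β - γ * |δ|) = β ^ 2 / γ := by
  set c := β / γ with hc
  have hc0 : 0 ≤ c := by positivity
  have hcγ : γ * c = β := by rw [hc]; field_simp
  have hcpi : c ≤ Real.pi := by rwa [hc, div_le_iff₀' hγ]
  have hcont : Continuous fun δ : ℝ => max 0 (β - γ * |δ|) := by fun_prop
  have hi : ∀ a b : ℝ, IntervalIntegrable (fun δ : ℝ => max 0 (β - γ * |δ|)) volume a b :=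
    fun a b => hcont.intervalIntegrable a b
  have hhalf : ∫ δ in (0 : ℝ)..Real.pi, max 0 (β - γ * |δ|) = β ^ 2 / γ / 2 := by
    rw [← intervalIntegral.integral_add_adjacent_intervals (hi 0 c) (hi c Real.pi)]
    have e1 : ∫ δ in (0 : ℝ)..c, max 0 (β - γ * |δ|) = ∫ δ in (0 : ℝ)..c, (β - γ * δ) := by
      refine intervalIntegral.integral_congr fun δ hδ => ?_
      rw [uIcc_of_le hc0] at hδ
      rw [abs_of_nonneg hδ.1, max_eq_right]
      nlinarith [hδ.2]
    have e2 : ∫ δ in c..Real.pi, max 0 (β - γ * |δ|) = ∫ δ in c..Real.pi, (0 : ℝ) := by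
      refine intervalIntegral.integral_congr fun δ hδ => ?_
      rw [uIcc_of_le hcpi] at hδ
      rw [abs_of_nonneg (hc0.trans hδ.1), max_eq_left]
      nlinarith [hδ.1]
    rw [e1, e2, intervalIntegral.integral_sub intervalIntegrable_const
      (Continuous.intervalIntegrable (by fun_prop) _ _),
      intervalIntegral.integral_const_mul, integral_id]
    simp only [intervalIntegral.integral_const, smul_eq_mul, sub_zero, mul_zero, add_zero, hc]
    field_simp
    ring
  have hneg : ∫ δ in (-Real.pi)..0, max 0 (β - γ * |δ|) =
      ∫ δ in (0 : ℝ)..Real.pi, max 0 (β - γ * |δ|) := by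
    have := intervalIntegral.integral_comp_neg (a := 0) (b := Real.pi)
      (fun δ : ℝ => max 0 (β - γ * |δ|))
    simp only [abs_neg, neg_zero] at this
    exact this.symm
  rw [← intervalIntegral.integral_add_adjacent_intervals (hi (-Real.pi) 0) (hi 0 Real.pi), hneg,
    hhalf]
  ring

/-- In the angle `δ` from the direction of `a`, the weight is a truncated tent. -/
lemma exists_angle_chanWeight (r t : ℝ) (a : ℤ × ℤ) : ∃ α : ℝ, ∀ δ : ℝ,
    chanWeight r t a (ang (δ + α)) = if 0 < ‖latVec a‖ * Real.cos δ then
      max 0 (1 - r * ‖latVec a‖ - t * ‖latVec a‖ / r * |Real.sin δ|) else 0 := by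
  obtain ⟨α, -, hα⟩ := exists_ang_eq (dir (latVec a))
  refine ⟨α, fun δ => ?_⟩
  have hA := norm_smul_dir (latVec a)
  rw [← hα] at hA
  have e1 : pdot (ang (δ + α)) (latVec a) = ‖latVec a‖ * Real.cos δ := by
    conv_lhs => rw [← hA]
    simp only [pdot, PiLp.smul_apply, smul_eq_mul, ang_zero_coord, ang_one_coord]
    rw [Real.cos_add, Real.sin_add]
    have := Real.sin_sq_add_cos_sq α
    linear_combination (‖latVec a‖ * Real.cos δ) * this
  have e2 : pdet (ang (δ + α)) (latVec a) = -(‖latVec a‖ * Real.sin δ) := by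
    conv_lhs => rw [← hA]
    simp only [pdet, PiLp.smul_apply, smul_eq_mul, ang_zero_coord, ang_one_coord]
    rw [Real.cos_add, Real.sin_add]
    have := Real.sin_sq_add_cos_sq α
    linear_combination (-‖latVec a‖ * Real.sin δ) * this
  rw [chanWeight, e1, e2, abs_neg, abs_mul, abs_of_nonneg (norm_nonneg _)]
  congr 3
  ring

lemma integral_chanWeight_eq {r t : ℝ} {a : ℤ × ℤ} {α : ℝ} {F : ℝ → ℝ}
    (h : ∀ δ : ℝ, chanWeight r t a (ang (δ + α)) = F δ) :
    ∫ v, chanWeight r t a v ∂dv = ∫ δ in (-Real.pi)..Real.pi, F δ := by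
  rw [integral_dv_eq (measurable_chanWeight r t a).aestronglyMeasurable α]
  simp_rw [← h]
  rw [intervalIntegral.integral_comp_add_right (fun θ => chanWeight r t a (ang θ))]
  congr 1 <;> ring

lemma intervalIntegrable_chanWeight {r t : ℝ} (hr : 0 < r) (ht : 0 ≤ t) {a : ℤ × ℤ} {α : ℝ}
    {F : ℝ → ℝ} (h : ∀ δ : ℝ, chanWeight r t a (ang (δ + α)) = F δ) :
    IntervalIntegrable F volume (-Real.pi) Real.pi := by
  have hF : F = fun δ => chanWeight r t a (ang (δ + α)) := funext fun δ => (h δ).symm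
  rw [hF]
  refine (intervalIntegrable_const (c := (1 : ℝ))).mono_fun ?_ (ae_of_all _ fun δ => ?_)
  · have := continuous_ang.measurable
    exact ((measurable_chanWeight r t a).comp
      (by fun_prop)).aestronglyMeasurable
  · simp only
    rw [Real.norm_of_nonneg (chanWeight_nonneg _ _ _ _), norm_one]
    exact chanWeight_le_one hr ht a _

/-- Upper bound for the integral of the weight: in terms of the angle it is dominated by a tent
of slope `(t - 1) |a| / r`, since `(t - 1) x ≤ t sin x` on its support. -/
lemma integral_chanWeight_le {r t : ℝ} (hr : 0 < r) (hr4 : r ≤ 1 / 4) (ht : 2 ≤ t) {a : ℤ × ℤ}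
    (ha : a ≠ 0) : ∫ v, chanWeight r t a v ∂dv ≤
      r * max 0 (1 - r * ‖latVec a‖) ^ 2 / (‖latVec a‖ * (t - 1)) := by
  obtain ⟨α, hα⟩ := exists_angle_chanWeight r t a
  rw [integral_chanWeight_eq hα]
  have hFi := intervalIntegrable_chanWeight hr (by linarith) hα
  have hL := one_le_norm_latVec ha
  set L := ‖latVec a‖
  have hL0 : 0 < L := by linarith
  set β := max 0 (1 - r * L) with hβ
  have hβ0 : 0 ≤ β := le_max_left _ _
  have hβ1 : β ≤ 1 := max_le zero_le_one (by nlinarith)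
  set γ := (t - 1) * L / r with hγ
  have hγ4 : 4 ≤ γ := by
    rw [hγ, le_div_iff₀ hr]
    nlinarith
  have hpi := Real.pi_gt_three
  have htent := integral_tent hβ0 (by linarith : 0 < γ) (by nlinarith)
  calc _ ≤ ∫ δ in (-Real.pi)..Real.pi, max 0 (β - γ * |δ|) := by
        refine intervalIntegral.integral_mono_on (by linarith) hFi
          (Continuous.intervalIntegrable (by fun_prop) _ _) fun δ hδ => ?_
        split_ifs with hcos
        · refine max_le (le_max_left _ _) ?_
          by_cases hpos : 1 - r * L - t * L / r * |Real.sin δ| ≤ 0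
          · exact hpos.trans (le_max_left _ _)
          · rw [not_le] at hpos
            refine le_trans ?_ (le_max_right _ _)
            have hβ' : 1 - r * L ≤ β := le_max_right _ _
            -- the angle is small, so that its sine is comparable to it
            have hcos' : 0 < Real.cos δ := by
              by_contra! hneg
              nlinarith
            have hδ' : |δ| ≤ Real.pi / 2 := by
              by_contra! hgt
              have h1 : |δ| ≤ Real.pi := abs_le.2 hδ
              have := Real.cos_nonpos_of_pi_div_two_le_of_le hgt.le (by linarith)
              rw [Real.cos_abs] at this
              linarith
            have hsin : |Real.sin δ| = Real.sin |δ| := by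
              rcases le_total 0 δ with h0 | h0
              · rw [abs_of_nonneg h0] at hδ' ⊢
                exact abs_of_nonneg (Real.sin_nonneg_of_nonneg_of_le_pi h0 (by linarith))
              · rw [abs_of_nonpos h0] at hδ' ⊢
                rw [Real.sin_neg]
                exact abs_of_nonpos (Real.sin_nonpos_of_nonpos_of_neg_pi_le h0 (by linarith))
            rw [hsin] at hpos ⊢
            have hj := Real.mul_le_sin (abs_nonneg δ) hδ'
            set x := |δ| with hx
            have hx0 : 0 ≤ x := abs_nonneg δ
            have hsx : t * 4 * Real.sin x < 1 := by
              have hs0 : 0 ≤ Real.sin x := le_trans (by positivity) hj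
              have h1 : t * 4 ≤ t * L / r := by
                rw [le_div_iff₀ hr]; nlinarith
              have h2 : t * 4 * Real.sin x ≤ t * L / r * Real.sin x := by gcongr
              nlinarith
            have hxt : x * t < 1 := by
              have : 2 / Real.pi * x * Real.pi = 2 * x := by field_simp
              have h3 : 2 * x ≤ Real.sin x * Real.pi := by
                rw [← this]; gcongr
              have h4 : 2 * x ≤ Real.sin x * 4 := by
                have hs0 : 0 ≤ Real.sin x := le_trans (by positivity) hj
                nlinarith [Real.pi_le_four]
              nlinarith
            have hx1 : x ≤ 1 := by nlinarith
            have hsin3 : x - x ^ 3 / 6 ≤ Real.sin x := by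
              rcases hx0.eq_or_lt with h0 | h0
              · rw [← h0]; simp
              · exact (Real.sin_gt_sub_cube h0).le
            have hmain : (t - 1) * x ≤ t * Real.sin x := by
              nlinarith [mul_nonneg hx0 hx0, mul_nonneg (mul_nonneg hx0 hx0) hx0]
            have : γ * x ≤ t * L / r * Real.sin x := by
              rw [hγ, div_mul_eq_mul_div, div_mul_eq_mul_div]
              gcongr ?_ / r
              nlinarith
            linarith
        · exact le_max_left _ _
    _ = β ^ 2 / γ := htent
    _ = r * β ^ 2 / (L * (t - 1)) := by rw [hγ]; field_simp

/-- Lower bound for the integral of the weight, by `|sin x| ≤ |x|`. -/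
lemma le_integral_chanWeight {r t : ℝ} (hr : 0 < r) (hr4 : r ≤ 1 / 4) (ht : 1 ≤ t) {a : ℤ × ℤ}
    (ha : a ≠ 0) : r * max 0 (1 - r * ‖latVec a‖) ^ 2 / (‖latVec a‖ * t) ≤
      ∫ v, chanWeight r t a v ∂dv := by
  obtain ⟨α, hα⟩ := exists_angle_chanWeight r t a
  rw [integral_chanWeight_eq hα]
  have hFi := intervalIntegrable_chanWeight hr (by linarith) hα
  have hL := one_le_norm_latVec ha
  set L := ‖latVec a‖
  have hL0 : 0 < L := by linarith
  set β := max 0 (1 - r * L) with hβ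
  have hβ0 : 0 ≤ β := le_max_left _ _
  have hβ1 : β ≤ 1 := max_le zero_le_one (by nlinarith)
  set γ := t * L / r with hγ
  have hγ4 : 4 ≤ γ := by
    rw [hγ, le_div_iff₀ hr]
    nlinarith
  have hpi := Real.pi_gt_three
  have htent := integral_tent hβ0 (by linarith : 0 < γ) (by nlinarith)
  calc r * β ^ 2 / (L * t) = β ^ 2 / γ := by rw [hγ]; field_simp
    _ = ∫ δ in (-Real.pi)..Real.pi, max 0 (β - γ * |δ|) := htent.symm
    _ ≤ _ := by
        refine intervalIntegral.integral_mono_on (by linarith)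
          (Continuous.intervalIntegrable (by fun_prop) _ _) hFi fun δ hδ => ?_
        split_ifs with hcos
        · refine max_le (le_max_left _ _) ?_
          rcases le_total (1 - r * L) 0 with h | h
          · rw [hβ, max_eq_left h]
            refine le_trans ?_ (le_max_left _ _)
            nlinarith [abs_nonneg δ]
          · rw [hβ, max_eq_right h]
            refine le_trans ?_ (le_max_right _ _)
            have := Real.abs_sin_le_abs (x := δ)
            nlinarith
        · refine max_le le_rfl ?_
          have hcos' : Real.cos δ ≤ 0 := by
            by_contra! hneg
            exact hcos (by positivity)
          have : 1 ≤ |δ| := by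
            by_contra! hlt
            have h1 := abs_lt.1 hlt
            have := Real.cos_pos_of_mem_Ioo (x := δ) ⟨by linarith [h1.1], by linarith [h1.2]⟩
            linarith
          nlinarith

/-- The weight of a channel is concentrated near its direction. -/
lemma dist_dir_le_of_chanWeight_ne_zero {r t : ℝ} (hr : 0 < r) (ht : 1 ≤ t) {a : ℤ × ℤ}
    (ha : a ≠ 0) {v : Circ} (h : chanWeight r t a v ≠ 0) : dist v (dir (latVec a)) ≤ 2 * r := by
  have hL := one_le_norm_latVec ha
  unfold chanWeight at h
  split_ifs at h with hdot
  · have hpos : 0 < 1 - r * ‖latVec a‖ - t / r * |pdet v (latVec a)| := by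
      by_contra! hneg
      exact h (max_eq_left hneg)
    have hA := norm_smul_dir (latVec a)
    set L := ‖latVec a‖
    set u := dir (latVec a)
    have e1 : pdot v (latVec a) = L * pdot v u := by
      rw [← hA]; simp only [pdot, PiLp.smul_apply, smul_eq_mul]; ring
    have e2 : pdet v (latVec a) = L * pdet v u := by
      rw [← hA]; simp only [pdet, PiLp.smul_apply, smul_eq_mul]; ring
    have hL0 : 0 < L := by linarith
    have hc0 : 0 < pdot v u := by
      rw [e1] at hdot; exact pos_of_mul_pos_right hdot hL0.le
    have hs : |pdet v u| ≤ r := by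
      rw [e2, abs_mul, abs_of_pos hL0] at hpos
      have h1 : t / r * (L * |pdet v u|) < 1 := by
        have : 0 ≤ r * L := by positivity
        linarith
      rw [div_mul_eq_mul_div, div_lt_one hr] at h1
      have h2 : 1 * |pdet v u| ≤ t * (L * |pdet v u|) := by
        rw [← mul_assoc]
        gcongr
        nlinarith
      linarith
    have hsq := pdet_sq_add_pdot_sq v u
    have hc1 := pdot_le v u
    rw [norm_circ, norm_circ] at hsq hc1
    rw [Subtype.dist_eq, dist_eq_norm]
    apply le_of_sq_le_sq _ (by positivity)
    have e3 : ‖(v : Plane) - u‖ ^ 2 = 2 - 2 * pdot v u := by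
      rw [norm_sq_plane, pdot]
      simp only [PiLp.sub_apply]
      linear_combination circ_sq v + circ_sq u
    rw [e3]
    have hs2 : pdet v u ^ 2 ≤ r ^ 2 := sq_le_sq' (by linarith [abs_le.1 hs]) (abs_le.1 hs).2
    nlinarith
  · exact absurd rfl h

/-! ### Equidistribution across the channels -/

lemma integral_indicator_fract {p q : ℝ} (hp : 0 ≤ p) (hq : q ≤ 1) (c : ℝ) :
    ∫ u in (0 : ℝ)..1, (Ioo p q).indicator (fun _ => (1 : ℝ)) (Int.fract (c + u)) =
      max 0 (q - p) := by
  set F : ℝ → ℝ := fun u => (Ioo p q).indicator (fun _ => (1 : ℝ)) (Int.fract u) with hF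
  have hper : Function.Periodic F 1 := fun u => by simp [hF]
  have h1 : ∫ u in (0 : ℝ)..1, F (c + u) = ∫ u in (0 : ℝ)..1, F u := by
    rw [intervalIntegral.integral_comp_add_left F c, add_zero, hper.intervalIntegral_add_eq c 0,
      zero_add]
  rw [h1, intervalIntegral.integral_of_le zero_le_one, integral_Ioc_eq_integral_Ioo]
  have h2 : ∀ u ∈ Ioo (0 : ℝ) 1, F u = (Ioo p q).indicator (fun _ => (1 : ℝ)) u := fun u hu => by
    simp only [hF]
    rw [Int.fract_eq_self.2 ⟨hu.1.le, hu.2⟩]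
  rw [setIntegral_congr_fun measurableSet_Ioo h2, integral_indicator measurableSet_Ioo,
    Measure.restrict_restrict measurableSet_Ioo, inter_eq_left.2 (Ioo_subset_Ioo hp hq)]
  simp [max_comm]

/-- The points whose position across the rows of direction `a` lies in a given interval. -/
def stripSet (r c p q : ℝ) (a : ℤ × ℤ) : Set Plane :=
  {x | Int.fract (pdet (latVec a) x / r + c) ∈ Ioo p q}

lemma measurableSet_stripSet (r c p q : ℝ) (a : ℤ × ℤ) : MeasurableSet (stripSet r c p q a) := by
  have h : Continuous fun x : Plane => pdet (latVec a) x / r + c := by unfold pdet; fun_prop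
  exact (measurable_fract.comp h.measurable) measurableSet_Ioo

/-- Functions that vary little at the scale `r` do not correlate with the strips, which have
period at most `r`. -/
lemma abs_integral_strip_sub_le {g : Plane → ℝ} (hg : Continuous g) {R r η : ℝ}
    (hR : ∀ x, R < ‖x‖ → g x = 0) (hr : 0 < r) (hr1 : r ≤ 1)
    (hη : ∀ x w, ‖w‖ ≤ r → |g (x + w) - g x| ≤ η) {a : ℤ × ℤ} (ha : a ≠ 0) (c : ℝ) {p q : ℝ}
    (hp : 0 ≤ p) (hq : q ≤ 1) :
    |(∫ x, (stripSet r c p q a).indicator g x) - max 0 (q - p) * ∫ x, g x| ≤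
      η * volume.real (Metric.closedBall (0 : Plane) (R + 1)) := by
  have hL := one_le_norm_latVec ha
  have hη0 : 0 ≤ η := (abs_nonneg _).trans (hη 0 0 (by simpa using hr.le))
  set L := ‖latVec a‖ with hLdef
  set E := stripSet r c p q a with hE
  have hEm : MeasurableSet E := measurableSet_stripSet r c p q a
  have hgc : HasCompactSupport g := HasCompactSupport.of_support_subset_isCompact
    (isCompact_closedBall (0 : Plane) R) fun x hx => by
      rw [mem_closedBall_zero_iff]
      by_contra! h
      exact hx (hR x h)
  have hgi : Integrable g := hg.integrable_of_hasCompactSupport hgc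
  -- the translation by one period of the strips
  set w : Plane := (r / L ^ 2) • pair (-latVec a 1, latVec a 0) with hw
  have hwnorm : ‖w‖ ≤ r := by
    have h1 : ‖pair (-latVec a 1, latVec a 0)‖ ^ 2 = L ^ 2 := by
      rw [hLdef, norm_sq_plane, norm_sq_plane]; simp [pair]; ring
    have h2 : ‖pair (-latVec a 1, latVec a 0)‖ = L :=
      (sq_eq_sq₀ (norm_nonneg _) (norm_nonneg _)).1 h1
    rw [hw, norm_smul, h2, Real.norm_of_nonneg (by positivity)]
    rw [div_mul_eq_mul_div, div_le_iff₀ (by positivity)]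
    have : L * 1 ≤ L * L := by gcongr
    nlinarith
  have hdetw : pdet (latVec a) w = r := by
    have h1 := norm_sq_plane (latVec a)
    rw [← hLdef] at h1
    have h2 : pdet (latVec a) w = r / L ^ 2 * (latVec a 0 ^ 2 + latVec a 1 ^ 2) := by
      rw [hw]; simp [pdet, pair]; ring
    rw [h2, ← h1]
    field_simp
  have hmem : ∀ x u, E.indicator (fun _ => (1 : ℝ)) (x + u • w) =
      (Ioo p q).indicator (fun _ => (1 : ℝ)) (Int.fract ((pdet (latVec a) x / r + c) + u)) := by
    intro x u
    have : pdet (latVec a) (x + u • w) / r + c = pdet (latVec a) x / r + c + u := by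
      have : pdet (latVec a) (x + u • w) = pdet (latVec a) x + u * pdet (latVec a) w := by
        simp only [pdet, PiLp.add_apply, PiLp.smul_apply, smul_eq_mul]; ring
      rw [this, hdetw]
      field_simp
      ring
    simp only [indicator, hE, stripSet, mem_ofPred_eq, this]
  set φ : Plane → ℝ → ℝ := fun x u => E.indicator (fun _ => (1 : ℝ)) (x + u • w) with hφ
  have hφm : Measurable (Function.uncurry φ) :=
    (measurable_const.indicator hEm).comp (by fun_prop)
  have hφ1 : ∀ x u, ‖φ x u‖ ≤ 1 := fun x u => by
    simp only [hφ, indicator]; split_ifs <;> simp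
  -- the average over the translations of the indicator
  have hav : ∫ u in (0 : ℝ)..1, ∫ x, φ x u * g x = max 0 (q - p) * ∫ x, g x := by
    rw [intervalIntegral.integral_of_le zero_le_one, integral_integral_swap]
    · rw [← integral_const_mul]
      refine integral_congr_ae (ae_of_all _ fun x => ?_)
      simp only
      rw [integral_mul_const, ← intervalIntegral.integral_of_le zero_le_one]
      simp only [hφ, hmem]
      rw [integral_indicator_fract hp hq]
    · have : Integrable (fun z : ℝ × Plane => g z.2)
          ((volume.restrict (Ioc (0 : ℝ) 1)).prod volume) := hgi.comp_snd _
      refine this.bdd_mul (c := 1) ?_ (ae_of_all _ fun z => hφ1 z.2 z.1)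
      exact (hφm.comp measurable_swap).aestronglyMeasurable
  have hshift : ∀ u : ℝ, ∫ x, E.indicator g x = ∫ x, φ x u * g (x + u • w) := by
    intro u
    rw [← integral_add_right_eq_self (fun x => E.indicator g x) (u • w)]
    refine integral_congr_ae (ae_of_all _ fun x => ?_)
    simp only [hφ, indicator]
    split_ifs <;> simp
  have hconst : ∫ x, E.indicator g x = ∫ u in (0 : ℝ)..1, ∫ x, E.indicator g x := by simp
  have hdiff : ∀ u ∈ uIoc (0 : ℝ) 1, ‖(∫ x, E.indicator g x) - ∫ x, φ x u * g x‖ ≤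
      η * volume.real (Metric.closedBall (0 : Plane) (R + 1)) := by
    intro u hu
    rw [uIoc_of_le zero_le_one] at hu
    have huw : ‖u • w‖ ≤ r := by
      rw [norm_smul, Real.norm_of_nonneg hu.1.le]
      nlinarith [norm_nonneg w, hu.1, hu.2]
    have hφu : AEStronglyMeasurable (fun x => φ x u) volume :=
      (hφm.comp (measurable_id.prodMk measurable_const)).aestronglyMeasurable
    have i1 : Integrable fun x => φ x u * g (x + u • w) :=
      (hgi.comp_add_right (u • w)).bdd_mul (c := 1) hφu (ae_of_all _ fun x => hφ1 x u)
    have i2 : Integrable fun x => φ x u * g x :=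
      hgi.bdd_mul (c := 1) hφu (ae_of_all _ fun x => hφ1 x u)
    rw [hshift u, ← integral_sub i1 i2]
    have hB : MeasurableSet (Metric.closedBall (0 : Plane) (R + 1)) := measurableSet_closedBall
    calc ‖∫ x, (φ x u * g (x + u • w) - φ x u * g x)‖
        ≤ ∫ x, (Metric.closedBall (0 : Plane) (R + 1)).indicator (fun _ => η) x := by
          refine norm_integral_le_of_norm_le ?_ (ae_of_all _ fun x => ?_)
          · rw [integrable_indicator_iff hB]
            exact integrableOn_const (measure_closedBall_lt_top.ne)
          · rw [← mul_sub, norm_mul, indicator]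
            split_ifs with hx
            · calc ‖φ x u‖ * ‖g (x + u • w) - g x‖ ≤ 1 * η := by
                    gcongr
                    · exact hφ1 x u
                    · exact hη x _ huw
                _ = η := one_mul η
            · rw [mem_closedBall_zero_iff, not_le] at hx
              rw [hR x (by linarith), hR (x + u • w)]
              · simp
              · have := norm_sub_le (x + u • w) (u • w)
                rw [add_sub_cancel_right] at this
                linarith
      _ = η * volume.real (Metric.closedBall (0 : Plane) (R + 1)) := by
          rw [integral_indicator hB, setIntegral_const, smul_eq_mul, mul_comm]
  have hint : IntervalIntegrable (fun u => ∫ x, φ x u * g x) volume 0 1 := by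
    rw [intervalIntegrable_iff_integrableOn_Ioc_of_le zero_le_one]
    have : Integrable (fun z : ℝ × Plane => φ z.2 z.1 * g z.2)
          ((volume.restrict (Ioc (0 : ℝ) 1)).prod volume) := by
      have : Integrable (fun z : ℝ × Plane => g z.2)
          ((volume.restrict (Ioc (0 : ℝ) 1)).prod volume) := hgi.comp_snd _
      refine this.bdd_mul (c := 1) ?_ (ae_of_all _ fun z => hφ1 z.2 z.1)
      exact (hφm.comp measurable_swap).aestronglyMeasurable
    exact this.integral_prod_left
  rw [← hav, hconst, ← intervalIntegral.integral_sub (by simp) hint, ← Real.norm_eq_abs]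
  have := intervalIntegral.norm_integral_le_of_norm_le_const hdiff
  simpa using this

/-! ### The mass carried by the free trajectories -/

/-- Freeness is a countable intersection, over the holes, of conditions that are open because the
time runs over a compact interval. -/
lemma measurableSet_isFree (t : ℝ) :
    MeasurableSet {q : ℝ × Phase | 0 < q.1 ∧ IsFree q.1 t q.2} := by
  have h : {q : ℝ × Phase | 0 < q.1 ∧ IsFree q.1 t q.2} = {q : ℝ × Phase | 0 < q.1} ∩
      ⋂ k : ℤ × ℤ, {q : ℝ × Phase | ∀ s ∈ Icc 0 t,
        q.1 ^ 2 / 2 < ‖q.2.1 - s • (q.2.2 : Plane) - q.1 • latVec k‖} := by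
    ext q
    simp only [mem_ofPred_eq, mem_inter_iff, mem_iInter]
    refine and_congr_right fun hq => ?_
    simp only [IsFree, mem_Omega hq]
    exact ⟨fun h k s hs => h s hs k, fun h s hs k => h k s hs⟩
  rw [h]
  refine (measurableSet_lt measurable_const measurable_fst).inter
    (MeasurableSet.iInter fun k => IsOpen.measurableSet ?_)
  rw [isOpen_iff_eventually]
  intro q hq
  have hcont : Continuous fun z : (ℝ × Phase) × ℝ =>
      ‖z.1.2.1 - z.2 • (z.1.2.2 : Plane) - z.1.1 • latVec k‖ := by fun_prop
  have hcont' : Continuous fun z : (ℝ × Phase) × ℝ => z.1.1 ^ 2 / 2 := by fun_prop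
  have ho : IsOpen {z : (ℝ × Phase) × ℝ |
      z.1.1 ^ 2 / 2 < ‖z.1.2.1 - z.2 • (z.1.2.2 : Plane) - z.1.1 • latVec k‖} :=
    isOpen_lt hcont' hcont
  exact isCompact_Icc.eventually_forall_of_forall_eventually
    (P := fun (q : ℝ × Phase) (s : ℝ) =>
      q.1 ^ 2 / 2 < ‖q.2.1 - s • (q.2.2 : Plane) - q.1 • latVec k‖)
    fun s hs => ho.mem_nhds (show (q, s) ∈ _ from hq s hs)

lemma measurableSet_isFree_phase {r : ℝ} (hr : 0 < r) (t : ℝ) :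
    MeasurableSet {p : Phase | IsFree r t p} := by
  have h := (measurable_prodMk_left (x := r) : Measurable fun p : Phase => (r, p))
    (measurableSet_isFree t)
  convert h using 1
  ext p
  simp [hr]

lemma measurableSet_isFree_plane {r : ℝ} (hr : 0 < r) (t : ℝ) (v : Circ) :
    MeasurableSet {x : Plane | IsFree r t (x, v)} :=
  (measurable_prodMk_right (y := v) : Measurable fun x : Plane => (x, v))
    (measurableSet_isFree_phase hr t)

/-- For a given velocity the free mass is at least that in the channels, which do not overlap. -/
lemma le_integral_isFree {g : Plane → ℝ} (hg : Continuous g) (hg0 : ∀ x, 0 ≤ g x) {R r η t : ℝ}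
    (hR : ∀ x, R < ‖x‖ → g x = 0) (hr : 0 < r) (hr4 : r ≤ 1 / 4)
    (hη : ∀ x w, ‖w‖ ≤ r → |g (x + w) - g x| ≤ η) (ht : 2 ≤ t) (v : Circ)
    {P : Finset (ℤ × ℤ)} (hP : ∀ a ∈ P, Int.gcd a.1 a.2 = 1) :
    (∑ a ∈ P, chanWeight r t a v) * (∫ x, g x) -
        η * volume.real (Metric.closedBall (0 : Plane) (R + 1)) ≤
      ∫ x, {x : Plane | IsFree r t (x, v)}.indicator g x := by
  have hη0 : 0 ≤ η := (abs_nonneg _).trans (hη 0 0 (by simpa using hr.le))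
  have hgi : Integrable g := hg.integrable_of_hasCompactSupport
    (HasCompactSupport.of_support_subset_isCompact (isCompact_closedBall (0 : Plane) R)
      fun x hx => by
        rw [mem_closedBall_zero_iff]
        by_contra! h
        exact hx (hR x h))
  by_cases hex : ∃ a ∈ P, chanWeight r t a v ≠ 0
  · obtain ⟨a, ha, hne⟩ := hex
    have facts : ∀ b : ℤ × ℤ, chanWeight r t b v ≠ 0 → 0 < pdot v (latVec b) ∧
        0 < 1 - r * ‖latVec b‖ - t / r * |pdet v (latVec b)| := by
      intro b hb
      unfold chanWeight at hb
      split_ifs at hb with h1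
      · refine ⟨h1, ?_⟩
        by_contra! h2
        exact hb (max_eq_left h2)
      · exact absurd rfl hb
    have small : ∀ b : ℤ × ℤ, chanWeight r t b v ≠ 0 → r * ‖latVec b‖ < 1 ∧
        |pdet v (latVec b)| ≤ r / 2 := by
      intro b hb
      have h := (facts b hb).2
      have h1 : 0 ≤ r * ‖latVec b‖ := by positivity
      have h2 : 0 ≤ t / r * |pdet v (latVec b)| := by positivity
      refine ⟨by linarith, ?_⟩
      have h3 : t / r * |pdet v (latVec b)| < 1 := by linarith
      rw [div_mul_eq_mul_div, div_lt_one hr] at h3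
      nlinarith [abs_nonneg (pdet v (latVec b))]
    have hsum : ∑ b ∈ P, chanWeight r t b v = chanWeight r t a v := by
      refine Finset.sum_eq_single_of_mem a ha fun b hb hba => ?_
      by_contra hne'
      exact hba (eq_of_primitive_near hr (hP b hb) (hP a ha) (facts b hne').1 (facts a hne).1
        (small b hne').1 (small a hne).1 (small b hne').2 (small a hne).2)
    have ha0 : a ≠ 0 := by
      rintro rfl
      simpa using hP 0 ha
    set d := pdet v (latVec a) with hd
    set L := ‖latVec a‖ with hL
    have hw : chanWeight r t a v = max 0 ((1 - r * L / 2 - t / r * |d|) - r * L / 2) := by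
      rw [chanWeight, if_pos (facts a hne).1]
      congr 1
      ring
    have hL0 : 0 ≤ L := norm_nonneg _
    have h1 := abs_integral_strip_sub_le hg hR hr (by linarith) hη ha0
      ((if 0 ≤ d then 0 else t) * d / r) (p := r * L / 2) (q := 1 - r * L / 2 - t / r * |d|)
      (by positivity) (by
        have : 0 ≤ r * L / 2 := by positivity
        have : 0 ≤ t / r * |d| := by positivity
        linarith)
    rw [hsum, hw]
    refine (sub_le_of_abs_sub_le_right (by rwa [abs_sub_comm] at h1)).trans ?_
    refine integral_mono (hgi.indicator (measurableSet_stripSet _ _ _ _ _))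
      (hgi.indicator (measurableSet_isFree_plane hr t v)) fun x => ?_
    refine indicator_le_indicator_of_subset (fun x hx => ?_) hg0 x
    exact isFree_of_fract_mem hr ha0 hx
  · push Not at hex
    rw [Finset.sum_eq_zero hex, zero_mul, zero_sub]
    have h1 : 0 ≤ ∫ x, {x : Plane | IsFree r t (x, v)}.indicator g x :=
      integral_nonneg fun x => indicator_nonneg (fun x _ => hg0 x) x
    have h2 : 0 ≤ η * volume.real (Metric.closedBall (0 : Plane) (R + 1)) := by positivity
    linarith

/-- For a given velocity the free mass is at most that in slightly longer channels. -/
lemma integral_isFree_le {g : Plane → ℝ} (hg : Continuous g) (hg0 : ∀ x, 0 ≤ g x) {R r η t X : ℝ}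
    (hR : ∀ x, R < ‖x‖ → g x = 0) (hr : 0 < r) (hr4 : r ≤ 1 / 4)
    (hη : ∀ x w, ‖w‖ ≤ r → |g (x + w) - g x| ≤ η) (ht : 4 ≤ t) (v : Circ) (hX : 1 / r ≤ X) :
    ∫ x, {x : Plane | IsFree r t (x, v)}.indicator g x ≤
      (∑ a ∈ primDisc X, chanWeight r (t - 4) a v + r ^ 3) * (∫ x, g x) +
        η * volume.real (Metric.closedBall (0 : Plane) (R + 1)) := by
  have hgi : Integrable g := hg.integrable_of_hasCompactSupport
    (HasCompactSupport.of_support_subset_isCompact (isCompact_closedBall (0 : Plane) R)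
      fun x hx => by
        rw [mem_closedBall_zero_iff]
        by_contra! h
        exact hx (hR x h))
  obtain ⟨a, hgcd, hd, hs0, hs⟩ := exists_primitive_near hr hr4 v
  have ha0 : a ≠ 0 := by
    rintro rfl
    simp at hgcd
  have hfree : ∀ x, IsFree r t (x, v) → x ∈ stripSet r
      ((if 0 ≤ pdet v (latVec a) then 2 else t - 2) * pdet v (latVec a) / r)
      (r * pdot v (latVec a) / 2)
      (1 - r * pdot v (latVec a) / 2 - (t - 4) / r * |pdet v (latVec a)|) a :=
    fun x hx => hx.fract_mem hr ht hgcd hd hs0 hs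
  have hsq := pdet_sq_add_pdot_sq v (latVec a)
  have hw : chanWeight r (t - 4) a v =
      max 0 (1 - r * ‖latVec a‖ - (t - 4) / r * |pdet v (latVec a)|) := by
    rw [chanWeight, if_pos hs0]
  have hL1 := one_le_norm_latVec ha0
  have hmem : ‖latVec a‖ ≤ X → a ∈ primDisc X := fun h => mem_primDisc.2 ⟨hgcd, h⟩
  set s := pdot v (latVec a)
  set d := pdet v (latVec a)
  set L := ‖latVec a‖
  have ht4 : 0 ≤ (t - 4) / r * |d| := mul_nonneg (div_nonneg (by linarith) hr.le) (abs_nonneg _)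
  have h1 := abs_integral_strip_sub_le hg hR hr (by linarith) hη ha0
      ((if 0 ≤ d then 2 else t - 2) * d / r) (p := r * s / 2)
      (q := 1 - r * s / 2 - (t - 4) / r * |d|) (by positivity) (by
        have : 0 ≤ r * s / 2 := by positivity
        linarith)
  have h2 : ∫ x, {x : Plane | IsFree r t (x, v)}.indicator g x ≤
      ∫ x, (stripSet r ((if 0 ≤ d then 2 else t - 2) * d / r) (r * s / 2)
        (1 - r * s / 2 - (t - 4) / r * |d|) a).indicator g x :=
    integral_mono (hgi.indicator (measurableSet_isFree_plane hr t v))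
      (hgi.indicator (measurableSet_stripSet _ _ _ _ _))
      fun x => indicator_le_indicator_of_subset hfree hg0 x
  have h3 := (abs_le.1 h1).2
  have hsL : r * L - r ^ 3 ≤ r * s := by
    rw [norm_circ] at hsq
    have hd2 : d ^ 2 ≤ r ^ 2 := sq_le_sq' (by linarith [abs_le.1 hd]) (abs_le.1 hd).2
    have : L - s ≤ r ^ 2 := by
      by_contra! hlt
      nlinarith
    nlinarith
  have hmax : max 0 (1 - r * s / 2 - (t - 4) / r * |d| - r * s / 2) ≤
      ∑ a ∈ primDisc X, chanWeight r (t - 4) a v + r ^ 3 := by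
    have hsum0 : 0 ≤ ∑ a ∈ primDisc X, chanWeight r (t - 4) a v :=
      Finset.sum_nonneg fun _ _ => chanWeight_nonneg _ _ _ _
    have hr3 : 0 < r ^ 3 := by positivity
    refine max_le (by linarith) ?_
    by_cases hLX : L ≤ X
    · have := Finset.single_le_sum (f := fun a => chanWeight r (t - 4) a v)
        (fun _ _ => chanWeight_nonneg _ _ _ _) (hmem hLX)
      simp only [hw] at this
      have := (le_max_right _ _).trans this
      linarith
    · have : 1 / r < L := hX.trans_lt (not_le.1 hLX)
      rw [div_lt_iff₀' hr] at this
      linarith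
  have hg0' : 0 ≤ ∫ x, g x := integral_nonneg hg0
  have := mul_le_mul_of_nonneg_right hmax hg0'
  linarith

/-- The integral over the positions, as a function of the velocity. -/
noncomputable def velMass (h : Phase → ℝ) (v : Circ) : ℝ := ∫ x : Plane, h (x, v)

/-- The integral of `h` over the free trajectories. -/
noncomputable def freeInt (t : ℝ) (h : Phase → ℝ) (r : ℝ) : ℝ :=
  ∫ p, {p : Phase | IsFree r t p}.indicator h p ∂dxdv

section

variable {h : Phase → ℝ}

lemma exists_radius (hc : HasCompactSupport h) : ∃ R : ℝ, ∀ x v, R < ‖x‖ → h (x, v) = 0 := by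
  obtain ⟨R, hR⟩ := (hc.isCompact.image continuous_fst).isBounded.exists_norm_le
  refine ⟨R, fun x v hx => ?_⟩
  by_contra hne
  exact absurd (hR x ⟨(x, v), subset_tsupport _ hne, rfl⟩) (not_le.2 hx)

lemma continuous_velMass (hh : Continuous h) (hc : HasCompactSupport h) :
    Continuous (velMass h) := by
  obtain ⟨R, hR⟩ := exists_radius hc
  rw [← continuousOn_univ]
  refine continuousOn_integral_of_compact_support (f := fun v x => h (x, v))
    (isCompact_closedBall (0 : Plane) R) (Continuous.continuousOn (by fun_prop)) ?_
  intro v x _ hx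
  rw [mem_closedBall_zero_iff, not_le] at hx
  exact hR x v hx

lemma velMass_nonneg (h0 : ∀ p, 0 ≤ h p) (v : Circ) : 0 ≤ velMass h v :=
  integral_nonneg fun _ => h0 _

instance : IsFiniteMeasureOnCompacts dxdv := by unfold dxdv; infer_instance

instance : SFinite dxdv := by unfold dxdv; infer_instance

lemma integrable_phase (hh : Continuous h) (hc : HasCompactSupport h) : Integrable h dxdv :=
  hh.integrable_of_hasCompactSupport hc

lemma freeInt_eq (hh : Continuous h) (hc : HasCompactSupport h) {r : ℝ} (hr : 0 < r) (t : ℝ) :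
    freeInt t h r = ∫ v, (∫ x, {x : Plane | IsFree r t (x, v)}.indicator (fun x => h (x, v)) x)
      ∂dv := by
  have hi := (integrable_phase hh hc).indicator (measurableSet_isFree_phase hr t)
  rw [dxdv] at hi
  rw [freeInt, dxdv, integral_prod_symm _ hi]
  rfl

lemma integral_velMass (hh : Continuous h) (hc : HasCompactSupport h) :
    ∫ p, h p ∂dxdv = ∫ v, velMass h v ∂dv := by
  have hi := integrable_phase hh hc
  rw [dxdv] at hi
  rw [dxdv, integral_prod_symm _ hi]
  rfl

lemma integrable_inner (hh : Continuous h) (hc : HasCompactSupport h) {r : ℝ} (hr : 0 < r)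
    (t : ℝ) : Integrable (fun v => ∫ x, {x : Plane | IsFree r t (x, v)}.indicator
      (fun x => h (x, v)) x) dv := by
  have hi := (integrable_phase hh hc).indicator (measurableSet_isFree_phase hr t)
  rw [dxdv] at hi
  exact hi.integral_prod_right

lemma exists_modulus (hh : Continuous h) (hc : HasCompactSupport h) {η : ℝ} (hη : 0 < η) :
    ∃ δ > 0, ∀ x w v, ‖w‖ ≤ δ → |h (x + w, v) - h (x, v)| ≤ η := by
  have hu := hc.uniformContinuous_of_continuous hh
  obtain ⟨δ, hδ, H⟩ := Metric.uniformContinuous_iff.1 hu η hη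
  refine ⟨δ / 2, by positivity, fun x w v hw => ?_⟩
  rw [← Real.dist_eq]
  refine (H ?_).le
  rw [Prod.dist_eq]
  simp only [dist_self, dist_self_add_left]
  exact max_lt (by linarith) hδ

lemma exists_modulus_velMass (hh : Continuous h) (hc : HasCompactSupport h) {e : ℝ} (he : 0 < e) :
    ∃ δ > 0, ∀ v u : Circ, dist v u ≤ δ → |velMass h v - velMass h u| ≤ e := by
  have hu := CompactSpace.uniformContinuous_of_continuous (continuous_velMass hh hc)
  obtain ⟨δ, hδ, H⟩ := Metric.uniformContinuous_iff.1 hu e he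
  refine ⟨δ / 2, by positivity, fun v u hvu => ?_⟩
  rw [← Real.dist_eq]
  exact (H (by linarith)).le

lemma exists_bound_velMass (hh : Continuous h) (hc : HasCompactSupport h) :
    ∃ K, ∀ v, |velMass h v| ≤ K := by
  obtain ⟨K, hK⟩ := isCompact_univ.exists_bound_of_continuousOn
    (continuous_velMass hh hc).continuousOn
  exact ⟨K, fun v => hK v (mem_univ v)⟩

/-- The free mass at small `r` is bounded above by a sum over primitive vectors. -/
lemma exists_freeInt_le (hh : Continuous h) (hc : HasCompactSupport h) (h0 : ∀ p, 0 ≤ h p)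
    {t : ℝ} (ht : 6 ≤ t) {e : ℝ} (he : 0 < e) :
    ∃ r₀ > 0, r₀ ≤ 1 / 4 ∧ ∀ r, 0 < r → r ≤ r₀ → ∀ X, 1 / r ≤ X →
      freeInt t h r ≤ ∑ a ∈ primDisc X, (velMass h (dir (latVec a)) + e) *
        (r * max 0 (1 - r * ‖latVec a‖) ^ 2 / (‖latVec a‖ * (t - 5))) + e := by
  obtain ⟨R, hR⟩ := exists_radius hc
  set V := volume.real (Metric.closedBall (0 : Plane) (R + 1)) with hV
  have hpi := Real.pi_pos
  have hV0 : 0 ≤ V := measureReal_nonneg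
  set η := e / (2 * (2 * Real.pi * (V + 1))) with hηdef
  have hη : 0 < η := by positivity
  obtain ⟨δ₁, hδ₁, H1⟩ := exists_modulus hh hc hη
  obtain ⟨δ₂, hδ₂, H2⟩ := exists_modulus_velMass hh hc he
  set I := ∫ v, velMass h v ∂dv with hI
  have hI0 : 0 ≤ I := integral_nonneg fun v => velMass_nonneg h0 v
  refine ⟨min (1 / 4) (min δ₁ (min (δ₂ / 2) (e / (2 * (I + 1))))), by positivity,
    min_le_left _ _, fun r hr hr0 X hX => ?_⟩
  simp only [le_min_iff] at hr0
  obtain ⟨hr4, hr1, hr2, hr3⟩ := hr0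
  rw [freeInt_eq hh hc hr t]
  have hGi := continuous_integrable_dv (continuous_velMass hh hc)
  have hWi : ∀ a, Integrable (chanWeight r (t - 4) a) dv := fun a =>
    integrable_chanWeight hr (by linarith) a
  have hpt : ∀ v, (∫ x, {x : Plane | IsFree r t (x, v)}.indicator (fun x => h (x, v)) x) ≤
      ∑ a ∈ primDisc X, (velMass h (dir (latVec a)) + e) * chanWeight r (t - 4) a v +
        r ^ 3 * velMass h v + η * V := by
    intro v
    have h1 := integral_isFree_le (g := fun x => h (x, v)) (by fun_prop) (fun x => h0 _)
      (fun x hx => hR x v hx) hr hr4 (fun x w hw => H1 x w v (hw.trans hr1))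
      (t := t) (by linarith) v hX
    refine h1.trans ?_
    rw [add_mul, Finset.sum_mul]
    refine add_le_add_left (add_le_add_left (Finset.sum_le_sum fun a ha => ?_) _) _
    change _ * velMass h v ≤ _
    rw [mul_comm]
    by_cases hz : chanWeight r (t - 4) a v = 0
    · simp [hz]
    · have ha0 : a ≠ 0 := by
        rintro rfl
        simp [mem_primDisc] at ha
      have hdist := dist_dir_le_of_chanWeight_ne_zero hr (by linarith) ha0 hz
      have := (abs_le.1 (H2 v _ (hdist.trans (by linarith)))).2
      refine mul_le_mul_of_nonneg_right (by linarith) (chanWeight_nonneg _ _ _ _)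
  have hsumi : Integrable (fun v => ∑ a ∈ primDisc X,
      (velMass h (dir (latVec a)) + e) * chanWeight r (t - 4) a v) dv :=
    integrable_finsetSum _ fun a _ => (hWi a).const_mul _
  have hmono := integral_mono (integrable_inner hh hc hr t)
    ((hsumi.add (hGi.const_mul (r ^ 3))).add (integrable_const (η * V))) hpt
  refine hmono.trans ?_
  rw [integral_add' (hsumi.add (hGi.const_mul _)) (integrable_const _),
    integral_add' hsumi (hGi.const_mul _), integral_const, dv_univ, integral_const_mul,
    integral_finsetSum _ fun a _ => (hWi a).const_mul _, smul_eq_mul, ← hI]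
  have e1 : 2 * Real.pi * (η * V) ≤ e / 2 := by
    have : η * (2 * (2 * Real.pi * (V + 1))) = e := by rw [hηdef]; field_simp
    nlinarith [mul_pos hpi hη]
  have e2 : r ^ 3 * I ≤ e / 2 := by
    rw [le_div_iff₀ (by positivity)] at hr3
    have : r ^ 3 ≤ r := by nlinarith [mul_pos hr hr]
    nlinarith
  have e3 : ∑ a ∈ primDisc X, ∫ v, (velMass h (dir (latVec a)) + e) * chanWeight r (t - 4) a v ∂dv
      ≤ ∑ a ∈ primDisc X, (velMass h (dir (latVec a)) + e) *
        (r * max 0 (1 - r * ‖latVec a‖) ^ 2 / (‖latVec a‖ * (t - 5))) := by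
    refine Finset.sum_le_sum fun a ha => ?_
    have ha0 : a ≠ 0 := by
      rintro rfl
      simp [mem_primDisc] at ha
    rw [integral_const_mul]
    have := integral_chanWeight_le hr hr4 (t := t - 4) (by linarith) ha0
    rw [show t - 4 - 1 = t - 5 by ring] at this
    exact mul_le_mul_of_nonneg_left this (by linarith [velMass_nonneg h0 (dir (latVec a))])
  linarith

/-- The free mass at small `r` is bounded below by a sum over primitive vectors. -/
lemma exists_le_freeInt (hh : Continuous h) (hc : HasCompactSupport h) (h0 : ∀ p, 0 ≤ h p)
    {t : ℝ} (ht : 2 ≤ t) {e : ℝ} (he : 0 < e) :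
    ∃ r₀ > 0, r₀ ≤ 1 / 4 ∧ ∀ r, 0 < r → r ≤ r₀ → ∀ X,
      ∑ a ∈ primDisc X, max 0 (velMass h (dir (latVec a)) - e) *
        (r * max 0 (1 - r * ‖latVec a‖) ^ 2 / (‖latVec a‖ * t)) - e ≤ freeInt t h r := by
  obtain ⟨R, hR⟩ := exists_radius hc
  set V := volume.real (Metric.closedBall (0 : Plane) (R + 1)) with hV
  have hpi := Real.pi_pos
  have hV0 : 0 ≤ V := measureReal_nonneg
  set η := e / (2 * Real.pi * (V + 1)) with hηdef
  have hη : 0 < η := by positivity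
  obtain ⟨δ₁, hδ₁, H1⟩ := exists_modulus hh hc hη
  obtain ⟨δ₂, hδ₂, H2⟩ := exists_modulus_velMass hh hc he
  refine ⟨min (1 / 4) (min δ₁ (δ₂ / 2)), by positivity, min_le_left _ _,
    fun r hr hr0 X => ?_⟩
  simp only [le_min_iff] at hr0
  obtain ⟨hr4, hr1, hr2⟩ := hr0
  rw [freeInt_eq hh hc hr t]
  have hWi : ∀ a, Integrable (chanWeight r t a) dv := fun a =>
    integrable_chanWeight hr (by linarith) a
  have hpt : ∀ v, ∑ a ∈ primDisc X, max 0 (velMass h (dir (latVec a)) - e) * chanWeight r t a v -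
      η * V ≤ (∫ x, {x : Plane | IsFree r t (x, v)}.indicator (fun x => h (x, v)) x) := by
    intro v
    have h1 := le_integral_isFree (g := fun x => h (x, v)) (by fun_prop) (fun x => h0 _)
      (fun x hx => hR x v hx) hr hr4 (fun x w hw => H1 x w v (hw.trans hr1)) ht v
      (P := primDisc X) fun a ha => (mem_primDisc.1 ha).1
    refine le_trans ?_ h1
    rw [Finset.sum_mul]
    refine sub_le_sub_right (Finset.sum_le_sum fun a ha => ?_) _
    change _ ≤ _ * velMass h v
    rw [mul_comm (chanWeight r t a v)]
    by_cases hz : chanWeight r t a v = 0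
    · simp [hz]
    · have ha0 : a ≠ 0 := by
        rintro rfl
        simp [mem_primDisc] at ha
      have hdist := dist_dir_le_of_chanWeight_ne_zero hr (by linarith) ha0 hz
      have := (abs_le.1 (H2 v _ (hdist.trans (by linarith)))).1
      exact mul_le_mul_of_nonneg_right (max_le (velMass_nonneg h0 v) (by linarith))
        (chanWeight_nonneg _ _ _ _)
  have hsumi : Integrable (fun v => ∑ a ∈ primDisc X,
      max 0 (velMass h (dir (latVec a)) - e) * chanWeight r t a v) dv :=
    integrable_finsetSum _ fun a _ => (hWi a).const_mul _
  have hmono := integral_mono (hsumi.sub (integrable_const (η * V)))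
    (integrable_inner hh hc hr t) hpt
  refine le_trans ?_ hmono
  rw [integral_sub' hsumi (integrable_const _), integral_const, dv_univ,
    integral_finsetSum _ fun a _ => (hWi a).const_mul _, smul_eq_mul]
  have e1 : 2 * Real.pi * (η * V) ≤ e := by
    have : η * (2 * Real.pi * (V + 1)) = e := by rw [hηdef]; field_simp
    nlinarith [mul_pos hpi hη]
  have e3 : ∑ a ∈ primDisc X, max 0 (velMass h (dir (latVec a)) - e) *
        (r * max 0 (1 - r * ‖latVec a‖) ^ 2 / (‖latVec a‖ * t)) ≤
      ∑ a ∈ primDisc X, ∫ v, max 0 (velMass h (dir (latVec a)) - e) * chanWeight r t a v ∂dv := by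
    refine Finset.sum_le_sum fun a ha => ?_
    have ha0 : a ≠ 0 := by
      rintro rfl
      simp [mem_primDisc] at ha
    rw [integral_const_mul]
    exact mul_le_mul_of_nonneg_left (le_integral_chanWeight hr hr4 (by linarith) ha0)
      (le_max_left _ _)
  linarith

end

/-! ### The logarithmic average over the size of the holes -/

lemma integral_one_sub_mul_sq {L : ℝ} (hL : 0 < L) (a b : ℝ) :
    ∫ r in a..b, (1 - r * L) ^ 2 = ((1 - a * L) ^ 3 - (1 - b * L) ^ 3) / (3 * L) := by
  have hderiv : ∀ r ∈ uIcc a b, HasDerivAt (fun r : ℝ => -(1 - r * L) ^ 3 / (3 * L))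
      ((1 - r * L) ^ 2) r := by
    intro r _
    have h1 : HasDerivAt (fun r : ℝ => 1 - r * L) (-(1 * L)) r :=
      ((hasDerivAt_id r).mul_const L).const_sub 1
    convert! ((h1.pow 3).neg.div_const (3 * L)) using 1
    field_simp
    ring
  rw [intervalIntegral.integral_eq_sub_of_hasDerivAt hderiv
    (Continuous.intervalIntegrable (by fun_prop) _ _)]
  ring

lemma integral_max_sq_le {L ε r₀ : ℝ} (hL : 0 < L) (hε : 0 ≤ ε) (hr₀ : ε ≤ r₀) :
    ∫ r in ε..r₀, max 0 (1 - r * L) ^ 2 ≤ 1 / (3 * L) := by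
  have hc : Continuous fun r : ℝ => max 0 (1 - r * L) ^ 2 := by fun_prop
  have hi : ∀ a b, IntervalIntegrable (fun r : ℝ => max 0 (1 - r * L) ^ 2) volume a b :=
    fun a b => hc.intervalIntegrable a b
  have hLi : 0 < 1 / L := by positivity
  have h1 : ∫ r in ε..r₀, max 0 (1 - r * L) ^ 2 ≤
      ∫ r in (0 : ℝ)..(max r₀ (1 / L)), max 0 (1 - r * L) ^ 2 :=
    intervalIntegral.integral_mono_interval hε hr₀ (le_max_left _ _)
      (ae_of_all _ fun r => by positivity) (hi _ _)
  refine h1.trans (le_of_eq ?_)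
  rw [← intervalIntegral.integral_add_adjacent_intervals (hi 0 (1 / L)) (hi (1 / L) _)]
  have e1 : ∫ r in (0 : ℝ)..(1 / L), max 0 (1 - r * L) ^ 2 =
      ∫ r in (0 : ℝ)..(1 / L), (1 - r * L) ^ 2 := by
    refine intervalIntegral.integral_congr fun r hr => ?_
    rw [uIcc_of_le hLi.le] at hr
    have := hr.2
    rw [le_div_iff₀ hL] at this
    rw [max_eq_right (by linarith)]
  have e2 : ∫ r in (1 / L)..(max r₀ (1 / L)), max 0 (1 - r * L) ^ 2 =
      ∫ r in (1 / L)..(max r₀ (1 / L)), (0 : ℝ) := by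
    refine intervalIntegral.integral_congr fun r hr => ?_
    rw [uIcc_of_le (le_max_right _ _)] at hr
    have := hr.1
    rw [div_le_iff₀ hL] at this
    rw [max_eq_left (by linarith)]
    norm_num
  rw [e1, e2, integral_one_sub_mul_sq hL]
  simp [hL.ne']

lemma le_integral_max_sq {L ε r₀ : ℝ} (hL : 0 < L) (hε : ε * L ≤ 1) (hr₀ : 1 ≤ r₀ * L) :
    (1 - ε * L) ^ 3 / (3 * L) ≤ ∫ r in ε..r₀, max 0 (1 - r * L) ^ 2 := by
  have h1 : ε ≤ 1 / L := by rwa [le_div_iff₀ hL]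
  have h2 : 1 / L ≤ r₀ := by rwa [div_le_iff₀ hL]
  calc (1 - ε * L) ^ 3 / (3 * L) = ∫ r in ε..(1 / L), (1 - r * L) ^ 2 := by
        rw [integral_one_sub_mul_sq hL]
        simp [hL.ne']
    _ = ∫ r in ε..(1 / L), max 0 (1 - r * L) ^ 2 := by
        refine intervalIntegral.integral_congr fun r hr => ?_
        rw [uIcc_of_le h1] at hr
        have := hr.2
        rw [le_div_iff₀ hL] at this
        rw [max_eq_right (by linarith)]
    _ ≤ ∫ r in ε..r₀, max 0 (1 - r * L) ^ 2 :=
        intervalIntegral.integral_mono_interval le_rfl h1 h2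
          (ae_of_all _ fun r => by positivity)
          (Continuous.intervalIntegrable (by fun_prop) _ _)

section

variable {h : Phase → ℝ}

lemma freeInt_nonneg (h0 : ∀ p, 0 ≤ h p) (t r : ℝ) : 0 ≤ freeInt t h r :=
  integral_nonneg fun p => indicator_nonneg (fun p _ => h0 p) p

lemma freeInt_le (hh : Continuous h) (hc : HasCompactSupport h) (h0 : ∀ p, 0 ≤ h p) {r : ℝ}
    (hr : 0 < r) (t : ℝ) : freeInt t h r ≤ ∫ v, velMass h v ∂dv := by
  have hi := integrable_phase hh hc
  rw [← integral_velMass hh hc]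
  exact integral_mono (hi.indicator (measurableSet_isFree_phase hr t)) hi
    (indicator_le_self' fun p _ => h0 p)

/-- Absolute convergence of the double integral over the hole sizes and the phase space, which
allows the order of integration to be exchanged. -/
lemma integrable_freePair (hh : Continuous h) (hc : HasCompactSupport h) {ε : ℝ} (hε : 0 < ε)
    (t : ℝ) : Integrable (fun q : ℝ × Phase =>
      {q : ℝ × Phase | 0 < q.1 ∧ IsFree q.1 t q.2}.indicator (fun q => h q.2 / q.1) q)
      ((volume.restrict (Ioc ε (1 / 4))).prod dxdv) := by
  refine Integrable.indicator ?_ (measurableSet_isFree t)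
  have h1 : Integrable (fun r : ℝ => r⁻¹) (volume.restrict (Ioc ε (1 / 4))) := by
    refine IntegrableOn.mono_set (t := Icc ε (1 / 4)) ?_ Ioc_subset_Icc_self
    refine ContinuousOn.integrableOn_Icc ?_
    exact ContinuousOn.inv₀ continuousOn_id fun r hr => (hε.trans_le hr.1).ne'
  have := h1.mul_prod (integrable_phase hh hc)
  refine this.congr (ae_of_all _ fun q => ?_)
  simp only
  rw [div_eq_inv_mul]

lemma freePair_eq {r : ℝ} (hr : 0 < r) (t : ℝ) (p : Phase) :
    {q : ℝ × Phase | 0 < q.1 ∧ IsFree q.1 t q.2}.indicator (fun q => h q.2 / q.1) (r, p) =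
      {p : Phase | IsFree r t p}.indicator h p / r := by
  by_cases hp : IsFree r t p
  · have h1 : (r, p) ∈ {q : ℝ × Phase | 0 < q.1 ∧ IsFree q.1 t q.2} := ⟨hr, hp⟩
    have h2 : p ∈ {p : Phase | IsFree r t p} := hp
    rw [indicator_of_mem h1, indicator_of_mem h2]
  · rw [indicator_of_notMem (fun hq => hp hq.2), indicator_of_notMem (fun hq => hp hq), zero_div]

lemma intervalIntegrable_freeInt_div (hh : Continuous h) (hc : HasCompactSupport h) {ε b : ℝ}
    (hε : 0 < ε) (hεb : ε ≤ b) (hb : b ≤ 1 / 4) (t : ℝ) :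
    IntervalIntegrable (fun r => freeInt t h r / r) volume ε b := by
  rw [intervalIntegrable_iff_integrableOn_Ioc_of_le hεb]
  have h1 := (integrable_freePair hh hc hε t).integral_prod_left
  refine IntegrableOn.mono_set (t := Ioc ε (1 / 4)) ?_ (Ioc_subset_Ioc_right hb)
  refine h1.congr ((ae_restrict_iff' measurableSet_Ioc).2 (ae_of_all _ fun r hr => ?_))
  simp only [freePair_eq (hε.trans hr.1)]
  rw [integral_div]
  rfl

/-- The logarithmic average of the free mass. -/
noncomputable def logAverage (t : ℝ) (h : Phase → ℝ) (ε : ℝ) : ℝ :=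
  1 / |Real.log ε| * ∫ r in ε..(1 / 4), freeInt t h r / r

lemma tendsto_primSum_inv {G : Circ → ℝ} (hG : Continuous G) (h0 : ∀ v, 0 ≤ G v) {κ : ℝ}
    (hκ : 0 < κ) : Tendsto (fun ε : ℝ => primSum G (κ / ε) / |Real.log ε|) (𝓝[>] 0)
      (𝓝 (6 / Real.pi ^ 2 * ∫ v, G v ∂dv)) := by
  have h1 := ((tendsto_primSum_div_log hG h0).comp (tendsto_id.const_mul_atTop hκ)).mul
    (tendsto_log_mul_div_log hκ)
  rw [mul_one] at h1
  have h2 := h1.comp tendsto_inv_nhdsGT_zero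
  refine h2.congr' ?_
  filter_upwards [Ioo_mem_nhdsGT (lt_min one_pos hκ)] with ε hε
  have hε1 : ε < 1 := hε.2.trans_le (min_le_left _ _)
  have hεκ : ε < κ := hε.2.trans_le (min_le_right _ _)
  have hlog : 0 < Real.log (κ * ε⁻¹) := by
    apply Real.log_pos
    rw [← div_eq_mul_inv, one_lt_div hε.1]
    exact hεκ
  simp only [Function.comp_apply, id]
  rw [div_mul_div_cancel₀ hlog.ne', Real.log_inv, abs_of_neg (Real.log_neg hε.1 hε1),
    div_eq_mul_inv κ]

lemma integral_inv_le {ε r₀ : ℝ} (hε : 0 < ε) (hε1 : ε ≤ 1) (hr₀ : 0 < r₀) (hr₁ : r₀ ≤ 1) :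
    ∫ r in ε..r₀, r⁻¹ ≤ |Real.log ε| := by
  rw [integral_inv_of_pos hε hr₀, Real.log_div hr₀.ne' hε.ne',
    abs_of_nonpos (Real.log_nonpos hε.le hε1)]
  linarith [Real.log_nonpos hr₀.le hr₁]

lemma tendsto_const_div_abs_log (K : ℝ) :
    Tendsto (fun ε : ℝ => K / |Real.log ε|) (𝓝[>] 0) (𝓝 0) :=
  (tendsto_abs_atBot_atTop.comp Real.tendsto_log_nhdsGT_zero).const_div_atTop K

/-- The logarithmic average is asymptotically at most the prediction at time `t - 5`. -/
lemma eventually_logAverage_le (hh : Continuous h) (hc : HasCompactSupport h)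
    (h0 : ∀ p, 0 ≤ h p) {t : ℝ} (ht : 6 ≤ t) {b : ℝ}
    (hb : 2 / (Real.pi ^ 2 * (t - 5)) * ∫ v, velMass h v ∂dv < b) :
    ∀ᶠ ε in 𝓝[>] 0, logAverage t h ε ≤ b := by
  have hpi := Real.pi_pos
  have hG := continuous_velMass hh hc
  set I := ∫ v, velMass h v ∂dv with hI
  have ht5 : 0 < t - 5 := by linarith
  -- the loss `e` covers the oscillation of `velMass h` in a channel and the errors of `freeInt`
  obtain ⟨e, he, heb⟩ : ∃ e > 0, 1 / (3 * (t - 5)) *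
      (6 / Real.pi ^ 2 * (I + 2 * Real.pi * e)) + e < b := by
    have hcont : Continuous fun e : ℝ => 1 / (3 * (t - 5)) *
      (6 / Real.pi ^ 2 * (I + 2 * Real.pi * e)) + e := by fun_prop
    have h1 : 1 / (3 * (t - 5)) * (6 / Real.pi ^ 2 * (I + 2 * Real.pi * 0)) + 0 < b := by
      convert hb using 1
      field_simp
      ring
    have h2 := (hcont.tendsto 0).eventually_lt_const h1
    obtain ⟨e, he, he'⟩ := ((h2.filter_mono nhdsWithin_le_nhds).and
      (self_mem_nhdsWithin : Ioi (0 : ℝ) ∈ 𝓝[>] 0)).exists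
    exact ⟨e, he', he⟩
  obtain ⟨r₀, hr₀, hr₀4, H⟩ := exists_freeInt_le hh hc h0 ht he
  set Ge : Circ → ℝ := fun v => velMass h v + e with hGe
  have hGec : Continuous Ge := hG.add continuous_const
  have hGe0 : ∀ v, 0 ≤ Ge v := fun v => add_nonneg (velMass_nonneg h0 v) he.le
  have hGeI : ∫ v, Ge v ∂dv = I + 2 * Real.pi * e := by
    rw [hGe, integral_add (continuous_integrable_dv hG) (integrable_const _), integral_const,
      dv_univ, smul_eq_mul]
  set K := ∫ r in r₀..(1 / 4), freeInt t h r / r with hK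
  have hlim : Tendsto (fun ε : ℝ => 1 / (3 * (t - 5)) * (primSum Ge (1 / ε) / |Real.log ε|) + e +
      K / |Real.log ε|) (𝓝[>] 0)
      (𝓝 (1 / (3 * (t - 5)) * (6 / Real.pi ^ 2 * (I + 2 * Real.pi * e)) + e)) := by
    have := (((tendsto_primSum_inv hGec hGe0 one_pos).const_mul (1 / (3 * (t - 5)))).add_const
      e).add (tendsto_const_div_abs_log K)
    rwa [hGeI, add_zero] at this
  filter_upwards [hlim.eventually_lt_const heb, Ioo_mem_nhdsGT hr₀] with ε hε1 hε2
  refine le_trans ?_ hε1.le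
  obtain ⟨hε0, hεr⟩ := hε2
  have hlog : 0 < |Real.log ε| := abs_pos.2 (Real.log_neg hε0 (by linarith)).ne
  rw [logAverage, ← intervalIntegral.integral_add_adjacent_intervals
    (intervalIntegrable_freeInt_div hh hc hε0 hεr.le hr₀4 t)
    (intervalIntegrable_freeInt_div hh hc hr₀ hr₀4 le_rfl t), ← hK]
  have hmono : ∫ r in ε..r₀, freeInt t h r / r ≤ ∫ r in ε..r₀,
      (∑ a ∈ primDisc (1 / ε), Ge (dir (latVec a)) / (‖latVec a‖ * (t - 5)) *
        max 0 (1 - r * ‖latVec a‖) ^ 2 + e * r⁻¹) := by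
    refine intervalIntegral.integral_mono_on hεr.le
      (intervalIntegrable_freeInt_div hh hc hε0 hεr.le hr₀4 t) ?_ fun r hr => ?_
    · refine ContinuousOn.intervalIntegrable ?_
      rw [uIcc_of_le hεr.le]
      refine ContinuousOn.add (Continuous.continuousOn (by fun_prop)) ?_
      exact ContinuousOn.mul continuousOn_const
        (ContinuousOn.inv₀ continuousOn_id fun r hr => (hε0.trans_le hr.1).ne')
    · have hr0 : 0 < r := hε0.trans_le hr.1
      have h1 := H r hr0 hr.2 (1 / ε) (one_div_le_one_div_of_le hε0 hr.1)
      rw [div_le_iff₀ hr0]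
      refine h1.trans (le_of_eq ?_)
      rw [add_mul, Finset.sum_mul, mul_assoc, inv_mul_cancel₀ hr0.ne', mul_one]
      congr 1
      refine Finset.sum_congr rfl fun a _ => ?_
      ring
  have hsum : ∫ r in ε..r₀,
      (∑ a ∈ primDisc (1 / ε), Ge (dir (latVec a)) / (‖latVec a‖ * (t - 5)) *
        max 0 (1 - r * ‖latVec a‖) ^ 2 + e * r⁻¹) ≤
      1 / (3 * (t - 5)) * primSum Ge (1 / ε) + e * |Real.log ε| := by
    rw [intervalIntegral.integral_add, intervalIntegral.integral_finsetSum,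
      intervalIntegral.integral_const_mul]
    · refine add_le_add ?_ (mul_le_mul_of_nonneg_left
        (integral_inv_le hε0 (by linarith) hr₀ (by linarith)) he.le)
      rw [primSum, Finset.mul_sum]
      refine Finset.sum_le_sum fun a ha => ?_
      have ha0 : a ≠ 0 := by
        rintro rfl
        simp [mem_primDisc] at ha
      have hL := one_le_norm_latVec ha0
      have hL0 : 0 < ‖latVec a‖ := by linarith
      rw [intervalIntegral.integral_const_mul]
      calc _ ≤ Ge (dir (latVec a)) / (‖latVec a‖ * (t - 5)) * (1 / (3 * ‖latVec a‖)) := by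
            refine mul_le_mul_of_nonneg_left (integral_max_sq_le hL0 hε0.le hεr.le) ?_
            exact div_nonneg (hGe0 _) (by positivity)
        _ = 1 / (3 * (t - 5)) * latTerm Ge a := by
            rw [latTerm]
            field_simp
    · intro a _
      exact Continuous.intervalIntegrable (by fun_prop) _ _
    · exact Continuous.intervalIntegrable (by fun_prop) _ _
    · refine ContinuousOn.intervalIntegrable ?_
      rw [uIcc_of_le hεr.le]
      exact ContinuousOn.mul continuousOn_const
        (ContinuousOn.inv₀ continuousOn_id fun r hr => (hε0.trans_le hr.1).ne')
  calc 1 / |Real.log ε| * ((∫ r in ε..r₀, freeInt t h r / r) + K)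
      ≤ 1 / |Real.log ε| * ((1 / (3 * (t - 5)) * primSum Ge (1 / ε) + e * |Real.log ε|) + K) := by
        gcongr
        exact hmono.trans hsum
    _ = _ := by field_simp

/-- The logarithmic average is asymptotically at least the prediction. Only lattice vectors with
`1 / r₀ < |a| ≤ e / ε` are kept, for which the range of integration in `r` contains almost all
of `[0, 1 / |a|]`. -/
lemma eventually_le_logAverage (hh : Continuous h) (hc : HasCompactSupport h)
    (h0 : ∀ p, 0 ≤ h p) {t : ℝ} (ht : 2 ≤ t) {b : ℝ}
    (hb : b < 2 / (Real.pi ^ 2 * t) * ∫ v, velMass h v ∂dv) :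
    ∀ᶠ ε in 𝓝[>] 0, b ≤ logAverage t h ε := by
  have hpi := Real.pi_pos
  have hG := continuous_velMass hh hc
  set I := ∫ v, velMass h v ∂dv with hI
  have ht0 : 0 < t := by linarith
  -- the loss `e`, also used as the proportion of the range of lattice vectors that is kept
  obtain ⟨e, he, he1, heb⟩ : ∃ e > 0, e < 1 ∧ b < (1 - e) ^ 3 / (3 * t) *
      (6 / Real.pi ^ 2 * (I - 2 * Real.pi * e)) - e := by
    have hcont : Continuous fun e : ℝ => (1 - e) ^ 3 / (3 * t) *
      (6 / Real.pi ^ 2 * (I - 2 * Real.pi * e)) - e := by fun_prop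
    have h1 : b < (1 - 0) ^ 3 / (3 * t) * (6 / Real.pi ^ 2 * (I - 2 * Real.pi * 0)) - 0 := by
      convert hb using 1
      field_simp
      ring
    have h2 := (hcont.tendsto 0).eventually_const_lt h1
    obtain ⟨e, he, he'⟩ := ((h2.filter_mono nhdsWithin_le_nhds).and
      (Ioo_mem_nhdsGT (one_pos : (0 : ℝ) < 1))).exists
    exact ⟨e, he'.1, he'.2, he⟩
  obtain ⟨r₀, hr₀, hr₀4, H⟩ := exists_le_freeInt hh hc h0 ht he
  set Ge : Circ → ℝ := fun v => max 0 (velMass h v - e) with hGe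
  have hGec : Continuous Ge := continuous_const.max (hG.sub continuous_const)
  have hGe0 : ∀ v, 0 ≤ Ge v := fun v => le_max_left _ _
  have hGeI : I - 2 * Real.pi * e ≤ ∫ v, Ge v ∂dv := by
    have h1 : ∫ v, (velMass h v - e) ∂dv = I - 2 * Real.pi * e := by
      rw [integral_sub (continuous_integrable_dv hG) (integrable_const _), integral_const,
        dv_univ, smul_eq_mul]
    rw [← h1]
    exact integral_mono ((continuous_integrable_dv hG).sub (integrable_const _))
      (continuous_integrable_dv hGec) fun v => le_max_right _ _
  have he3 : 0 ≤ (1 - e) ^ 3 / (3 * t) := by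
    have : 0 ≤ 1 - e := by linarith
    positivity
  set K := primSum Ge (1 / r₀) with hK
  have hlim : Tendsto (fun ε : ℝ => (1 - e) ^ 3 / (3 * t) * (primSum Ge (e / ε) / |Real.log ε| -
      K / |Real.log ε|) - e) (𝓝[>] 0)
      (𝓝 ((1 - e) ^ 3 / (3 * t) * (6 / Real.pi ^ 2 * ∫ v, Ge v ∂dv) - e)) := by
    have := (((tendsto_primSum_inv hGec hGe0 he).sub
      (tendsto_const_div_abs_log K)).const_mul ((1 - e) ^ 3 / (3 * t))).sub_const e
    rwa [sub_zero] at this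
  have heb' : b < (1 - e) ^ 3 / (3 * t) * (6 / Real.pi ^ 2 * ∫ v, Ge v ∂dv) - e := by
    refine heb.trans_le ?_
    gcongr
  filter_upwards [hlim.eventually_const_lt heb',
    Ioo_mem_nhdsGT (show 0 < min r₀ (e * r₀) by positivity)] with ε hε1 hε2
  refine le_trans hε1.le ?_
  obtain ⟨hε0, hεm⟩ := hε2
  have hεr : ε < r₀ := hεm.trans_le (min_le_left _ _)
  have hεe : ε < e * r₀ := hεm.trans_le (min_le_right _ _)
  have hlog : 0 < |Real.log ε| := abs_pos.2 (Real.log_neg hε0 (by linarith)).ne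
  have hsub : 1 / r₀ ≤ e / ε := by
    rw [div_le_div_iff₀ hr₀ hε0]; linarith
  rw [logAverage, ← intervalIntegral.integral_add_adjacent_intervals
    (intervalIntegrable_freeInt_div hh hc hε0 hεr.le hr₀4 t)
    (intervalIntegrable_freeInt_div hh hc hr₀ hr₀4 le_rfl t)]
  have htail : 0 ≤ ∫ r in r₀..(1 / 4), freeInt t h r / r :=
    intervalIntegral.integral_nonneg hr₀4 fun r hr =>
      div_nonneg (freeInt_nonneg h0 t r) (hr₀.le.trans hr.1)
  have hmono : ∫ r in ε..r₀,
      (∑ a ∈ primDisc (e / ε), Ge (dir (latVec a)) / (‖latVec a‖ * t) *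
        max 0 (1 - r * ‖latVec a‖) ^ 2 - e * r⁻¹) ≤ ∫ r in ε..r₀, freeInt t h r / r := by
    refine intervalIntegral.integral_mono_on hεr.le ?_
      (intervalIntegrable_freeInt_div hh hc hε0 hεr.le hr₀4 t) fun r hr => ?_
    · refine ContinuousOn.intervalIntegrable ?_
      rw [uIcc_of_le hεr.le]
      refine ContinuousOn.sub (Continuous.continuousOn (by fun_prop)) ?_
      exact ContinuousOn.mul continuousOn_const
        (ContinuousOn.inv₀ continuousOn_id fun r hr => (hε0.trans_le hr.1).ne')
    · have hr0 : 0 < r := hε0.trans_le hr.1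
      have h1 := H r hr0 hr.2 (e / ε)
      rw [le_div_iff₀ hr0]
      refine le_trans (le_of_eq ?_) h1
      rw [sub_mul, Finset.sum_mul, mul_assoc, inv_mul_cancel₀ hr0.ne', mul_one]
      congr 1
      refine Finset.sum_congr rfl fun a _ => ?_
      ring
  have hsum : (1 - e) ^ 3 / (3 * t) * (primSum Ge (e / ε) - K) - e * |Real.log ε| ≤
      ∫ r in ε..r₀,
      (∑ a ∈ primDisc (e / ε), Ge (dir (latVec a)) / (‖latVec a‖ * t) *
        max 0 (1 - r * ‖latVec a‖) ^ 2 - e * r⁻¹) := by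
    rw [intervalIntegral.integral_sub, intervalIntegral.integral_finsetSum,
      intervalIntegral.integral_const_mul]
    · refine sub_le_sub ?_ (mul_le_mul_of_nonneg_left
        (integral_inv_le hε0 (by linarith) hr₀ (by linarith)) he.le)
      rw [hK, primSum, primSum, ← Finset.sum_sdiff_eq_sub (primDisc_subset hsub), Finset.mul_sum]
      have hterm : ∀ a : ℤ × ℤ, 0 ≤ ∫ r in ε..r₀, Ge (dir (latVec a)) / (‖latVec a‖ * t) *
          max 0 (1 - r * ‖latVec a‖) ^ 2 := fun a =>
        intervalIntegral.integral_nonneg hεr.le fun r _ =>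
          mul_nonneg (div_nonneg (hGe0 _) (by positivity)) (by positivity)
      refine le_trans (Finset.sum_le_sum fun a ha => ?_)
        (Finset.sum_le_sum_of_subset_of_nonneg Finset.sdiff_subset fun a _ _ => hterm a)
      rw [Finset.mem_sdiff, mem_primDisc, mem_primDisc] at ha
      obtain ⟨⟨hgcd, hle⟩, hgt⟩ := ha
      have hgt' : 1 / r₀ < ‖latVec a‖ := by
        by_contra! hcon
        exact hgt ⟨hgcd, hcon⟩
      have hL0 : 0 < ‖latVec a‖ := lt_trans (by positivity) hgt'
      have hεL : ε * ‖latVec a‖ ≤ e := by rwa [le_div_iff₀' hε0] at hle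
      have hr₀L : 1 ≤ r₀ * ‖latVec a‖ := by
        rw [div_lt_iff₀' hr₀] at hgt'; exact hgt'.le
      rw [intervalIntegral.integral_const_mul]
      calc (1 - e) ^ 3 / (3 * t) * latTerm Ge a =
            Ge (dir (latVec a)) / (‖latVec a‖ * t) * ((1 - e) ^ 3 / (3 * ‖latVec a‖)) := by
            rw [latTerm]
            field_simp
        _ ≤ Ge (dir (latVec a)) / (‖latVec a‖ * t) *
              ∫ r in ε..r₀, max 0 (1 - r * ‖latVec a‖) ^ 2 := by
            refine mul_le_mul_of_nonneg_left ?_ (div_nonneg (hGe0 _) (by positivity))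
            refine le_trans ?_ (le_integral_max_sq hL0 (by linarith) hr₀L)
            have : 0 ≤ 1 - e := by linarith
            gcongr
    · intro a _
      exact Continuous.intervalIntegrable (by fun_prop) _ _
    · exact Continuous.intervalIntegrable (by fun_prop) _ _
    · refine ContinuousOn.intervalIntegrable ?_
      rw [uIcc_of_le hεr.le]
      exact ContinuousOn.mul continuousOn_const
        (ContinuousOn.inv₀ continuousOn_id fun r hr => (hε0.trans_le hr.1).ne')
  calc (1 - e) ^ 3 / (3 * t) * (primSum Ge (e / ε) / |Real.log ε| - K / |Real.log ε|) - e
      = 1 / |Real.log ε| *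
        (((1 - e) ^ 3 / (3 * t) * (primSum Ge (e / ε) - K) - e * |Real.log ε|) + 0) := by
        field_simp
        ring
    _ ≤ _ := by
        gcongr
        exact hsum.trans hmono

end

/-! ### Solutions of the initial-boundary value problem -/

/-- The data transported along the free trajectories, and `0` elsewhere. -/
noncomputable def freeSol (r : ℝ) (fin : Phase → ℝ) (t : ℝ) (p : Phase) : ℝ :=
  {p : Phase | IsFree r t p}.indicator (fun p => fin (p.1 - t • (p.2 : Plane), p.2)) p

lemma isOpen_Omega {r : ℝ} (hr : 0 < r) : IsOpen (Omega r) := by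
  have h : IsOpen (Z r) := isOpen_lt continuous_const (Metric.continuous_infDist_pt _)
  exact h.smul₀ hr.ne'

lemma freeSol_of_isFree {r t : ℝ} {fin : Phase → ℝ} {p : Phase} (h : IsFree r t p) :
    freeSol r fin t p = fin (p.1 - t • (p.2 : Plane), p.2) :=
  indicator_of_mem (s := {p : Phase | IsFree r t p}) h _

lemma freeSol_of_not_isFree {r t : ℝ} {fin : Phase → ℝ} {p : Phase} (h : ¬ IsFree r t p) :
    freeSol r fin t p = 0 :=
  indicator_of_notMem (s := {p : Phase | IsFree r t p}) h _

lemma not_isFree_of_notMem {r t s : ℝ} {x : Plane} {v : Circ} (hs : s ∈ Icc 0 t)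
    (h : x - s • (v : Plane) ∉ Omega r) : ¬ IsFree r t (x, v) := fun hf => h (hf s hs)

/-- Along a trajectory through an interior point the canonical solution is locally constant. -/
lemma freeSol_eventually_const {r : ℝ} (hr : 0 < r) (fin : Phase → ℝ) (t : ℝ)
    {x : Plane} (hx : x ∈ Omega r) (v : Circ) :
    ∀ᶠ s : ℝ in 𝓝 0, freeSol r fin (t + s) (x + s • (v : Plane), v) = freeSol r fin t (x, v) := by
  have hc : Continuous fun u : ℝ => x + u • (v : Plane) := by fun_prop
  have hn : ∀ᶠ u : ℝ in 𝓝 0, x + u • (v : Plane) ∈ Omega r :=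
    hc.continuousAt.eventually_mem (by simpa using (isOpen_Omega hr).mem_nhds hx)
  obtain ⟨δ, hδ, H⟩ := Metric.eventually_nhds_iff.1 hn
  filter_upwards [Metric.ball_mem_nhds 0 hδ] with s hs
  rw [Metric.mem_ball, dist_zero_right, Real.norm_eq_abs, abs_lt] at hs
  have H' : ∀ u : ℝ, |u| < δ → x + u • (v : Plane) ∈ Omega r := fun u hu => H (by simpa using hu)
  have hiff : IsFree r (t + s) (x + s • (v : Plane), v) ↔ IsFree r t (x, v) := by
    constructor
    · intro h u hu
      rcases le_or_gt 0 (u + s) with hus | hus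
      · have := h (u + s) ⟨hus, by linarith [hu.2]⟩
        simp only at this ⊢
        convert this using 1
        module
      · have := H' (-u) (by rw [abs_neg, abs_lt]; constructor <;> linarith [hu.1])
        simp only
        convert this using 1
        module
    · intro h σ hσ
      rcases le_or_gt 0 (σ - s) with hus | hus
      · have := h (σ - s) ⟨hus, by linarith [hσ.2]⟩
        simp only at this ⊢
        convert this using 1
        module
      · have := H' (s - σ) (by rw [abs_lt]; constructor <;> linarith [hσ.1])
        simp only
        convert this using 1
        module
  by_cases hf : IsFree r t (x, v)
  · rw [freeSol_of_isFree hf, freeSol_of_isFree (hiff.2 hf)]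
    simp only
    congr 2
    module
  · rw [freeSol_of_not_isFree hf, freeSol_of_not_isFree (fun h => hf (hiff.1 h))]

lemma notMem_Omega_of_mem_frontier {r : ℝ} (hr : 0 < r) {x : Plane} (hx : x ∈ frontier (Omega r)) :
    x ∉ Omega r := by
  rw [(isOpen_Omega hr).frontier_eq] at hx
  exact hx.2

/-- Existence of a solution. -/
lemma isSolution_freeSol {r : ℝ} (hr : 0 < r) (fin : Phase → ℝ) :
    IsSolution r fin (freeSol r fin) where
  transport t ht x hx v := by
    have h := freeSol_eventually_const hr fin t hx v
    exact (hasDerivAt_const (0 : ℝ) (freeSol r fin t (x, v))).congr_of_eventuallyEq h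
  initial x hx v := by
    have hf : IsFree r 0 (x, v) := by
      intro s hs
      obtain rfl : s = 0 := le_antisymm hs.2 hs.1
      simpa using hx
    rw [freeSol_of_isFree hf]
    simp
  initial_trace x hx v := by
    have h := freeSol_eventually_const hr fin 0 hx v
    simp only [zero_add] at h
    exact (continuousAt_const.congr (h.mono fun s hs => hs.symm)).continuousWithinAt
  boundary t ht x hx v n _ _ := freeSol_of_not_isFree
    (not_isFree_of_notMem (s := 0) ⟨le_rfl, ht.le⟩
      (by simpa using notMem_Omega_of_mem_frontier hr hx))
  boundary_trace t ht x hx v n _ _ := by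
    have h : ∀ s ∈ Ici (0 : ℝ), freeSol r fin (t + s) (x + s • (v : Plane), v) = 0 := fun s hs =>
      freeSol_of_not_isFree (not_isFree_of_notMem (s := s)
        ⟨hs, by linarith⟩ (by simpa using notMem_Omega_of_mem_frontier hr hx))
    exact continuousWithinAt_const.congr h (h 0 self_mem_Ici)
  zero_in_holes t ht x hx v := freeSol_of_not_isFree
    (not_isFree_of_notMem (s := 0) ⟨le_rfl, ht⟩
      (by simpa using fun h => hx (subset_closure h)))

/-- A solution is constant along the trajectories that enter `Ω_r` at time `τ₀`. -/
lemma PerforatedTransport.IsSolution.eq_of_trajectory {r : ℝ} {fin : Phase → ℝ} {f : ℝ → Phase → ℝ}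
    (hf : IsSolution r fin f) {x : Plane} {v : Circ} {τ₀ ℓ : ℝ} (hτ₀ : 0 ≤ τ₀) (hℓ : 0 < ℓ)
    (hc : ContinuousWithinAt (fun s : ℝ => f (τ₀ + s) (x + s • (v : Plane), v)) (Ici 0) 0)
    (hΩ : ∀ s ∈ Ioc 0 ℓ, x + s • (v : Plane) ∈ Omega r) :
    f (τ₀ + ℓ) (x + ℓ • (v : Plane), v) = f τ₀ (x, v) := by
  set φ : ℝ → ℝ := fun s => f (τ₀ + s) (x + s • (v : Plane), v) with hφ
  have hd : ∀ s ∈ Ioc 0 ℓ, HasDerivAt φ 0 s := by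
    intro s hs
    have h1 := hf.transport (τ₀ + s) (by linarith [hs.1]) _ (hΩ s hs) v
    have h2 : HasDerivAt (fun u : ℝ => f (τ₀ + s + u)
        (x + s • (v : Plane) + u • (v : Plane), v)) 0 (s - s) := by rwa [sub_self]
    have h3 := h2.comp_sub_const s s
    refine h3.congr_of_eventuallyEq (Eventually.of_forall fun u => ?_)
    have e1 : τ₀ + s + (u - s) = τ₀ + u := by ring
    have e2 : x + s • (v : Plane) + (u - s) • (v : Plane) = x + u • (v : Plane) := by module
    simp only [hφ, e1, e2]
  have hcont : ContinuousOn φ (Icc 0 ℓ) := by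
    intro s hs
    rcases hs.1.eq_or_lt with h0 | h0
    · rw [← h0]
      exact hc.mono Icc_subset_Ici_self
    · exact (hd s ⟨h0, hs.2⟩).continuousAt.continuousWithinAt
  obtain ⟨c, _, hc'⟩ := exists_hasDerivAt_eq_slope φ (fun _ => 0) hℓ hcont
    fun s hs => hd s ⟨hs.1, hs.2.le⟩
  rw [eq_div_iff (by linarith), zero_mul] at hc'
  have h0 : φ 0 = f τ₀ (x, v) := by simp [hφ]
  rw [← h0]
  exact (sub_eq_zero.1 hc'.symm)

/-- The trajectory of duration `t` from `(x, v)` is neither tangent to a hole nor has an end on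
the boundary of one. -/
def IsTransversal (r t : ℝ) (p : Phase) : Prop :=
  ∀ k : ℤ × ℤ, ‖p.1 - r • latVec k‖ ≠ r ^ 2 / 2 ∧
    ‖p.1 - t • (p.2 : Plane) - r • latVec k‖ ≠ r ^ 2 / 2 ∧
    |pdet p.2 (p.1 - r • latVec k)| ≠ r ^ 2 / 2

lemma notMem_closure_Omega {r : ℝ} (hr : 0 < r) {x : Plane} {k : ℤ × ℤ}
    (h : ‖x - r • latVec k‖ < r ^ 2 / 2) : x ∉ closure (Omega r) := by
  rw [mem_closure_iff]
  push Not
  refine ⟨Metric.ball (r • latVec k) (r ^ 2 / 2), Metric.isOpen_ball, ?_, ?_⟩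
  · rwa [Metric.mem_ball, dist_eq_norm]
  · rw [← disjoint_iff_inter_eq_empty, Set.disjoint_left]
    intro y hy hyΩ
    rw [Metric.mem_ball, dist_eq_norm] at hy
    exact lt_asymm hy ((mem_Omega hr).1 hyΩ k)

/-- On transversal trajectories every solution agrees with the canonical one. -/
lemma PerforatedTransport.IsSolution.eq_freeSol {r t : ℝ} (hr : 0 < r) (ht : 0 < t)
    {fin : Phase → ℝ} {f : ℝ → Phase → ℝ} (hf : IsSolution r fin f) {p : Phase}
    (hp : IsTransversal r t p) :
    f t p = freeSol r fin t p := by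
  obtain ⟨x, v⟩ := p
  by_cases hfree : IsFree r t (x, v)
  · rw [freeSol_of_isFree hfree]
    have hx : x - t • (v : Plane) ∈ Omega r := hfree t ⟨ht.le, le_rfl⟩
    have h1 := hf.eq_of_trajectory (x := x - t • (v : Plane)) (v := v) (τ₀ := 0) le_rfl ht
      (by simpa using hf.initial_trace _ hx v) (fun s hs => by
        have := hfree (t - s) ⟨by linarith [hs.2], by linarith [hs.1]⟩
        simp only at this
        convert this using 1
        module)
    rw [hf.initial _ hx v] at h1
    simpa using h1
  rw [freeSol_of_not_isFree hfree]
  by_cases hx : x ∈ Omega r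
  swap
  · rw [mem_Omega hr] at hx
    push Not at hx
    obtain ⟨k, hk⟩ := hx
    exact hf.zero_in_holes t ht.le x
      (notMem_closure_Omega hr (lt_of_le_of_ne hk (hp k).1)) v
  -- the first hole met by the backward trajectory
  set S : Set ℝ := {s | s ∈ Icc 0 t ∧ x - s • (v : Plane) ∉ Omega r} with hS
  have hSc : IsClosed S := by
    have hc : Continuous fun s : ℝ => x - s • (v : Plane) := by fun_prop
    exact isClosed_Icc.inter ((isOpen_Omega hr).isClosed_compl.preimage hc)
  have hSne : S.Nonempty := by
    unfold IsFree at hfree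
    push Not at hfree
    obtain ⟨s, hs, hs'⟩ := hfree
    exact ⟨s, hs, hs'⟩
  have hSb : BddBelow S := ⟨0, fun s hs => hs.1.1⟩
  set s₀ := sInf S with hs₀
  obtain ⟨hs₀m, hs₀Ω⟩ : s₀ ∈ S := hSc.csInf_mem hSne hSb
  have hbefore : ∀ s, 0 ≤ s → s < s₀ → x - s • (v : Plane) ∈ Omega r := by
    intro s hs hlt
    by_contra hcon
    exact absurd (csInf_le hSb (show s ∈ S from ⟨⟨hs, hlt.le.trans hs₀m.2⟩, hcon⟩)) (not_le.2 hlt)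
  have hs₀pos : 0 < s₀ := by
    rcases hs₀m.1.eq_or_lt with h | h
    · rw [← h, zero_smul, sub_zero] at hs₀Ω
      exact absurd hx hs₀Ω
    · exact h
  set y := x - s₀ • (v : Plane) with hy
  have hyΩ : ∀ u ∈ Ioc 0 s₀, y + u • (v : Plane) ∈ Omega r := by
    intro u hu
    have := hbefore (s₀ - u) (by linarith [hu.2]) (by linarith [hu.1])
    convert this using 1
    rw [hy]; module
  obtain ⟨k, hk⟩ : ∃ k, ‖y - r • latVec k‖ ≤ r ^ 2 / 2 := by
    by_contra! hcon
    exact hs₀Ω ((mem_Omega hr).2 hcon)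
  have hyc : y ∈ closure (Omega r) := by
    have hc : Tendsto (fun u : ℝ => y + u • (v : Plane)) (𝓝[>] 0) (𝓝 y) := by
      have : Continuous fun u : ℝ => y + u • (v : Plane) := by fun_prop
      have h := this.tendsto 0
      rw [zero_smul, add_zero] at h
      exact h.mono_left nhdsWithin_le_nhds
    refine mem_closure_of_tendsto hc ?_
    filter_upwards [Ioc_mem_nhdsGT hs₀pos] with u hu using hyΩ u hu
  have hk' : ‖y - r • latVec k‖ = r ^ 2 / 2 := by
    by_contra hne
    exact notMem_closure_Omega hr (lt_of_le_of_ne hk hne) hyc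
  have hfr : y ∈ frontier (Omega r) := by
    rw [(isOpen_Omega hr).frontier_eq]
    exact ⟨hyc, hs₀Ω⟩
  set w := y - r • latVec k with hw
  -- the trajectory leaves the hole at `y`, as otherwise it would be inside for small times
  have hdot0 : 0 ≤ pdot v w := by
    by_contra! hneg
    have hu : min s₀ (-pdot v w) ∈ Ioc 0 s₀ := ⟨lt_min hs₀pos (by linarith), min_le_left _ _⟩
    have h1 := (mem_Omega hr).1 (hyΩ _ hu) k
    set u := min s₀ (-pdot v w) with hudef
    have hu2 : u ≤ -pdot v w := min_le_right _ _
    have e1 : ‖y + u • (v : Plane) - r • latVec k‖ ^ 2 = ‖w‖ ^ 2 + 2 * u * pdot v w + u ^ 2 := by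
      have : y + u • (v : Plane) - r • latVec k = w + u • (v : Plane) := by rw [hw]; module
      rw [this, norm_sq_plane, norm_sq_plane, pdot]
      simp only [PiLp.add_apply, PiLp.smul_apply, smul_eq_mul]
      linear_combination u ^ 2 * circ_sq v
    have h2 : (r ^ 2 / 2) ^ 2 < ‖y + u • (v : Plane) - r • latVec k‖ ^ 2 := by
      gcongr
    rw [e1, hk'] at h2
    nlinarith [hu.1]
  have hdetxy : pdet v (x - r • latVec k) = pdet v w := by
    simp only [hw, hy, pdet, PiLp.sub_apply, PiLp.smul_apply, smul_eq_mul]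
    ring
  have hdot : 0 < pdot v w := by
    refine lt_of_le_of_ne hdot0 fun h0 => (hp k).2.2 ?_
    have h1 := pdet_sq_add_pdot_sq v w
    rw [← h0, norm_circ, hk'] at h1
    rw [hdetxy, ← abs_of_nonneg (show 0 ≤ r ^ 2 / 2 by positivity), ← sq_eq_sq_iff_abs_eq_abs]
    linarith
  have hs₀t : s₀ < t := by
    refine lt_of_le_of_ne hs₀m.2 fun h => (hp k).2.1 ?_
    rw [← h]
    exact hk'
  set n : Plane := (r ^ 2 / 2)⁻¹ • w with hn
  have hr2 : 0 < r ^ 2 / 2 := by positivity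
  have hnormal : IsInwardNormal r y n := by
    refine ⟨?_, latVec k, mem_lattice.2 ⟨k, rfl⟩, ?_⟩
    · rw [hn, norm_smul, hk', Real.norm_of_nonneg (by positivity), inv_mul_cancel₀ hr2.ne']
    · rw [hn, smul_inv_smul₀ hr2.ne', hw]
      module
  have hin : 0 < inner ℝ (v : Plane) n := by
    have : inner ℝ (v : Plane) n = (r ^ 2 / 2)⁻¹ * pdot v w := by
      rw [hn, inner_smul_right]
      congr 1
      rw [PiLp.inner_apply, pdot]
      simp [mul_comm]
    rw [this]
    positivity
  have h1 := hf.eq_of_trajectory (x := y) (v := v) (τ₀ := t - s₀) (by linarith) hs₀pos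
    (hf.boundary_trace _ (by linarith) y hfr v n hnormal hin) hyΩ
  rw [hf.boundary _ (by linarith) y hfr v n hnormal hin] at h1
  rw [← h1]
  congr 2
  · ring
  · rw [hy]; module

/-- Tangency and the position of an end on a circle are conditions of this quartic form on `r`. -/
lemma finite_quartic (α β γ δ : ℝ) :
    {r : ℝ | (α - r * β) ^ 2 + (γ - r * δ) ^ 2 = r ^ 4 / 4}.Finite := by
  set P : Polynomial ℝ := Polynomial.C (-1 / 4) * Polynomial.X ^ 4 +
    Polynomial.C (β ^ 2 + δ ^ 2) * Polynomial.X ^ 2 +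
    Polynomial.C (-2 * (α * β + γ * δ)) * Polynomial.X + Polynomial.C (α ^ 2 + γ ^ 2) with hP
  have hP0 : P ≠ 0 := by
    intro h
    have h4 := congrArg (fun Q : Polynomial ℝ => Q.coeff 4) h
    simp only [hP, Polynomial.coeff_add, Polynomial.coeff_C_mul, Polynomial.coeff_X_pow,
      Polynomial.coeff_X, Polynomial.coeff_C, Polynomial.coeff_zero] at h4
    norm_num at h4
  refine (P.rootSet_finite ℝ).subset fun r hr => ?_
  rw [Polynomial.mem_rootSet]
  refine ⟨hP0, ?_⟩
  have hr' : (α - r * β) ^ 2 + (γ - r * δ) ^ 2 = r ^ 4 / 4 := hr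
  simp only [hP, map_add, map_mul, map_pow, Polynomial.aeval_X, Polynomial.aeval_C,
    Algebra.algebraMap_self, RingHom.id_apply]
  linear_combination hr'

/-- For every point of the phase space all but countably many hole sizes are transversal. -/
lemma ae_isTransversal (t : ℝ) (p : Phase) : ∀ᵐ r : ℝ, IsTransversal r t p := by
  unfold IsTransversal
  rw [ae_all_iff]
  intro k
  have key : ∀ α β γ δ : ℝ, ∀ᵐ r : ℝ, (α - r * β) ^ 2 + (γ - r * δ) ^ 2 ≠ r ^ 4 / 4 := by
    intro α β γ δ
    rw [ae_iff]
    simp only [ne_eq, not_not]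
    exact (finite_quartic α β γ δ).measure_zero _
  set z : Plane := p.1 - t • (p.2 : Plane) with hz
  filter_upwards [key (p.1 0) (latVec k 0) (p.1 1) (latVec k 1),
    key (z 0) (latVec k 0) (z 1) (latVec k 1),
    key (pdet p.2 p.1) (pdet p.2 (latVec k)) 0 0] with r h1 h2 h3
  have hnorm : ∀ y : Plane, ‖y - r • latVec k‖ ^ 2 =
      (y 0 - r * latVec k 0) ^ 2 + (y 1 - r * latVec k 1) ^ 2 := by
    intro y
    rw [norm_sq_plane]
    simp only [PiLp.sub_apply, PiLp.smul_apply, smul_eq_mul]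
  refine ⟨fun h => h1 ?_, fun h => h2 ?_, fun h => h3 ?_⟩
  · rw [← hnorm, h]; ring
  · rw [← hnorm, h]; ring
  · have : pdet p.2 (p.1 - r • latVec k) = pdet p.2 p.1 - r * pdet p.2 (latVec k) := by
      simp only [pdet, PiLp.sub_apply, PiLp.smul_apply, smul_eq_mul]; ring
    rw [← this, ← sq_abs, h]; ring

/-- The product of the transported data and of the test function. -/
def testProduct (fin χ : Phase → ℝ) (t : ℝ) (p : Phase) : ℝ :=
  fin (p.1 - t • (p.2 : Plane), p.2) * χ p

lemma continuous_testProduct {fin χ : Phase → ℝ} (hfin : Continuous fin) (hχ : Continuous χ)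
    (t : ℝ) : Continuous (testProduct fin χ t) := by
  unfold testProduct
  fun_prop

lemma hasCompactSupport_testProduct {fin χ : Phase → ℝ} (hχ : HasCompactSupport χ) (t : ℝ) :
    HasCompactSupport (testProduct fin χ t) := hχ.mul_left

lemma freeSol_mul {r t : ℝ} {fin χ : Phase → ℝ} (p : Phase) :
    freeSol r fin t p * χ p = {p : Phase | IsFree r t p}.indicator (testProduct fin χ t) p := by
  by_cases hp : IsFree r t p
  · rw [freeSol_of_isFree hp, indicator_of_mem (s := {p : Phase | IsFree r t p}) hp, testProduct]
  · rw [freeSol_of_not_isFree hp, indicator_of_notMem (s := {p : Phase | IsFree r t p}) hp,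
      zero_mul]

section

variable {fin : Phase → ℝ} {f : ℝ → ℝ → Phase → ℝ}

lemma ae_eq_freeSol (hf : ∀ ε ∈ Ioo (0 : ℝ) (1 / 4), IsSolution ε fin (f ε)) {t ε : ℝ}
    (ht : 0 < t) (hε : ε ∈ Ioo (0 : ℝ) (1 / 4)) (p : Phase) :
    (fun r => f r t p / r) =ᵐ[volume.restrict (Ioc ε (1 / 4))]
      fun r => freeSol r fin t p / r := by
  rw [Filter.EventuallyEq, ae_restrict_iff' measurableSet_Ioc]
  filter_upwards [ae_isTransversal t p, Measure.ae_ne volume (1 / 4 : ℝ)] with r hreg hne hr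
  have hr0 : 0 < r := hε.1.trans hr.1
  rw [(hf r ⟨hr0, lt_of_le_of_ne hr.2 hne⟩).eq_freeSol hr0 ht hreg]

lemma integrableOn_freeSol_div {t ε : ℝ} (hε : ε ∈ Ioo (0 : ℝ) (1 / 4)) (p : Phase) :
    IntegrableOn (fun r => freeSol r fin t p / r) (Ioc ε (1 / 4)) := by
  have hm : MeasurableSet {r : ℝ | 0 < r ∧ IsFree r t p} :=
    (measurable_prodMk_right (y := p) : Measurable fun r : ℝ => (r, p)) (measurableSet_isFree t)
  have h1 : IntegrableOn (fun r : ℝ => fin (p.1 - t • (p.2 : Plane), p.2) * r⁻¹)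
      (Ioc ε (1 / 4)) := by
    refine IntegrableOn.mono_set (t := Icc ε (1 / 4)) ?_ Ioc_subset_Icc_self
    refine ContinuousOn.integrableOn_Icc (continuousOn_const.mul ?_)
    exact ContinuousOn.inv₀ continuousOn_id fun r hr => (hε.1.trans_le hr.1).ne'
  refine (h1.indicator hm).congr ((ae_restrict_iff' measurableSet_Ioc).2
    (ae_of_all _ fun r hr => ?_))
  have hr0 : 0 < r := hε.1.trans hr.1
  simp only
  by_cases hp : IsFree r t p
  · rw [freeSol_of_isFree hp, indicator_of_mem (s := {r : ℝ | 0 < r ∧ IsFree r t p}) ⟨hr0, hp⟩,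
      div_eq_mul_inv]
  · rw [freeSol_of_not_isFree hp, indicator_of_notMem (s := {r : ℝ | 0 < r ∧ IsFree r t p})
      (fun h => hp h.2), zero_div]

lemma intervalIntegrable_solution (hf : ∀ ε ∈ Ioo (0 : ℝ) (1 / 4), IsSolution ε fin (f ε))
    {t ε : ℝ} (ht : 0 < t) (hε : ε ∈ Ioo (0 : ℝ) (1 / 4)) (p : Phase) :
    IntervalIntegrable (fun r => f r t p / r) volume ε (1 / 4) := by
  rw [intervalIntegrable_iff_integrableOn_Ioc_of_le hε.2.le]
  exact Integrable.congr (integrableOn_freeSol_div hε p) (ae_eq_freeSol hf ht hε p).symm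

lemma cesaro_mul_eq (hf : ∀ ε ∈ Ioo (0 : ℝ) (1 / 4), IsSolution ε fin (f ε))
    {t ε : ℝ} (ht : 0 < t) (hε : ε ∈ Ioo (0 : ℝ) (1 / 4)) (χ : Phase → ℝ) (p : Phase) :
    cesaro f t ε p * χ p = 1 / |Real.log ε| * ∫ r in Ioc ε (1 / 4),
      {q : ℝ × Phase | 0 < q.1 ∧ IsFree q.1 t q.2}.indicator
        (fun q => testProduct fin χ t q.2 / q.1) (r, p) := by
  rw [cesaro, intervalIntegral.integral_of_le hε.2.le,
    integral_congr_ae (ae_eq_freeSol hf ht hε p), mul_assoc, ← integral_mul_const]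
  congr 1
  refine setIntegral_congr_fun measurableSet_Ioc fun r hr => ?_
  simp only [freePair_eq (hε.1.trans hr.1), ← freeSol_mul]
  ring

variable {χ : Phase → ℝ}

lemma integrable_cesaro_mul (hf : ∀ ε ∈ Ioo (0 : ℝ) (1 / 4), IsSolution ε fin (f ε))
    (hfin : Continuous fin) (hχ : Continuous χ) (hχc : HasCompactSupport χ)
    {t ε : ℝ} (ht : 0 < t) (hε : ε ∈ Ioo (0 : ℝ) (1 / 4)) :
    Integrable (fun p => cesaro f t ε p * χ p) dxdv := by
  simp_rw [cesaro_mul_eq hf ht hε χ]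
  exact (integrable_freePair (continuous_testProduct hfin hχ t)
    (hasCompactSupport_testProduct hχc t) hε.1 t).integral_prod_right.const_mul _

/-- The tested average of an arbitrary solution depends on the free trajectories only. -/
lemma testedCesaro_eq (hf : ∀ ε ∈ Ioo (0 : ℝ) (1 / 4), IsSolution ε fin (f ε))
    (hfin : Continuous fin) (hχ : Continuous χ) (hχc : HasCompactSupport χ)
    {t ε : ℝ} (ht : 0 < t) (hε : ε ∈ Ioo (0 : ℝ) (1 / 4)) :
    testedCesaro f χ t ε = logAverage t (testProduct fin χ t) ε := by
  have hi := integrable_freePair (continuous_testProduct hfin hχ t)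
    (hasCompactSupport_testProduct (fin := fin) hχc t) hε.1 t
  rw [testedCesaro, logAverage]
  simp_rw [cesaro_mul_eq hf ht hε χ]
  rw [integral_const_mul, intervalIntegral.integral_of_le hε.2.le]
  congr 1
  rw [← integral_integral_swap hi]
  refine setIntegral_congr_fun measurableSet_Ioc fun r hr => ?_
  simp only [freePair_eq (hε.1.trans hr.1)]
  rw [integral_div]
  rfl

end

/-! ### The limiting equation -/

lemma contMDiff_ang : ContMDiff 𝓘(ℝ, ℝ) (𝓡 1) ∞ ang := by
  have h : ContMDiff 𝓘(ℝ, ℝ) 𝓘(ℝ, Plane) ∞ fun θ : ℝ => (!₂[Real.cos θ, Real.sin θ] : Plane) := by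
    apply ContDiff.contMDiff
    rw [contDiff_euclidean]
    intro i
    fin_cases i
    · exact Real.contDiff_cos
    · exact Real.contDiff_sin
  -- the charted space structure of the circle is the one derived from this fact
  have : Fact (Module.finrank ℝ Plane = 1 + 1) := Fact.mk (@finrank_euclideanSpace_fin ℝ _ (1 + 1))
  exact h.codRestrict_sphere fun θ => (ang θ).2

lemma contDiff_comp_ang {φ : ℝ × Phase → ℝ} (hφ : IsTestFunction φ) :
    ContDiff ℝ ∞ fun z : ℝ × (Plane × ℝ) => φ (z.1, (z.2.1, ang z.2.2)) := by
  have h1 : ContMDiff 𝓘(ℝ, ℝ × (Plane × ℝ)) 𝓘(ℝ, ℝ) ∞ fun z : ℝ × (Plane × ℝ) => z.1 :=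
    contDiff_fst.contMDiff
  have h2 : ContMDiff 𝓘(ℝ, ℝ × (Plane × ℝ)) 𝓘(ℝ, Plane) ∞ fun z : ℝ × (Plane × ℝ) => z.2.1 :=
    (contDiff_fst.comp contDiff_snd).contMDiff
  have h3 : ContMDiff 𝓘(ℝ, ℝ × (Plane × ℝ)) 𝓘(ℝ, ℝ) ∞ fun z : ℝ × (Plane × ℝ) => z.2.2 :=
    (contDiff_snd.comp contDiff_snd).contMDiff
  exact (hφ.1.comp (h1.prodMk (h2.prodMk (contMDiff_ang.comp h3)))).contDiff

/-- The transport derivative is the derivative of `φ`, in the coordinates given by the angle, in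
the direction `(1, v, 0)`. -/
lemma transportDeriv_eq_fderiv {φ : ℝ × Phase → ℝ} (hφ : IsTestFunction φ) (t : ℝ)
    (x : Plane) (θ : ℝ) :
    transportDeriv φ (t, (x, ang θ)) =
      fderiv ℝ (fun z : ℝ × (Plane × ℝ) => φ (z.1, (z.2.1, ang z.2.2))) (t, (x, θ))
        (1, ((ang θ : Plane), 0)) := by
  set Φ : ℝ × (Plane × ℝ) → ℝ := fun z => φ (z.1, (z.2.1, ang z.2.2)) with hΦ
  have hd : HasFDerivAt Φ (fderiv ℝ Φ (t, (x, θ))) (t, (x, θ)) :=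
    ((contDiff_comp_ang hφ).differentiable (by simp) _).hasFDerivAt
  set D := fderiv ℝ Φ (t, (x, θ))
  have h1 : HasDerivAt (fun s : ℝ => φ (s, (x, ang θ))) (D (1, (0, 0))) t := by
    have h := hd.comp_hasDerivAt t ((hasDerivAt_id t).prodMk (hasDerivAt_const t (x, θ)))
    exact h
  have h2 : HasFDerivAt (fun y : Plane => φ (t, (y, ang θ)))
      (D.comp ((0 : Plane →L[ℝ] ℝ).prod ((ContinuousLinearMap.id ℝ Plane).prod
        (0 : Plane →L[ℝ] ℝ)))) x := by
    have hin : HasFDerivAt (fun y : Plane => ((t, (y, θ)) : ℝ × (Plane × ℝ)))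
        ((0 : Plane →L[ℝ] ℝ).prod ((ContinuousLinearMap.id ℝ Plane).prod
          (0 : Plane →L[ℝ] ℝ))) x :=
      (hasFDerivAt_const t x).prodMk ((hasFDerivAt_id x).prodMk (hasFDerivAt_const θ x))
    exact hd.comp x hin
  rw [transportDeriv, h1.deriv, h2.fderiv]
  simp only [ContinuousLinearMap.comp_apply, ContinuousLinearMap.prod_apply,
    zero_apply, ContinuousLinearMap.id_apply]
  rw [← map_add]
  simp

lemma continuous_transportDeriv {φ : ℝ × Phase → ℝ} (hφ : IsTestFunction φ) :
    Continuous (transportDeriv φ) := by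
  -- the angle in a compact interval is a quotient map onto the circle, and a proper one
  set a : Icc (-Real.pi) Real.pi → Circ := fun θ => ang θ with ha
  have hac : Continuous a := continuous_ang.comp continuous_subtype_val
  have has : Function.Surjective a := fun v => by
    obtain ⟨θ, hθ, h⟩ := exists_ang_eq v
    exact ⟨⟨θ, hθ⟩, h⟩
  set π : ℝ × (Plane × Icc (-Real.pi) Real.pi) → ℝ × Phase :=
    Prod.map id (Prod.map id a) with hπ
  have hproper : IsProperMap π :=
    isProperMap_id.prodMap (isProperMap_id.prodMap hac.isProperMap)
  have hq : IsQuotientMap π := hproper.isClosedMap.isQuotientMap hproper.continuous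
    (Function.surjective_id.prodMap (Function.surjective_id.prodMap has))
  rw [hq.continuous_iff]
  have h1 : transportDeriv φ ∘ π = fun z =>
      fderiv ℝ (fun z : ℝ × (Plane × ℝ) => φ (z.1, (z.2.1, ang z.2.2)))
        (z.1, (z.2.1, (z.2.2 : ℝ))) (1, ((ang z.2.2 : Plane), 0)) := by
    ext z
    exact transportDeriv_eq_fderiv hφ z.1 z.2.1 z.2.2
  rw [h1]
  have h2 := (contDiff_comp_ang hφ).continuous_fderiv (by simp)
  have h3 : Continuous fun z : ℝ × (Plane × Icc (-Real.pi) Real.pi) =>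
      ((1 : ℝ), ((ang z.2.2 : Plane), (0 : ℝ))) := by
    have := continuous_ang
    fun_prop
  exact (h2.comp (by fun_prop)).clm_apply h3

/-- The derivative of a test function along a characteristic. -/
lemma hasDerivAt_characteristic {φ : ℝ × Phase → ℝ} (hφ : IsTestFunction φ) (y : Plane) (v : Circ)
    (t : ℝ) : HasDerivAt (fun t : ℝ => φ (t, (y + t • (v : Plane), v)))
      (transportDeriv φ (t, (y + t • (v : Plane), v))) t := by
  obtain ⟨θ, -, rfl⟩ := exists_ang_eq v
  rw [transportDeriv_eq_fderiv hφ]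
  have hd := ((contDiff_comp_ang hφ).differentiable (by simp)
    (t, (y + t • (ang θ : Plane), θ))).hasFDerivAt
  have hline : HasDerivAt (fun t : ℝ => y + t • (ang θ : Plane)) (ang θ : Plane) t := by
    have := ((hasDerivAt_id t).smul_const (ang θ : Plane)).const_add y
    simpa using this
  exact hd.comp_hasDerivAt t ((hasDerivAt_id t).prodMk (hline.prodMk (hasDerivAt_const t θ)))

lemma transportDeriv_eq_zero {φ : ℝ × Phase → ℝ} (hφ : IsTestFunction φ) {q : ℝ × Phase}
    (hq : q ∉ tsupport φ) : transportDeriv φ q = 0 := by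
  obtain ⟨t, x, v⟩ := q
  have h := hasDerivAt_characteristic hφ (x - t • (v : Plane)) v t
  rw [sub_add_cancel] at h
  refine h.unique ((hasDerivAt_const t (0 : ℝ)).congr_of_eventuallyEq ?_)
  have hc : Continuous fun s : ℝ => ((s, (x - t • (v : Plane) + s • (v : Plane), v)) : ℝ × Phase) :=
    by fun_prop
  have h1 := (notMem_tsupport_iff_eventuallyEq.1 hq)
  have h2 : Tendsto (fun s : ℝ => ((s, (x - t • (v : Plane) + s • (v : Plane), v)) : ℝ × Phase))
      (𝓝 t) (𝓝 (t, (x, v))) := by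
    have := hc.tendsto t
    rwa [sub_add_cancel] at this
  filter_upwards [h2.eventually h1] with s hs using hs

lemma PerforatedTransport.IsTestFunction.exists_time_bounds {φ : ℝ × Phase → ℝ}
    (hφ : IsTestFunction φ) :
    ∃ a b : ℝ, 0 < a ∧ a < b ∧ ∀ q ∈ tsupport φ, q.1 ∈ Ioo a b := by
  have hK : IsCompact (tsupport φ) := hφ.2.1
  obtain ⟨b, hb⟩ := (hK.image continuous_fst).bddAbove
  by_cases hne : (tsupport φ).Nonempty
  · obtain ⟨q₀, hq₀, hmin⟩ := hK.exists_isMinOn hne continuous_fst.continuousOn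
    have h0 : 0 < q₀.1 := hφ.2.2 hq₀
    have hb0 : q₀.1 ≤ b := hb ⟨q₀, hq₀, rfl⟩
    refine ⟨q₀.1 / 2, b + 1, by positivity, by linarith, fun q hq => ⟨?_, ?_⟩⟩
    · have : q₀.1 ≤ q.1 := hmin hq
      linarith
    · have : q.1 ≤ b := hb ⟨q, hq, rfl⟩
      linarith
  · refine ⟨1, 2, one_pos, one_lt_two, fun q hq => absurd ⟨q, hq⟩ hne⟩

instance : IsLocallyFiniteMeasure dxdv := by unfold dxdv; infer_instance

/-- The free transport for the time given by the first coordinate preserves the measure. -/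
lemma measurePreserving_transport :
    MeasurePreserving (fun q : ℝ × Phase => (q.1, (q.2.1 + q.1 • (q.2.2 : Plane), q.2.2)))
      ((volume : Measure ℝ).prod dxdv) ((volume : Measure ℝ).prod dxdv) := by
  have hphase : ∀ t : ℝ, MeasurePreserving
      (fun p : Phase => (p.1 + t • (p.2 : Plane), p.2)) dxdv dxdv := by
    intro t
    have h1 : MeasurePreserving (fun p : Circ × Plane => (p.1, p.2 + t • (p.1 : Plane)))
        (dv.prod volume) (dv.prod volume) := by
      refine (MeasurePreserving.id dv).skew_product
        (g := fun (v : Circ) (x : Plane) => x + t • (v : Plane)) ?_ (ae_of_all _ fun v => ?_)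
      · exact Continuous.measurable (by unfold Function.uncurry; fun_prop)
      · exact (measurePreserving_add_right volume (t • (v : Plane))).map_eq
    have h2 := (Measure.measurePreserving_swap (μ := dv) (ν := (volume : Measure Plane))).comp
      (h1.comp (Measure.measurePreserving_swap (μ := (volume : Measure Plane)) (ν := dv)))
    exact h2
  refine (MeasurePreserving.id volume).skew_product
    (g := fun (t : ℝ) (p : Phase) => (p.1 + t • (p.2 : Plane), p.2)) ?_
    (ae_of_all _ fun t => (hphase t).map_eq)
  exact Continuous.measurable (by unfold Function.uncurry; fun_prop)

lemma continuousOn_limitDensity {fin : Phase → ℝ} (hfin : Continuous fin) :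
    ContinuousOn (fun q : ℝ × Phase => limitDensity fin q.1 q.2) {q | 0 < q.1} := by
  unfold limitDensity
  refine ContinuousOn.div (Continuous.continuousOn (by fun_prop))
    (Continuous.continuousOn (by fun_prop)) fun q hq => ?_
  have h : 0 < q.1 := hq
  have := Real.pi_pos
  positivity

/-- Along a characteristic the integrand of the weak formulation is the derivative of a multiple
of `φ / t`. -/
lemma integral_characteristic {φ : ℝ × Phase → ℝ} (hφ : IsTestFunction φ) (fin : Phase → ℝ)
    (p : Phase) :
    ∫ t : ℝ, (limitDensity fin t (p.1 + t • (p.2 : Plane), p.2) *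
        -transportDeriv φ (t, (p.1 + t • (p.2 : Plane), p.2)) +
      limitDensity fin t (p.1 + t • (p.2 : Plane), p.2) / t *
        φ (t, (p.1 + t • (p.2 : Plane), p.2))) = 0 := by
  obtain ⟨a, b, ha, hab, hsupp⟩ := hφ.exists_time_bounds
  set k : ℝ → ℝ := fun t => φ (t, (p.1 + t • (p.2 : Plane), p.2)) with hk
  set k' : ℝ → ℝ := fun t => transportDeriv φ (t, (p.1 + t • (p.2 : Plane), p.2)) with hk'
  have hd : ∀ t, HasDerivAt k (k' t) t := fun t => hasDerivAt_characteristic hφ p.1 p.2 t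
  have hk0 : ∀ t, t ∉ Ioo a b → k t = 0 := fun t ht =>
    image_eq_zero_of_notMem_tsupport (f := φ) fun h => ht (hsupp _ h)
  have hk'0 : ∀ t, t ∉ Ioo a b → k' t = 0 := fun t ht =>
    transportDeriv_eq_zero hφ fun h => ht (hsupp _ h)
  have hkc : Continuous k := continuous_iff_continuousAt.2 fun t => (hd t).continuousAt
  have hk'c : Continuous k' := (continuous_transportDeriv hφ).comp (by fun_prop)
  set c : ℝ := 2 * fin p / Real.pi ^ 2 with hc
  have hpi := Real.pi_pos
  have hlim : ∀ t, limitDensity fin t (p.1 + t • (p.2 : Plane), p.2) = c / t := by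
    intro t
    rw [limitDensity, hc]
    simp only [add_sub_cancel_right, Prod.mk.eta]
    rw [div_div]
  rw [← setIntegral_eq_integral_of_forall_compl_eq_zero (s := Ioc a b),
    ← intervalIntegral.integral_of_le hab.le]
  · have hderiv : ∀ t ∈ uIcc a b, HasDerivAt (fun t => -c * (k t / t))
        (limitDensity fin t (p.1 + t • (p.2 : Plane), p.2) * -k' t +
          limitDensity fin t (p.1 + t • (p.2 : Plane), p.2) / t * k t) t := by
      intro t ht
      rw [uIcc_of_le hab.le] at ht
      have ht0 : t ≠ 0 := (ha.trans_le ht.1).ne'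
      have h := ((hd t).div (hasDerivAt_id t) ht0).const_mul (-c)
      convert! h using 1
      rw [hlim]
      simp only [id]
      field_simp
      ring
    rw [intervalIntegral.integral_eq_sub_of_hasDerivAt hderiv]
    · rw [hk0 a (fun h => lt_irrefl _ h.1), hk0 b (fun h => lt_irrefl _ h.2)]
      simp
    · refine ContinuousOn.intervalIntegrable ?_
      rw [uIcc_of_le hab.le]
      simp_rw [hlim]
      have hne : ∀ t ∈ Icc a b, t ≠ 0 := fun t ht => (ha.trans_le ht.1).ne'
      have h1 : ContinuousOn (fun t : ℝ => c / t) (Icc a b) :=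
        continuousOn_const.div continuousOn_id hne
      exact (h1.mul hk'c.neg.continuousOn).add
        ((h1.div continuousOn_id hne).mul hkc.continuousOn)
  · intro t ht
    have h1 := hk0 t fun h => ht ⟨h.1, h.2.le⟩
    have h2 := hk'0 t fun h => ht ⟨h.1, h.2.le⟩
    simp only [hk, hk'] at h1 h2
    rw [h1, h2]
    simp

lemma solvesDampedTransport_limitDensity {fin : Phase → ℝ} (hfin : Continuous fin) :
    SolvesDampedTransport (limitDensity fin) := by
  have hms : MeasurableSet {q : ℝ × Phase | 0 < q.1} :=
    measurableSet_lt measurable_const measurable_fst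
  refine ⟨(continuousOn_limitDensity hfin).locallyIntegrableOn hms, fun φ hφ => ?_⟩
  set Ψ : ℝ × Phase → ℝ := fun q => limitDensity fin q.1 q.2 * -transportDeriv φ q +
    limitDensity fin q.1 q.2 / q.1 * φ q with hΨ
  have hΨ0 : ∀ q, q ∉ tsupport φ → Ψ q = 0 := fun q hq => by
    simp only [hΨ, transportDeriv_eq_zero hφ hq, image_eq_zero_of_notMem_tsupport hq]
    simp
  have hφc : Continuous φ := hφ.1.continuous
  have hΨc : ContinuousOn Ψ (tsupport φ) := by
    have h1 := (continuousOn_limitDensity hfin).mono hφ.2.2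
    refine (h1.mul (continuous_transportDeriv hφ).neg.continuousOn).add
      ((h1.div continuous_fst.continuousOn fun q hq => ?_).mul hφc.continuousOn)
    have : 0 < q.1 := hφ.2.2 hq
    exact this.ne'
  have hK : IsCompact (tsupport φ) := hφ.2.1
  have hΨi : Integrable Ψ ((volume : Measure ℝ).prod dxdv) := by
    rw [← integrableOn_iff_integrable_of_support_subset (s := tsupport φ)]
    · exact hΨc.integrableOn_compact hK
    · intro q hq
      by_contra h
      exact hq (hΨ0 q h)
  rw [setIntegral_eq_integral_of_forall_compl_eq_zero fun q hq =>
    hΨ0 q fun h => hq (hφ.2.2 h)]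
  have hT := measurePreserving_transport
  rw [← hT.map_eq, integral_map hT.measurable.aemeasurable
    (by rw [hT.map_eq]; exact hΨi.aestronglyMeasurable)]
  have hi : Integrable (fun q : ℝ × Phase => Ψ (q.1, (q.2.1 + q.1 • (q.2.2 : Plane), q.2.2)))
      ((volume : Measure ℝ).prod dxdv) := hT.integrable_comp_of_integrable hΨi
  rw [integral_prod_symm _ hi]
  refine integral_eq_zero_of_ae (ae_of_all _ fun p => ?_)
  exact integral_characteristic hφ fin p

/-! ### The asymptotics of the logarithmic averages -/

section

variable {h : Phase → ℝ}

lemma logAverage_nonneg (h0 : ∀ p, 0 ≤ h p) (t : ℝ) {ε : ℝ} (hε : ε ∈ Ioo (0 : ℝ) (1 / 4)) :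
    0 ≤ logAverage t h ε :=
  mul_nonneg (by positivity) (intervalIntegral.integral_nonneg hε.2.le fun r hr =>
    div_nonneg (freeInt_nonneg h0 t r) (hε.1.le.trans hr.1))

lemma logAverage_le (hh : Continuous h) (hc : HasCompactSupport h) (h0 : ∀ p, 0 ≤ h p) (t : ℝ)
    {ε : ℝ} (hε : ε ∈ Ioo (0 : ℝ) (1 / 4)) : logAverage t h ε ≤ ∫ v, velMass h v ∂dv := by
  obtain ⟨hε0, hε4⟩ := hε
  have hlog : 0 < |Real.log ε| := abs_pos.2 (Real.log_neg hε0 (by linarith)).ne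
  have hI : 0 ≤ ∫ v, velMass h v ∂dv := integral_nonneg (velMass_nonneg h0)
  rw [logAverage, one_div, inv_mul_le_iff₀ hlog]
  calc ∫ r in ε..(1 / 4), freeInt t h r / r
      ≤ ∫ r in ε..(1 / 4), (∫ v, velMass h v ∂dv) * r⁻¹ := by
        refine intervalIntegral.integral_mono_on hε4.le
          (intervalIntegrable_freeInt_div hh hc hε0 hε4.le le_rfl t) ?_ fun r hr => ?_
        · refine ContinuousOn.intervalIntegrable ?_
          rw [uIcc_of_le hε4.le]
          exact continuousOn_const.mul (continuousOn_id.inv₀ fun r hr => (hε0.trans_le hr.1).ne')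
        · have hr0 : 0 < r := hε0.trans_le hr.1
          rw [div_eq_mul_inv]
          exact mul_le_mul_of_nonneg_right (freeInt_le hh hc h0 hr0 t) (by positivity)
    _ = (∫ v, velMass h v ∂dv) * ∫ r in ε..(1 / 4), r⁻¹ :=
        intervalIntegral.integral_const_mul _ _
    _ ≤ (∫ v, velMass h v ∂dv) * |Real.log ε| :=
        mul_le_mul_of_nonneg_left
          (integral_inv_le hε0 (by linarith) (by norm_num) (by norm_num)) hI
    _ = |Real.log ε| * ∫ v, velMass h v ∂dv := mul_comm _ _

lemma isBoundedUnder_le_logAverage (hh : Continuous h) (hc : HasCompactSupport h)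
    (h0 : ∀ p, 0 ≤ h p) (t : ℝ) : IsBoundedUnder (· ≤ ·) (𝓝[>] 0) (logAverage t h) :=
  isBoundedUnder_of_eventually_le (a := ∫ v, velMass h v ∂dv) <| by
    filter_upwards [Ioo_mem_nhdsGT (show (0 : ℝ) < 1 / 4 by norm_num)] with ε hε
    exact logAverage_le hh hc h0 t hε

lemma isBoundedUnder_ge_logAverage (h0 : ∀ p, 0 ≤ h p) (t : ℝ) :
    IsBoundedUnder (· ≥ ·) (𝓝[>] 0) (logAverage t h) :=
  isBoundedUnder_of_eventually_ge (a := 0) <| by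
    filter_upwards [Ioo_mem_nhdsGT (show (0 : ℝ) < 1 / 4 by norm_num)] with ε hε
    exact logAverage_nonneg h0 t hε

lemma liminf_le_limsup_logAverage (hh : Continuous h) (hc : HasCompactSupport h)
    (h0 : ∀ p, 0 ≤ h p) (t : ℝ) :
    liminf (logAverage t h) (𝓝[>] 0) ≤ limsup (logAverage t h) (𝓝[>] 0) :=
  liminf_le_limsup (isBoundedUnder_le_logAverage hh hc h0 t) (isBoundedUnder_ge_logAverage h0 t)

lemma limsup_logAverage_le (hh : Continuous h) (hc : HasCompactSupport h) (h0 : ∀ p, 0 ≤ h p)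
    {t : ℝ} (ht : 6 ≤ t) : limsup (logAverage t h) (𝓝[>] 0) ≤
      2 / (Real.pi ^ 2 * (t - 5)) * ∫ v, velMass h v ∂dv :=
  le_of_forall_gt_imp_ge_of_dense fun _ hb =>
    limsup_le_of_le (isBoundedUnder_ge_logAverage h0 t).isCoboundedUnder_le
      (eventually_logAverage_le hh hc h0 ht hb)

lemma le_liminf_logAverage (hh : Continuous h) (hc : HasCompactSupport h) (h0 : ∀ p, 0 ≤ h p)
    {t : ℝ} (ht : 2 ≤ t) : 2 / (Real.pi ^ 2 * t) * ∫ v, velMass h v ∂dv ≤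
      liminf (logAverage t h) (𝓝[>] 0) :=
  le_of_forall_lt_imp_le_of_dense fun _ hb =>
    le_liminf_of_le (isBoundedUnder_le_logAverage hh hc h0 t).isCoboundedUnder_ge
      (eventually_le_logAverage hh hc h0 ht hb)

/-- Every value between the lower and the upper limit of the logarithmic average is within
`O(1 / t²)` of the predicted one, since `1 / (t - 5) - 1 / t = O(1 / t²)`. -/
lemma abs_sub_le_of_mem_Icc_liminf_limsup (hh : Continuous h) (hc : HasCompactSupport h)
    (h0 : ∀ p, 0 ≤ h p) {t : ℝ} (ht : 10 ≤ t) {M : ℝ} (hM : ∀ v, velMass h v ≤ M) {a : ℝ}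
    (ha : a ∈ Icc (liminf (logAverage t h) (𝓝[>] 0)) (limsup (logAverage t h) (𝓝[>] 0))) :
    |a - 2 / (Real.pi ^ 2 * t) * ∫ v, velMass h v ∂dv| ≤ 20 * M / t ^ 2 := by
  set I := ∫ v, velMass h v ∂dv with hI
  have hI0 : 0 ≤ I := integral_nonneg (velMass_nonneg h0)
  have hpi := Real.pi_pos
  have hpi3 := Real.pi_gt_three
  have hIM : I ≤ 2 * Real.pi * M := by
    have h1 : I ≤ ∫ _ : Circ, M ∂dv :=
      integral_mono (continuous_integrable_dv (continuous_velMass hh hc))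
        (integrable_const _) hM
    rwa [integral_const, dv_univ, smul_eq_mul] at h1
  have hM0 : 0 ≤ M := by
    have : 0 ≤ 2 * Real.pi * M := hI0.trans hIM
    exact nonneg_of_mul_nonneg_right this (by positivity)
  have h1 := (le_liminf_logAverage hh hc h0 (t := t) (by linarith)).trans ha.1
  have h2 := ha.2.trans (limsup_logAverage_le hh hc h0 (t := t) (by linarith))
  rw [← hI] at h1 h2
  have ht5 : 0 < t - 5 := by linarith
  have ht0 : 0 < t := by linarith
  rw [abs_of_nonneg (sub_nonneg.2 h1)]
  calc a - 2 / (Real.pi ^ 2 * t) * I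
      ≤ 2 / (Real.pi ^ 2 * (t - 5)) * I - 2 / (Real.pi ^ 2 * t) * I := by linarith
    _ = 10 / (Real.pi ^ 2 * (t * (t - 5))) * I := by field_simp; ring
    _ ≤ 10 / (Real.pi ^ 2 * (t ^ 2 / 2)) * (2 * Real.pi * M) := by
        gcongr
        nlinarith
    _ = 40 / Real.pi * M / t ^ 2 := by field_simp; ring
    _ ≤ 20 * M / t ^ 2 := by
        gcongr
        rw [div_le_iff₀ hpi]
        linarith

end

section

variable {fin χ : Phase → ℝ} {f : ℝ → ℝ → Phase → ℝ}

lemma testedCesaro_eventuallyEq (hf : ∀ ε ∈ Ioo (0 : ℝ) (1 / 4), IsSolution ε fin (f ε))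
    (hfin : Continuous fin) (hχ : Continuous χ) (hχc : HasCompactSupport χ) {t : ℝ} (ht : 0 < t) :
    testedCesaro f χ t =ᶠ[𝓝[>] 0] logAverage t (testProduct fin χ t) := by
  filter_upwards [Ioo_mem_nhdsGT (show (0 : ℝ) < 1 / 4 by norm_num)] with ε hε
  exact testedCesaro_eq hf hfin hχ hχc ht hε

lemma limitDensity_mul (t : ℝ) (p : Phase) :
    limitDensity fin t p * χ p = 2 / (Real.pi ^ 2 * t) * testProduct fin χ t p := by
  rw [limitDensity, testProduct]
  ring

lemma integral_limitDensity_mul (hfin : Continuous fin) (hχ : Continuous χ)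
    (hχc : HasCompactSupport χ) (t : ℝ) : ∫ p, limitDensity fin t p * χ p ∂dxdv =
      2 / (Real.pi ^ 2 * t) * ∫ v, velMass (testProduct fin χ t) v ∂dv := by
  simp_rw [limitDensity_mul]
  rw [integral_const_mul, integral_velMass (continuous_testProduct hfin hχ t)
    (hasCompactSupport_testProduct hχc t)]

lemma integrable_limitDensity_mul (hfin : Continuous fin) (hχ : Continuous χ)
    (hχc : HasCompactSupport χ) (t : ℝ) :
    Integrable (fun p => limitDensity fin t p * χ p) dxdv := by
  simp_rw [limitDensity_mul]
  exact (integrable_phase (continuous_testProduct hfin hχ t)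
    (hasCompactSupport_testProduct hχc t)).const_mul _

/-- The masses of the products `testProduct fin χ t` are bounded uniformly in the velocity and in
the time. -/
lemma exists_velMass_testProduct_le (hfin : Continuous fin) (hfinc : HasCompactSupport fin)
    (hχ : Continuous χ) (hχc : HasCompactSupport χ) (hχ0 : ∀ p, 0 ≤ χ p) :
    ∃ M, ∀ t v, velMass (testProduct fin χ t) v ≤ M := by
  obtain ⟨A, hA⟩ := hfin.bounded_above_of_compact_support hfinc
  obtain ⟨B, hB⟩ := exists_bound_velMass hχ hχc
  have hA0 : 0 ≤ A := (norm_nonneg _).trans (hA (0, ang 0))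
  refine ⟨A * B, fun t v => ?_⟩
  have hslice : ∀ {k : Phase → ℝ}, Continuous k → HasCompactSupport k →
      Integrable fun x : Plane => k (x, v) := fun {k} hk hkc => by
    obtain ⟨R, hR⟩ := exists_radius hkc
    refine Continuous.integrable_of_hasCompactSupport (by fun_prop)
      (HasCompactSupport.intro (isCompact_closedBall (0 : Plane) R) fun x hx => hR x v ?_)
    rwa [mem_closedBall_zero_iff, not_le] at hx
  calc velMass (testProduct fin χ t) v ≤ ∫ x : Plane, A * χ (x, v) := by
        refine integral_mono (hslice (continuous_testProduct hfin hχ t)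
          (hasCompactSupport_testProduct hχc t)) ((hslice hχ hχc).const_mul A) fun x => ?_
        exact mul_le_mul_of_nonneg_right ((le_abs_self _).trans (hA _)) (hχ0 _)
    _ = A * velMass χ v := integral_const_mul _ _
    _ ≤ A * B := mul_le_mul_of_nonneg_left ((le_abs_self _).trans (hB v)) hA0

/-- The estimate for the tested averages of arbitrary solutions, with absolute constants. -/
lemma abs_limsup_sub_le_and_abs_liminf_sub_le
    (hf : ∀ ε ∈ Ioo (0 : ℝ) (1 / 4), IsSolution ε fin (f ε))
    (hfin : Continuous fin) (hfin0 : ∀ p, 0 ≤ fin p) (hχ : Continuous χ)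
    (hχc : HasCompactSupport χ) (hχ0 : ∀ p, 0 ≤ χ p) {t : ℝ} (ht : 10 ≤ t) {M : ℝ}
    (hM : ∀ v, velMass (testProduct fin χ t) v ≤ M) :
    |limsup (testedCesaro f χ t) (𝓝[>] 0) - ∫ p, limitDensity fin t p * χ p ∂dxdv| ≤
        20 * M / t ^ 2 ∧
      |liminf (testedCesaro f χ t) (𝓝[>] 0) - ∫ p, limitDensity fin t p * χ p ∂dxdv| ≤
        20 * M / t ^ 2 := by
  have hev := testedCesaro_eventuallyEq hf hfin hχ hχc (t := t) (by linarith)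
  have hc := continuous_testProduct hfin hχ t
  have hcs := hasCompactSupport_testProduct (fin := fin) hχc t
  have h0 : ∀ p, 0 ≤ testProduct fin χ t p := fun p => mul_nonneg (hfin0 _) (hχ0 _)
  have hle := liminf_le_limsup_logAverage hc hcs h0 t
  rw [limsup_congr hev, liminf_congr hev, integral_limitDensity_mul hfin hχ hχc]
  exact ⟨abs_sub_le_of_mem_Icc_liminf_limsup hc hcs h0 ht hM ⟨hle, le_rfl⟩,
    abs_sub_le_of_mem_Icc_liminf_limsup hc hcs h0 ht hM ⟨le_rfl, hle⟩⟩

end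

theorem mainTheorem2 :
    ∃ C T : ℝ, 0 < C ∧ 0 < T ∧
      ∀ fin : Phase → ℝ, Continuous fin → HasCompactSupport fin → (∀ p, 0 ≤ fin p) →
        -- the initial-boundary value problem has a solution
        (∀ ε ∈ Ioo (0 : ℝ) (1 / 4), ∃ g, IsSolution ε fin g) ∧
        -- the limiting equation
        SolvesDampedTransport (limitDensity fin) ∧
        ∀ f : ℝ → ℝ → Phase → ℝ, (∀ ε ∈ Ioo (0 : ℝ) (1 / 4), IsSolution ε fin (f ε)) →
          ∀ χ : Phase → ℝ, IsC1c χ → (∀ p, 0 ≤ χ p) →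
            -- all the integrals, the limsup and the liminf below are proper ones
            (∀ t > 0,
              (∀ ε ∈ Ioo (0 : ℝ) (1 / 4),
                (∀ p, IntervalIntegrable (fun r => f r t p / r) volume ε (1 / 4)) ∧
                Integrable (fun p => cesaro f t ε p * χ p) dxdv) ∧
              IsBoundedUnder (· ≤ ·) (𝓝[>] 0) (testedCesaro f χ t) ∧
              IsBoundedUnder (· ≥ ·) (𝓝[>] 0) (testedCesaro f χ t) ∧
              Integrable (fun p => limitDensity fin t p * χ p) dxdv) ∧
            -- the asymptotics for fixed data
            (fun t : ℝ => limsup (testedCesaro f χ t) (𝓝[>] 0) -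
                ∫ p, limitDensity fin t p * χ p ∂dxdv) =O[atTop] (fun t : ℝ => 1 / t ^ 2) ∧
            (fun t : ℝ => liminf (testedCesaro f χ t) (𝓝[>] 0) -
                ∫ p, limitDensity fin t p * χ p ∂dxdv) =O[atTop] (fun t : ℝ => 1 / t ^ 2) ∧
            -- the same with absolute constants `C` and `T`
            ∀ t ≥ T, ∀ M : ℝ,
              (∀ v : Circ, ∫ x : Plane, fin (x - t • (v : Plane), v) * χ (x, v) ≤ M) →
              |limsup (testedCesaro f χ t) (𝓝[>] 0) -
                  ∫ p, limitDensity fin t p * χ p ∂dxdv| ≤ C * M / t ^ 2 ∧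
              |liminf (testedCesaro f χ t) (𝓝[>] 0) -
                  ∫ p, limitDensity fin t p * χ p ∂dxdv| ≤ C * M / t ^ 2 := by
  refine ⟨20, 10, by norm_num, by norm_num, fun fin hfin hfinc hfin0 =>
    ⟨fun ε hε => ⟨freeSol ε fin, isSolution_freeSol hε.1 fin⟩,
      solvesDampedTransport_limitDensity hfin, fun f hf χ hχ1 hχ0 => ?_⟩⟩
  obtain ⟨hχd, hχc⟩ := hχ1
  have hχ : Continuous χ := hχd.continuous
  have key : ∀ t ≥ (10 : ℝ), ∀ M : ℝ, (∀ v, velMass (testProduct fin χ t) v ≤ M) → _ :=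
    fun t ht M hM => abs_limsup_sub_le_and_abs_liminf_sub_le hf hfin hfin0 hχ hχc hχ0 ht hM
  obtain ⟨M₀, hM₀⟩ := exists_velMass_testProduct_le hfin hfinc hχ hχc hχ0
  refine ⟨fun t ht => ⟨fun ε hε => ⟨intervalIntegrable_solution hf ht hε,
      integrable_cesaro_mul hf hfin hχ hχc ht hε⟩, ?_, ?_,
      integrable_limitDensity_mul hfin hχ hχc t⟩, ?_, ?_, key⟩
  · rw [IsBoundedUnder, Filter.map_congr (testedCesaro_eventuallyEq hf hfin hχ hχc ht)]
    exact isBoundedUnder_le_logAverage (continuous_testProduct hfin hχ t)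
      (hasCompactSupport_testProduct hχc t) (fun p => mul_nonneg (hfin0 _) (hχ0 _)) t
  · rw [IsBoundedUnder, Filter.map_congr (testedCesaro_eventuallyEq hf hfin hχ hχc ht)]
    exact isBoundedUnder_ge_logAverage (fun p => mul_nonneg (hfin0 _) (hχ0 _)) t
  · refine Asymptotics.IsBigO.of_bound (20 * M₀) ?_
    filter_upwards [eventually_ge_atTop 10] with t ht
    rw [Real.norm_eq_abs, Real.norm_of_nonneg (by positivity), mul_one_div]
    exact (key t ht M₀ (hM₀ t)).1
  · refine Asymptotics.IsBigO.of_bound (20 * M₀) ?_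
    filter_upwards [eventually_ge_atTop 10] with t ht
    rw [Real.norm_eq_abs, Real.norm_of_nonneg (by positivity), mul_one_div]
    exact (key t ht M₀ (hM₀ t)).2
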